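/- Let $X$ be a partially rectangular domain: a compact region with piecewise smooth (possibly empty) boundary in a smooth Riemannian surface (a closed surface $X$ is allowed), which is a union $X=R\cup W$ where $R=[-\frac\pi2,\frac\pi2]_x\times[-\frac\pi2,\frac\pi2]_y$ is a flat rectangle, or a flat cylinder in which $y=\pm\frac\pi2$ are identified, $W$ is closed, and $R\cap W=R\cap\{x=\pm\frac\pi2\}$. For $t\in[1,2]$ let $X_t$ be $X$ with $R$ replaced by $R_t=[-\frac{t\pi}2,\frac{t\pi}2]\times[-\frac\pi2,\frac\pi2]$, and let $\Delta_t$ be the positive Laplacian on $X_t$ with the Dirichlet condition, or with the Robin condition $d_nu=\beta u$ with a constant $\beta\in\mathbb R$ and outward normal $n$ (Neumann for $\beta=0$), realized through its closed quadratic form. Let $\phi\in C_c^\infty((-\frac\pi2,\frac\pi2))$ with $\phi\ge0$ and $\int\phi=\pi$. Let $I_t:X_1\to X_t$ be the identity on $W$ and $I_t(x,y)=\bigl(-\frac{t\pi}2+\int_{-\pi/2}^x(1+(t-1)\phi(s))\,ds,\;y\bigr)$ on $R$; it is an isometry from $X_1$, with the metric $(1+(t-1)\phi)^2dx^2+dy^2$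 on $R$ (and the original metric on $W$), onto $X_t$. Put $\phi_t=\dfrac{\phi}{1+(t-1)\phi}\circ I_t^{-1}$ on $R_t$, extended by $0$ to $X_t$, and $$Q=-4\,\partial_x\phi_t\,\partial_x-[\partial_x,[\partial_x,\phi_t]],$$ an operator acting on functions on $X_t$, with coefficients vanishing outside $R_t$. Then there is a constant $C$, depending only on $\phi$, with the following property for all $X$ and all the above boundary conditions. Let $1\le a<b\le2$ and, for $t\in[a,b]$, let $u(t)$ be a real eigenfunction of $\Delta_t$ with eigenvalue $E(t)$ and $\|u(t)\|_{L^2(X_t)}=1$, depending smoothly on $t$ in the sense that $t\mapsto(1+(t-1)\phi)^{1/2}\,u(t)\circ I_t$ is a smooth map from $[a,b]$ to $L^2(X_1)$ (where $\phi$ is extended by $0$ to $W$). Then $(Qu(t))\,u(t)$ is integrable on $X_t$, $E$ is differentiable on $[a,b]$ (one-sided at the end points), and for all $t\in[a,b]$ $$\frac{dE}{dt}(t)=-\tfrac12\,\langle Qu(t),u(t)\rangle_{L^2(X_t)},\qquad \frac{dE}{dt}(t)\le C.$$ -/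

import Mathlib

open MeasureTheory Set Filter Topology
open scoped Manifold ContDiff

noncomputable section

/-! ### Riemannian geometry of a smooth surface, in coordinates -/

section Riemannian

variable {M : Type*} [TopologicalSpace M] [ChartedSpace (EuclideanSpace ℝ (Fin 2)) M]
  [IsManifold (𝓡 2) ∞ M]

/-- A smooth Riemannian metric on the surface `M`. -/
abbrev SurfaceMetric (M : Type*) [TopologicalSpace M]
    [ChartedSpace (EuclideanSpace ℝ (Fin 2)) M] [IsManifold (𝓡 2) ∞ M] :=
  Bundle.ContMDiffRiemannianMetric (𝓡 2) ∞ (EuclideanSpace ℝ (Fin 2))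
    (fun p : M => TangentSpace (𝓡 2) p)

/-- The `i`-th vector of the standard basis of `T_p M`. -/
def tangentBasis (p : M) (i : Fin 2) : TangentSpace (𝓡 2) p :=
  (EuclideanSpace.single i (1 : ℝ) : EuclideanSpace ℝ (Fin 2))

/-- The matrix of the metric at `p` in the standard basis of `T_p M`. -/
def metricMatrix (g : SurfaceMetric M) (p : M) : Matrix (Fin 2) (Fin 2) ℝ :=
  Matrix.of fun i j => g.inner p (tangentBasis p i) (tangentBasis p j)

/-- The derivative of `f` at `p` along the `i`-th vector of the standard basis of `T_p M`. -/
def partialDeriv (f : M → ℝ) (p : M) (i : Fin 2) : ℝ :=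
  mfderiv (𝓡 2) 𝓘(ℝ, ℝ) f p (tangentBasis p i)

/-- The pointwise inner product `⟨df, dh⟩_g = g^{ij} ∂_i f ∂_j h` at `p`. -/
def gradInner (g : SurfaceMetric M) (f h : M → ℝ) (p : M) : ℝ :=
  ∑ i, ∑ j, (metricMatrix g p)⁻¹ i j *
    (partialDeriv f p i * partialDeriv h p j)

/-- The components `g_{ij}` of the metric in the preferred chart at `p₀`, at the point with
coordinates `z`. -/
def chartMatrix (g : SurfaceMetric M) (p₀ : M) (z : EuclideanSpace ℝ (Fin 2)) :
    Matrix (Fin 2) (Fin 2) ℝ :=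
  Matrix.of fun i j =>
    g.inner ((extChartAt (𝓡 2) p₀).symm z)
      (mfderiv 𝓘(ℝ, EuclideanSpace ℝ (Fin 2)) (𝓡 2) (extChartAt (𝓡 2) p₀).symm z
        (tangentBasis z i))
      (mfderiv 𝓘(ℝ, EuclideanSpace ℝ (Fin 2)) (𝓡 2) (extChartAt (𝓡 2) p₀).symm z
        (tangentBasis z j))

/-- The Riemannian volume measure. In the chart at `p₀` it is `√(det g_{ij}) dz`; these local
measures agree on overlaps, and the measure on `M` is their supremum. -/
def riemannianVolume [MeasurableSpace M] (g : SurfaceMetric M) : Measure M :=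
  ⨆ p₀ : M, Measure.map (extChartAt (𝓡 2) p₀).symm
    ((volume.restrict (extChartAt (𝓡 2) p₀).target).withDensity
      fun z => ENNReal.ofReal (Real.sqrt (chartMatrix g p₀ z).det))

/-- The velocity of a curve. -/
def velocity (γ : ℝ → M) (s : ℝ) : TangentSpace (𝓡 2) (γ s) :=
  mfderivWithin 𝓘(ℝ, ℝ) (𝓡 2) γ (Icc 0 1) s (1 : ℝ)

/-- Arc length on the image of the curve `γ : [0,1] → M`. -/
def arcLength [MeasurableSpace M] (g : SurfaceMetric M) (γ : ℝ → M) : Measure M :=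
  Measure.map γ ((volume.restrict (Ioo (0 : ℝ) 1)).withDensity
    fun s => ENNReal.ofReal (Real.sqrt (g.inner (γ s) (velocity γ s) (velocity γ s))))

end Riemannian

/-! ### Partially rectangular domains -/

/-- The range of the coordinate `y` on the rectangle, each point being listed once: `[-π/2, π/2]`
for a rectangle, and a half-open period for a cylinder, where `y = ±π/2` are identified. -/
def crossSection (cylinder : Bool) : Set ℝ :=
  if cylinder then Ico (-(Real.pi / 2)) (Real.pi / 2) else Icc (-(Real.pi / 2)) (Real.pi / 2)

/-- The range of the coordinate `y`: `[-π/2, π/2]` for a rectangle, all of `ℝ` for a cylinder,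
on which functions are written as `π`-periodic functions of `y`. -/
def coordRange (cylinder : Bool) : Set ℝ :=
  if cylinder then univ else Icc (-(Real.pi / 2)) (Real.pi / 2)

/-- The interior of `coordRange`. -/
def openCoordRange (cylinder : Bool) : Set ℝ :=
  if cylinder then univ else Ioo (-(Real.pi / 2)) (Real.pi / 2)

/-- The open interval of the values of `x` on the rectangle `R_t`. -/
def xRange (t : ℝ) : Set ℝ := Ioo (-(t * (Real.pi / 2))) (t * (Real.pi / 2))

/-- A partially rectangular domain `X`, whose rectangle (or cylinder) is
`[-π/2, π/2] × [-π/2, π/2]`. It is a compact region `X`, with piecewise smooth (possibly empty)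
boundary, of a smooth Riemannian surface `M` without boundary; `X = M` is allowed. -/
structure PartiallyRectangularDomain (M : Type*) [TopologicalSpace M]
    [ChartedSpace (EuclideanSpace ℝ (Fin 2)) M] [IsManifold (𝓡 2) ∞ M] where
  metric : SurfaceMetric M
  carrier : Set M
  isCompact_carrier : IsCompact carrier
  closure_interior : closure (interior carrier) = carrier
  /-- The boundary consists of finitely many smooth regular arcs (or loops), which may meet at
  their end points only. -/
  numArcs : ℕ
  arc : Fin numArcs → ℝ → M
  arc_smooth : ∀ i, ContMDiffOn 𝓘(ℝ, ℝ) (𝓡 2) ∞ (arc i) (Icc 0 1)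
  arc_regular : ∀ i, ∀ s ∈ Icc (0 : ℝ) 1, velocity (arc i) s ≠ 0
  arc_injOn : ∀ i, InjOn (arc i) (Ioo 0 1)
  arc_disjoint : ∀ i j, i ≠ j → Disjoint (arc i '' Ioo 0 1) (arc j '' Ioo 0 1)
  arcs_cover : ⋃ i, arc i '' Icc 0 1 = frontier carrier
  /-- Whether the flat piece is a cylinder. -/
  cylinder : Bool
  /-- The parametrization of the flat piece `R` by the coordinates `(x, y)`. -/
  rect : ℝ × ℝ → M
  rect_continuousOn :
    ContinuousOn rect (Icc (-(Real.pi / 2)) (Real.pi / 2) ×ˢ coordRange cylinder)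
  rect_smooth : ContMDiffOn 𝓘(ℝ, ℝ × ℝ) (𝓡 2) ∞ rect
    (Ioo (-(Real.pi / 2)) (Real.pi / 2) ×ˢ coordRange cylinder)
  rect_isometry : ∀ q ∈ Ioo (-(Real.pi / 2)) (Real.pi / 2) ×ˢ openCoordRange cylinder,
    ∀ v w : ℝ × ℝ,
      metric.inner (rect q) (mfderiv 𝓘(ℝ, ℝ × ℝ) (𝓡 2) rect q v)
        (mfderiv 𝓘(ℝ, ℝ × ℝ) (𝓡 2) rect q w) = v.1 * w.1 + v.2 * w.2
  rect_periodic : cylinder = true →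
    ∀ x ∈ Icc (-(Real.pi / 2)) (Real.pi / 2), ∀ y, rect (x, y + Real.pi) = rect (x, y)
  rect_injOn : InjOn rect (Icc (-(Real.pi / 2)) (Real.pi / 2) ×ˢ crossSection cylinder)
  rect_mapsTo :
    MapsTo rect (Icc (-(Real.pi / 2)) (Real.pi / 2) ×ˢ crossSection cylinder) carrier
  /-- The rest `W` of the domain is closed; it meets `R` in the vertical sides only. -/
  isClosed_rest :
    IsClosed (carrier \ rect '' (Ioo (-(Real.pi / 2)) (Real.pi / 2) ×ˢ crossSection cylinder))

/-- Dirichlet condition `u = 0`, or Robin condition `∂u/∂n = b u` with the outward normal `n`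
(`b = 0` is the Neumann condition). -/
inductive BoundaryCondition where
  | dirichlet : BoundaryCondition
  | robin (b : ℝ) : BoundaryCondition

/-- The coefficient of the boundary term in the quadratic form. -/
def BoundaryCondition.coeff : BoundaryCondition → ℝ
  | .dirichlet => 0
  | .robin b => b

namespace PartiallyRectangularDomain

variable {M : Type*} [TopologicalSpace M] [ChartedSpace (EuclideanSpace ℝ (Fin 2)) M]
  [IsManifold (𝓡 2) ∞ M] (X : PartiallyRectangularDomain M)

/-- The non-rectangular part `W` of the domain, including the vertical sides of `R`. -/
def rest : Set M :=
  X.carrier \ X.rect '' (Ioo (-(Real.pi / 2)) (Real.pi / 2) ×ˢ crossSection X.cylinder)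

/-! #### The domain `X_t`

`X_t` is `X` with its rectangle replaced by `R_t = [-tπ/2, tπ/2] × [-π/2, π/2]`. Its points are the
points `Sum.inl p` with `p ∈ W`, and the points `Sum.inr (x, y)` with `|x| < tπ/2` and `y` in the
cross-section; functions on `X_t` are functions on `M ⊕ ℝ × ℝ`, of which only the values at these
points matter (and, for a cylinder, the `π`-periodic extension in `y`). The vertical sides of
`R_t` are glued to `W` through `seamMap`. -/

open Classical in
/-- The identification of `X` near `W` with `X_t` near `W`: the identity on `W`, and on the two
halves of the rectangle the translation in `x` that carries the side `x = ±π/2` to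
`x = ±tπ/2`. -/
def seamMap (t : ℝ) (p : M) : M ⊕ ℝ × ℝ :=
  if p ∈ X.rest then Sum.inl p
  else
    let q := Function.invFunOn X.rect
      (Ioo (-(Real.pi / 2)) (Real.pi / 2) ×ˢ crossSection X.cylinder) p
    Sum.inr (q.1 + Real.sign q.1 * ((t - 1) * (Real.pi / 2)), q.2)

/-- `u` is periodic in `y` if the rectangle is a cylinder. -/
def IsPeriodic (t : ℝ) (u : M ⊕ ℝ × ℝ → ℝ) : Prop :=
  X.cylinder = true →
    ∀ x ∈ xRange t, ∀ y, u (Sum.inr (x, y + Real.pi)) = u (Sum.inr (x, y))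

/-- `f` is smooth on `X_t`, up to the boundary. -/
def IsSmooth (t : ℝ) (f : M ⊕ ℝ × ℝ → ℝ) : Prop :=
  X.IsPeriodic t f ∧
  ContDiffOn ℝ ∞ (fun q => f (Sum.inr q)) (xRange t ×ˢ coordRange X.cylinder) ∧
  ∃ O : Set M, IsOpen O ∧ X.rest ⊆ O ∧
    ContMDiffOn (𝓡 2) 𝓘(ℝ, ℝ) ∞ (fun p => f (X.seamMap t p)) (X.carrier ∩ O)

/-- `u` is smooth in the interior of `X_t`. -/
def IsSmoothInside (t : ℝ) (u : M ⊕ ℝ × ℝ → ℝ) : Prop :=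
  X.IsPeriodic t u ∧
  ContDiffOn ℝ ∞ (fun q => u (Sum.inr q)) (xRange t ×ˢ openCoordRange X.cylinder) ∧
  ∃ O : Set M, IsOpen O ∧ X.rest ⊆ O ∧
    ContMDiffOn (𝓡 2) 𝓘(ℝ, ℝ) ∞ (fun p => u (X.seamMap t p)) (interior X.carrier ∩ O)

/-- `f` vanishes outside a compact subset of the interior of `X_t`. -/
def VanishesNearBoundary (t : ℝ) (f : M ⊕ ℝ × ℝ → ℝ) : Prop :=
  (∃ K : Set M, IsCompact K ∧ K ⊆ interior X.carrier ∧
    ∀ p ∈ X.carrier \ K, f (X.seamMap t p) = 0) ∧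
  (X.cylinder = false → ∃ δ > 0, ∀ x ∈ xRange t, ∀ y ∈ Icc (-(Real.pi / 2)) (Real.pi / 2),
    Real.pi / 2 - δ < |y| → f (Sum.inr (x, y)) = 0)

/-- The smooth functions whose closure is the form domain of `Δ_t`. -/
def IsTest (t : ℝ) (bc : BoundaryCondition) (f : M ⊕ ℝ × ℝ → ℝ) : Prop :=
  X.IsSmooth t f ∧ (bc = .dirichlet → X.VanishesNearBoundary t f)

variable [MeasurableSpace M]

/-- The Riemannian volume of `X_t`. -/
def vol (t : ℝ) : Measure (M ⊕ ℝ × ℝ) :=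
  Measure.map Sum.inl ((riemannianVolume X.metric).restrict X.rest) +
    Measure.map Sum.inr
      ((volume : Measure (ℝ × ℝ)).restrict (xRange t ×ˢ crossSection X.cylinder))

/-- The arc length measure of the boundary of `X_t`. -/
def boundaryMeasure (t : ℝ) : Measure (M ⊕ ℝ × ℝ) :=
  Measure.map Sum.inl ((∑ i, arcLength X.metric (X.arc i)).restrict X.rest) +
    if X.cylinder then 0
    else
      Measure.map (fun x : ℝ => Sum.inr (x, Real.pi / 2)) (volume.restrict (xRange t)) +
        Measure.map (fun x : ℝ => Sum.inr (x, -(Real.pi / 2))) (volume.restrict (xRange t))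

/-- The Dirichlet integral `∫_{X_t} ⟨∇f, ∇h⟩` of smooth functions. -/
def dirichletForm (t : ℝ) (f h : M ⊕ ℝ × ℝ → ℝ) : ℝ :=
  (∫ p in X.rest ∩ interior X.carrier,
    gradInner X.metric (fun p => f (X.seamMap t p)) (fun p => h (X.seamMap t p)) p
      ∂(riemannianVolume X.metric)) +
  ∫ q in xRange t ×ˢ Ioo (-(Real.pi / 2)) (Real.pi / 2),
    (fderiv ℝ (fun q => f (Sum.inr q)) q (1, 0) * fderiv ℝ (fun q => h (Sum.inr q)) q (1, 0) +
      fderiv ℝ (fun q => f (Sum.inr q)) q (0, 1) * fderiv ℝ (fun q => h (Sum.inr q)) q (0, 1))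

/-- The form `∫_{X_t} ⟨∇f, ∇h⟩ - b ∫_{∂X_t} f h` of the positive Laplacian `Δ_t` with the given
boundary condition. -/
def laplaceForm (t : ℝ) (bc : BoundaryCondition) (f h : M ⊕ ℝ × ℝ → ℝ) : ℝ :=
  X.dirichletForm t f h - bc.coeff * ∫ z, f z * h z ∂(X.boundaryMeasure t)

/-- `u` is a real eigenfunction of `Δ_t` with eigenvalue `E` (the representative that is smooth in
the interior): `u ≠ 0` lies in the domain of the closed form, that is, it is the `L²` limit of test
functions `f n` that form a Cauchy sequence in `H¹` (and on the boundary, when there is a boundary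
term), and `form (u, h) = E ⟨u, h⟩` for all test functions `h`. -/
structure IsEigenfunction (t : ℝ) (bc : BoundaryCondition) (u : M ⊕ ℝ × ℝ → ℝ) (E : ℝ) :
    Prop where
  memLp : MemLp u 2 (X.vol t)
  ne_zero : ¬ u =ᵐ[X.vol t] 0
  smooth : X.IsSmoothInside t u
  weak : ∃ f : ℕ → M ⊕ ℝ × ℝ → ℝ,
    (∀ n, X.IsTest t bc (f n)) ∧
    Tendsto (fun n => eLpNorm (f n - u) 2 (X.vol t)) atTop (𝓝 0) ∧
    Tendsto (fun k : ℕ × ℕ => X.dirichletForm t (f k.1 - f k.2) (f k.1 - f k.2) +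
      |bc.coeff| * ∫ z, (f k.1 z - f k.2 z) ^ 2 ∂(X.boundaryMeasure t)) atTop (𝓝 0) ∧
    ∀ h, X.IsTest t bc h →
      Tendsto (fun n => X.laplaceForm t bc (f n) h) atTop (𝓝 (E * ∫ z, u z * h z ∂(X.vol t)))

end PartiallyRectangularDomain

/-! ### The stretching profile and the operator `Q` -/

/-- An admissible profile: smooth, nonnegative, supported inside `(-π/2, π/2)`, and normalized so
that the metric `(1 + (t - 1) φ)² dx² + dy²` gives the rectangle the length `tπ`. -/
structure IsProfile (φ : ℝ → ℝ) : Prop where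
  smooth : ContDiff ℝ ∞ φ
  nonneg : ∀ x, 0 ≤ φ x
  support : tsupport φ ⊆ Ioo (-(Real.pi / 2)) (Real.pi / 2)
  integral : ∫ x, φ x = Real.pi

/-- `x ↦ -tπ/2 + ∫_{-π/2}^x (1 + (t - 1) φ)`, the isometry of the interval `(-π/2, π/2)` with the
metric `(1 + (t - 1) φ)² dx²` onto `(-tπ/2, tπ/2)`. -/
def stretch (φ : ℝ → ℝ) (t x : ℝ) : ℝ :=
  -(t * (Real.pi / 2)) + ∫ s in (-(Real.pi / 2))..x, (1 + (t - 1) * φ s)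

/-- The isometry `I_t : (X_1, g_t) → X_t`. -/
def stretchIsometry (M : Type*) (φ : ℝ → ℝ) (t : ℝ) : M ⊕ ℝ × ℝ → M ⊕ ℝ × ℝ :=
  Sum.map id fun q => (stretch φ t q.1, q.2)

/-- The density `1 + (t - 1) φ` of the volume of `g_t` with respect to that of `g_1`, on `X_1`. -/
def stretchDensity (M : Type*) (φ : ℝ → ℝ) (t : ℝ) : M ⊕ ℝ × ℝ → ℝ :=
  Sum.elim (fun _ => 1) fun q => 1 + (t - 1) * φ q.1

/-- The function `φ_t = (φ / (1 + (t - 1) φ)) ∘ I_t⁻¹` on the rectangle of `X_t`; it vanishes on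
the rest of `X_t`. -/
def stretchedProfile (φ : ℝ → ℝ) (t : ℝ) (q : ℝ × ℝ) : ℝ :=
  let x := Function.invFun (stretch φ t) q.1
  φ x / (1 + (t - 1) * φ x)

/-- The operator `∂_x`. -/
def dX (f : ℝ × ℝ → ℝ) : ℝ × ℝ → ℝ := fun q => deriv (fun s => f (s, q.2)) q.1

/-- The operator of multiplication by `a`. -/
def mulOp (a f : ℝ × ℝ → ℝ) : ℝ × ℝ → ℝ := fun q => a q * f q

/-- The commutator `[A, B]`. -/
def opCommutator (A B : (ℝ × ℝ → ℝ) → ℝ × ℝ → ℝ) (f : ℝ × ℝ → ℝ) : ℝ × ℝ → ℝ :=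
  A (B f) - B (A f)

/-- The operator `Q = -4 ∂_x φ_t ∂_x - [∂_x, [∂_x, φ_t]]` on functions on `X_t`; its coefficients
vanish outside the rectangle. -/
def operatorQ {M : Type*} (φ : ℝ → ℝ) (t : ℝ) (u : M ⊕ ℝ × ℝ → ℝ) : M ⊕ ℝ × ℝ → ℝ :=
  Sum.elim (fun _ => 0) fun q =>
    -4 * dX (mulOp (stretchedProfile φ t) (dX fun q => u (Sum.inr q))) q -
      opCommutator dX (opCommutator dX (mulOp (stretchedProfile φ t))) (fun q => u (Sum.inr q)) q

/-- The family `u(t)`, `a ≤ t ≤ b`, depends smoothly on `t`: transplanted to the fixed space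
`L²(X_1)` by the unitary maps `u ↦ (1 + (t - 1) φ)^{1/2} (u ∘ I_t)`, it is a smooth function of `t`
with values in this Hilbert space. -/
def DependsSmoothly {M : Type*} [TopologicalSpace M] [ChartedSpace (EuclideanSpace ℝ (Fin 2)) M]
    [IsManifold (𝓡 2) ∞ M] [MeasurableSpace M] (X : PartiallyRectangularDomain M) (φ : ℝ → ℝ)
    (a b : ℝ) (u : ℝ → M ⊕ ℝ × ℝ → ℝ) : Prop :=
  ∃ v : ℝ → Lp ℝ 2 (X.vol 1), ContDiffOn ℝ ∞ v (Icc a b) ∧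
    ∀ t ∈ Icc a b,
      v t =ᵐ[X.vol 1] fun z =>
        Real.sqrt (stretchDensity M φ t z) * u t (stretchIsometry M φ t z)

end

/-! Two eigenvalue equations on different domains are compared on one of them. For parameters `t`
and `s`, the map `J = I_s ∘ I_t⁻¹` carries the rectangle of `X_t` onto that of `X_s`. It is a
translation near the vertical sides, and its derivative is `r = 1 + (s - t) ψ`, where `ψ` is `φ_t`
as a function of `x` alone (`IsProfile.exists_stretched`). Let `u` and `v` be the eigenfunctions on
`X_t` and `X_s`, and `w = v ∘ J`. Test the equation of `v` with `(r⁻¹ u) ∘ J⁻¹` and the equation of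
`u` with `w`. The weight `r⁻¹` cancels the Jacobian in the `L²` pairing, in the Robin term and in
the product of `y`-derivatives, and near `W` nothing changes. Only the `x`-derivatives feel the
stretching (`laplaceForm_transport`): `(E(s) - E(t)) ⟨w, u⟩ = ∫ ∂ₓw · F`, with the flux `F = (r⁻² -
1) ∂ₓu - r' r⁻³ u`.

The flux is of order `s - t` and its support in `x` is a compact subset of the open interval, so
integration by parts in `x` gives `-∫ w ∂ₓF` with no boundary terms, whatever the boundary condition
(`IsEigenfunction.sub_mul_integral_eq`). After division by `s - t` the limit `s → t` needs only `w →
u` in `L²`. Hence only continuity of the transplanted family is used, and no derivative of `u` in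
`t` appears. The limit is `∫ u (2ψ ∂ₓ²u + 3ψ' ∂ₓu + ψ'' u)`, which differs from `-½⟨Qu, u⟩` by `½ ∫
∂ₓ(ψ' u²) = 0` (`IsEigenfunction.integral_fluxDeriv_zero`).

For the upper bound, one more integration by parts gives `-½⟨Qu, u⟩ = -2 ∫ ψ (∂ₓu)² + ½ ∫ ψ'' u²`.
The first term is nonpositive because `ψ ≥ 0`, and `ψ''` is bounded in terms of `φ` uniformly in `1
≤ t ≤ 2`.

The analytic difficulty is that `u` is smooth only in the interior, so `ψ ∂ₓ²u` has to be shown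
square integrable up to the horizontal sides. This is done by Nirenberg's difference quotients. The
map `x ↦ x + h κ(x)` is a stretching of `X_t` onto itself that respects the boundary condition, and
the same transplantation identity with `s = t` yields an energy estimate uniform in `h`
(`diffQuot_energy_le`). There the Robin term is absorbed by a trace inequality
(`integral_boundary_sq_le`). Fatou's lemma then gives `IsEigenfunction.memLp_dX_rectDirDeriv`.

Since the form domain is described by limits of smooth functions, identities and estimates are first
proved for smooth functions and then passed to the limit (`exists_tendsto_laplaceForm`,
`IsEigenfunction.exists_isApprox`). This requires that smooth functions on `X_t` have bounded values
and gradients and that volume and boundary length are finite, which is where the Riemannian part is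
used. -/

noncomputable section

set_option linter.unusedSectionVars false

section Riemannian

variable {M : Type*} [TopologicalSpace M] [ChartedSpace (EuclideanSpace ℝ (Fin 2)) M]
  [IsManifold (𝓡 2) ∞ M]

/-! ### The metric in a chart -/

/-- The vector of `T_p M` with components `v` in the chart at `p₀`. -/
def chartVector (p₀ p : M) : EuclideanSpace ℝ (Fin 2) →L[ℝ] TangentSpace (𝓡 2) p :=
  (trivializationAt (EuclideanSpace ℝ (Fin 2)) (TangentSpace (𝓡 2)) p₀).symmL ℝ p

lemma continuousOn_chartVector (p₀ : M) (v : EuclideanSpace ℝ (Fin 2)) :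
    ContinuousOn (fun p => (⟨p, chartVector p₀ p v⟩ : TangentBundle (𝓡 2) M))
      (chartAt (EuclideanSpace ℝ (Fin 2)) p₀).source := by
  set e := trivializationAt (EuclideanSpace ℝ (Fin 2)) (TangentSpace (𝓡 2) (M := M)) p₀ with he
  have h := e.continuousOn_symm
  have h2 : ContinuousOn (fun p : M => (p, v)) (chartAt (EuclideanSpace ℝ (Fin 2)) p₀).source := by
    fun_prop
  refine (h.comp h2 (fun p hp => ?_)).congr fun p hp => ?_
  · simpa [he] using hp
  · simp [chartVector]
    exact Bundle.Trivialization.symmL_apply _ (by simpa using hp) v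

lemma continuousOn_inner_chartVector (g : SurfaceMetric M) (p₀ : M)
    (v w : EuclideanSpace ℝ (Fin 2)) :
    ContinuousOn (fun p => g.inner p (chartVector p₀ p v) (chartVector p₀ p w))
      (chartAt (EuclideanSpace ℝ (Fin 2)) p₀).source := by
  intro p hp
  have hv := continuousOn_chartVector p₀ v p hp
  have hw := continuousOn_chartVector p₀ w p hp
  have hg := g.contMDiff.continuous.continuousAt (x := p)
  have := (hg.continuousWithinAt
    (s := (chartAt (EuclideanSpace ℝ (Fin 2)) p₀).source)).clm_bundle_apply₂
      (F₁ := EuclideanSpace ℝ (Fin 2)) (F₂ := EuclideanSpace ℝ (Fin 2)) hv hw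
  simp only [FiberBundle.continuousWithinAt_totalSpace] at this
  exact this.2

lemma mfderiv_extChartAt_symm_eq {p₀ p : M}
    (hp : p ∈ (chartAt (EuclideanSpace ℝ (Fin 2)) p₀).source) (v : EuclideanSpace ℝ (Fin 2)) :
    (mfderiv 𝓘(ℝ, EuclideanSpace ℝ (Fin 2)) (𝓡 2) (extChartAt (𝓡 2) p₀).symm
      (extChartAt (𝓡 2) p₀ p) v : EuclideanSpace ℝ (Fin 2)) = chartVector p₀ p v := by
  rw [chartVector, TangentBundle.symmL_trivializationAt hp]
  simp [mfderivWithin_univ]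
  rfl

lemma mfderiv_extChartAt_chartVector {p₀ p : M}
    (hp : p ∈ (chartAt (EuclideanSpace ℝ (Fin 2)) p₀).source) (v : EuclideanSpace ℝ (Fin 2)) :
    mfderiv (𝓡 2) 𝓘(ℝ, EuclideanSpace ℝ (Fin 2)) (extChartAt (𝓡 2) p₀) p (chartVector p₀ p v)
      = v := by
  rw [← TangentBundle.continuousLinearMapAt_trivializationAt hp, chartVector]
  exact Bundle.Trivialization.continuousLinearMapAt_symmL _ (by simpa using hp) v

lemma chartVector_mfderiv_extChartAt {p₀ p : M}
    (hp : p ∈ (chartAt (EuclideanSpace ℝ (Fin 2)) p₀).source) (v : TangentSpace (𝓡 2) p) :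
    chartVector p₀ p
      (mfderiv (𝓡 2) 𝓘(ℝ, EuclideanSpace ℝ (Fin 2)) (extChartAt (𝓡 2) p₀) p v) = v := by
  rw [← TangentBundle.continuousLinearMapAt_trivializationAt hp, chartVector]
  exact Bundle.Trivialization.symmL_continuousLinearMapAt _ (by simpa using hp) v

lemma inner_self_nonneg' (g : SurfaceMetric M) (p : M) (v : TangentSpace (𝓡 2) p) :
    0 ≤ g.inner p v v := by
  by_cases hv : v = 0
  · simp [hv]
  · exact (g.pos p v hv).le

/-- The Gram matrix of a pair of tangent vectors. -/
def gramMatrix (g : SurfaceMetric M) (p : M) (b : Fin 2 → TangentSpace (𝓡 2) p) :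
    Matrix (Fin 2) (Fin 2) ℝ :=
  Matrix.of fun i j => g.inner p (b i) (b j)

/-- A kernel vector `c` gives a tangent vector `∑ cᵢ bᵢ` orthogonal to every `bⱼ`, hence to itself,
so it vanishes by positivity of the metric. -/
lemma gramMatrix_det_ne_zero (g : SurfaceMetric M) (p : M) (b : Fin 2 → TangentSpace (𝓡 2) p)
    (hb : ∀ c : Fin 2 → ℝ, ∑ i, c i • b i = 0 → c = 0) : (gramMatrix g p b).det ≠ 0 := by
  intro h
  obtain ⟨c, hc, h0⟩ := Matrix.exists_mulVec_eq_zero_iff.2 h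
  refine hc (hb c ?_)
  by_contra hv
  have := g.pos p _ hv
  have h1 : ∀ i, ∑ j, g.inner p (b i) (b j) * c j = 0 := fun i => by
    have := congrFun h0 i
    simpa [Matrix.mulVec, dotProduct, gramMatrix] using this
  have h2 : g.inner p (∑ i, c i • b i) (∑ i, c i • b i) = 0 := by
    have e : ∀ i, g.inner p (b i) (∑ j, c j • b j) = 0 := fun i => by
      rw [← h1 i]; simp [mul_comm]
    simp only [Fin.sum_univ_two] at e ⊢
    simp only [map_add, map_smul, add_apply, smul_apply] at e ⊢
    simp only [smul_eq_mul] at e ⊢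
    linear_combination c 0 * e 0 + c 1 * e 1
  linarith

/-- The inverse Gram matrix turns the components of a covector into the coordinates of its dual
vector. The value on the right depends on that vector only, so `g^{ij} Lᵢ L'ⱼ` is the same in every
basis. -/
lemma gramMatrix_sum_eq (g : SurfaceMetric M) (p : M) (b : Fin 2 → TangentSpace (𝓡 2) p)
    (hb : ∀ c : Fin 2 → ℝ, ∑ i, c i • b i = 0 → c = 0)
    (L L' : TangentSpace (𝓡 2) p → ℝ) (hL' : IsLinearMap ℝ L') (c : Fin 2 → ℝ)
    (hv : ∀ i, g.inner p (∑ j, c j • b j) (b i) = L (b i)) :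
    ∑ i, ∑ j, (gramMatrix g p b)⁻¹ i j * (L (b i) * L' (b j)) = L' (∑ j, c j • b j) := by
  have hdet : IsUnit (gramMatrix g p b).det := (gramMatrix_det_ne_zero g p b hb).isUnit
  have h1 : ∀ i, L (b i) = ∑ k, c k * gramMatrix g p b k i := fun i => by
    rw [← hv i]; simp [gramMatrix, Matrix.of_apply]
  have h2 := Matrix.mul_nonsing_inv _ hdet
  have h3 : ∀ k j, ∑ i, gramMatrix g p b k i * (gramMatrix g p b)⁻¹ i j = if k = j then 1 else 0 :=
    fun k j => by rw [← Matrix.mul_apply, h2, Matrix.one_apply]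
  have h4 : L' (∑ j, c j • b j) = ∑ j, c j * L' (b j) := by
    have := map_sum hL'.mk' (fun j => c j • b j) Finset.univ
    simpa using this
  rw [h4]
  simp only [h1]
  have a00 := h3 0 0
  have a01 := h3 0 1
  have a10 := h3 1 0
  have a11 := h3 1 1
  simp only [Fin.sum_univ_two] at a00 a01 a10 a11 ⊢
  simp at a00 a01 a10 a11
  linear_combination (c 0 * L' (b 0)) * a00 + (c 0 * L' (b 1)) * a01 + (c 1 * L' (b 0)) * a10 +
    (c 1 * L' (b 1)) * a11

lemma exists_gram_dual (g : SurfaceMetric M) (p : M) (b : Fin 2 → TangentSpace (𝓡 2) p)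
    (hb : ∀ c : Fin 2 → ℝ, ∑ i, c i • b i = 0 → c = 0) (l : Fin 2 → ℝ) :
    ∃ c : Fin 2 → ℝ, ∀ i, g.inner p (∑ j, c j • b j) (b i) = l i := by
  have hdet : IsUnit (gramMatrix g p b).det := (gramMatrix_det_ne_zero g p b hb).isUnit
  refine ⟨Matrix.vecMul l (gramMatrix g p b)⁻¹, fun i => ?_⟩
  have : Matrix.vecMul (Matrix.vecMul l (gramMatrix g p b)⁻¹) (gramMatrix g p b) = l := by
    rw [Matrix.vecMul_vecMul, Matrix.nonsing_inv_mul _ hdet, Matrix.vecMul_one]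
  conv_rhs => rw [← this]
  simp [gramMatrix, Matrix.vecMul, dotProduct]

lemma tangentBasis_independent (p : M) (c : Fin 2 → ℝ) (hc : ∑ i, c i • tangentBasis p i = 0) :
    c = 0 := by
  have h : ∑ i, c i • (EuclideanSpace.single i (1 : ℝ) : EuclideanSpace ℝ (Fin 2)) = 0 := hc
  funext i
  have := congrArg (fun v : EuclideanSpace ℝ (Fin 2) => v i) h
  fin_cases i <;> simpa [Fin.sum_univ_two] using this

lemma sum_tangentBasis (p : M) (v : TangentSpace (𝓡 2) p) :
    ∃ c : Fin 2 → ℝ, v = ∑ i, c i • tangentBasis p i := by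
  have key : ∀ w : EuclideanSpace ℝ (Fin 2), w = ∑ i, w i • EuclideanSpace.single i (1 : ℝ) := by
    intro w
    ext i
    fin_cases i <;> simp [Fin.sum_univ_two]
  exact ⟨fun i => WithLp.ofLp (show EuclideanSpace ℝ (Fin 2) from v) i, key v⟩

/-- The gradient: the vector dual to a linear form. -/
lemma exists_gradient (g : SurfaceMetric M) (p : M) (L : TangentSpace (𝓡 2) p → ℝ)
    (hL : IsLinearMap ℝ L) : ∃ v, ∀ w, g.inner p v w = L w := by
  obtain ⟨c, hc⟩ := exists_gram_dual g p (tangentBasis p) (tangentBasis_independent p)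
    fun i => L (tangentBasis p i)
  refine ⟨∑ j, c j • tangentBasis p j, fun w => ?_⟩
  obtain ⟨d, rfl⟩ := sum_tangentBasis p w
  have h4 : L (∑ j, d j • tangentBasis p j) = ∑ j, d j * L (tangentBasis p j) := by
    have := map_sum hL.mk' (fun j => d j • tangentBasis p j) Finset.univ
    simpa using this
  rw [h4, map_sum]
  exact Finset.sum_congr rfl fun i _ => by rw [map_smul, hc, smul_eq_mul]

/-- The differential of a function. -/
def differential (f : M → ℝ) (p : M) : TangentSpace (𝓡 2) p →L[ℝ] ℝ :=
  mfderiv (𝓡 2) 𝓘(ℝ, ℝ) f p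

lemma isLinearMap_differential (f : M → ℝ) (p : M) : IsLinearMap ℝ (differential f p) :=
  ⟨fun a b => map_add (differential f p) a b, fun a b => map_smul (differential f p) a b⟩

/-- The coordinate-free form `dh(∇f)`. Symmetry, positivity, the bounds below and the expression in
an arbitrary chart are all deduced from it. -/
lemma gradInner_eq_of_gradient (g : SurfaceMetric M) (f h : M → ℝ) (p : M)
    (v : TangentSpace (𝓡 2) p)
    (hv : ∀ w, g.inner p v w = differential f p w) :
    gradInner g f h p = differential h p v := by
  obtain ⟨c, rfl⟩ := sum_tangentBasis p v
  exact gramMatrix_sum_eq g p (tangentBasis p) (tangentBasis_independent p)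
    (differential f p) (differential h p)
    (isLinearMap_differential h p) c fun i => hv _

lemma chartVector_single_independent {p₀ p : M}
    (hp : p ∈ (chartAt (EuclideanSpace ℝ (Fin 2)) p₀).source) (c : Fin 2 → ℝ)
    (hc : ∑ i, c i • chartVector p₀ p (EuclideanSpace.single i (1 : ℝ)) = 0) : c = 0 := by
  have h : chartVector p₀ p (∑ i, c i • EuclideanSpace.single i (1 : ℝ)) = 0 := by
    simpa using hc
  have h2 := mfderiv_extChartAt_chartVector hp (∑ i, c i • EuclideanSpace.single i (1 : ℝ))
  rw [h, map_zero] at h2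
  exact tangentBasis_independent p c h2.symm

lemma exists_sum_chartVector {p₀ p : M}
    (hp : p ∈ (chartAt (EuclideanSpace ℝ (Fin 2)) p₀).source) (v : TangentSpace (𝓡 2) p) :
    ∃ c : Fin 2 → ℝ, v = ∑ i, c i • chartVector p₀ p (EuclideanSpace.single i (1 : ℝ)) := by
  obtain ⟨c, hc⟩ := sum_tangentBasis p
    (mfderiv (𝓡 2) 𝓘(ℝ, EuclideanSpace ℝ (Fin 2)) (extChartAt (𝓡 2) p₀) p v)
  refine ⟨c, ?_⟩
  rw [← chartVector_mfderiv_extChartAt hp v, hc]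
  exact (map_sum (chartVector p₀ p) _ _).trans
    (Finset.sum_congr rfl fun i _ => map_smul (chartVector p₀ p) _ _)

/-- `⟨df, dh⟩_g` in the chart at `p₀`. -/
lemma gradInner_eq_chart (g : SurfaceMetric M) (f h : M → ℝ) {p₀ p : M}
    (hp : p ∈ (chartAt (EuclideanSpace ℝ (Fin 2)) p₀).source) :
    gradInner g f h p =
      ∑ i, ∑ j, (gramMatrix g p fun i => chartVector p₀ p (EuclideanSpace.single i (1 : ℝ)))⁻¹ i j *
        (differential f p (chartVector p₀ p (EuclideanSpace.single i (1 : ℝ))) *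
        differential h p (chartVector p₀ p (EuclideanSpace.single j (1 : ℝ)))) := by
  obtain ⟨v, hv⟩ := exists_gradient g p _ (isLinearMap_differential f p)
  rw [gradInner_eq_of_gradient g f h p v hv]
  obtain ⟨c, rfl⟩ := exists_sum_chartVector hp v
  exact (gramMatrix_sum_eq g p _ (chartVector_single_independent hp)
    (differential f p) (differential h p)
    (isLinearMap_differential h p) c fun i => hv _).symm

lemma gradInner_self_nonneg (g : SurfaceMetric M) (f : M → ℝ) (p : M) : 0 ≤ gradInner g f f p := by
  obtain ⟨v, hv⟩ := exists_gradient g p _ (isLinearMap_differential f p)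
  rw [gradInner_eq_of_gradient g f f p v hv, ← hv]
  exact inner_self_nonneg' g p v

lemma gradInner_comm (g : SurfaceMetric M) (f h : M → ℝ) (p : M) :
    gradInner g f h p = gradInner g h f p := by
  obtain ⟨v, hv⟩ := exists_gradient g p _ (isLinearMap_differential f p)
  obtain ⟨w, hw⟩ := exists_gradient g p _ (isLinearMap_differential h p)
  rw [gradInner_eq_of_gradient g f h p v hv, gradInner_eq_of_gradient g h f p w hw, ← hw, ← hv,
    g.symm]

/-- For `v = ∇f` the hypothesis reads `|v|⁴ ≤ C |v|²`, and one factor cancels. -/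
lemma gradInner_self_le (g : SurfaceMetric M) (f : M → ℝ) (p : M) (C : ℝ)
    (hC : ∀ v, differential f p v ^ 2 ≤ C * g.inner p v v) :
    gradInner g f f p ≤ C := by
  obtain ⟨v, hv⟩ := exists_gradient g p _ (isLinearMap_differential f p)
  rw [gradInner_eq_of_gradient g f f p v hv, ← hv]
  have h1 := hC v
  have h2 := inner_self_nonneg' g p v
  rw [← hv] at h1
  rcases h2.eq_or_lt with h | h
  · rw [← h]
    -- When `∇f` has length zero the claim is `0 ≤ C`; a negative `C` is refuted by any nonzero
    -- tangent vector.
    by_contra hneg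
    push Not at hneg
    obtain ⟨w, hw⟩ : ∃ w : TangentSpace (𝓡 2) p, w ≠ 0 := by
      refine ⟨tangentBasis p 0, fun h0 => ?_⟩
      have := tangentBasis_independent p ![1, 0] (by simp [h0])
      simpa using congrFun this 0
    have := hC w
    nlinarith [g.pos p w hw, sq_nonneg (differential f p w)]
  · by_contra hneg
    push Not at hneg
    nlinarith

/-- Expand `|∇f ± ∇h|² ≥ 0`. A sum on the right is enough, since only integrability is at stake. -/
lemma gradInner_sq_le (g : SurfaceMetric M) (f h : M → ℝ) (p : M) :
    |gradInner g f h p| ≤ gradInner g f f p + gradInner g h h p := by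
  obtain ⟨v, hv⟩ := exists_gradient g p _ (isLinearMap_differential f p)
  obtain ⟨w, hw⟩ := exists_gradient g p _ (isLinearMap_differential h p)
  rw [gradInner_eq_of_gradient g f h p v hv, gradInner_eq_of_gradient g f f p v hv,
    gradInner_eq_of_gradient g h h p w hw, ← hw, ← hv, ← hw]
  have h1 := inner_self_nonneg' g p (v + w)
  have h2 := inner_self_nonneg' g p (v - w)
  simp only [map_add, map_sub, add_apply, sub_apply] at h1 h2
  have h3 := g.symm p v w
  have := inner_self_nonneg' g p v
  have := inner_self_nonneg' g p w
  rw [abs_le]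
  constructor <;> linarith

end Riemannian

section Riemannian

variable {M : Type*} [TopologicalSpace M] [ChartedSpace (EuclideanSpace ℝ (Fin 2)) M]
  [IsManifold (𝓡 2) ∞ M]

/-! ### Local bounds for gradients -/

/-- No openness or unique differentiability of `S` is asked for: functions on `X_t` are smooth up to
the boundary, and their derivatives at boundary points are taken within the region. -/
lemma hasMFDerivWithinAt_of_chart {f : M → ℝ} {S : Set M} {p₀ p : M}
    (hp : p ∈ (chartAt (EuclideanSpace ℝ (Fin 2)) p₀).source)
    {f' : EuclideanSpace ℝ (Fin 2) →L[ℝ] ℝ}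
    (hf : HasFDerivWithinAt (f ∘ (extChartAt (𝓡 2) p₀).symm) f'
      ((extChartAt (𝓡 2) p₀).symm ⁻¹' S) (extChartAt (𝓡 2) p₀ p)) :
    HasMFDerivWithinAt (𝓡 2) 𝓘(ℝ, ℝ) f S p
      (f'.comp (mfderiv (𝓡 2) 𝓘(ℝ, EuclideanSpace ℝ (Fin 2)) (extChartAt (𝓡 2) p₀) p)) := by
  have h1 : HasMFDerivWithinAt (𝓡 2) 𝓘(ℝ, EuclideanSpace ℝ (Fin 2)) (extChartAt (𝓡 2) p₀)
      (S ∩ (chartAt (EuclideanSpace ℝ (Fin 2)) p₀).source) p _ :=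
    (mdifferentiableAt_extChartAt hp).hasMFDerivAt.hasMFDerivWithinAt
  have h2 := (hf.hasMFDerivWithinAt).comp p h1 (fun q hq => by
    have := (extChartAt (𝓡 2) p₀).left_inv (x := q) (by simpa using hq.2)
    simp only [mem_preimage, this]; exact hq.1)
  have hnhds : (chartAt (EuclideanSpace ℝ (Fin 2)) p₀).source ∈ 𝓝 p :=
    (chartAt (EuclideanSpace ℝ (Fin 2)) p₀).open_source.mem_nhds hp
  have h3 := h2.congr_of_eventuallyEq (f₁ := f) (by
    filter_upwards [self_mem_nhdsWithin] with q hq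
    have := (extChartAt (𝓡 2) p₀).left_inv (x := q) (by simpa using hq.2)
    simp only [Function.comp, this]) (by
    have := (extChartAt (𝓡 2) p₀).left_inv (x := p) (by simpa using hp)
    simp only [Function.comp, this])
  exact (hasMFDerivWithinAt_inter hnhds).1 h3

lemma differential_chartVector {f : M → ℝ} {p₀ p : M}
    (hp : p ∈ (chartAt (EuclideanSpace ℝ (Fin 2)) p₀).source)
    (hf : DifferentiableAt ℝ (f ∘ (extChartAt (𝓡 2) p₀).symm) (extChartAt (𝓡 2) p₀ p))
    (v : EuclideanSpace ℝ (Fin 2)) :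
    differential f p (chartVector p₀ p v) =
      fderiv ℝ (f ∘ (extChartAt (𝓡 2) p₀).symm) (extChartAt (𝓡 2) p₀ p) v := by
  have h := hasMFDerivWithinAt_of_chart (S := univ) hp (f := f) (by
    simpa using hf.hasFDerivAt)
  rw [differential, (hasMFDerivWithinAt_univ.1 h).mfderiv]
  exact congrArg _ (mfderiv_extChartAt_chartVector hp v)

lemma continuousOn_gramMatrix_inv (g : SurfaceMetric M) (p₀ : M) (i j : Fin 2) :
    ContinuousOn (fun p => (gramMatrix g p
        fun i => chartVector p₀ p (EuclideanSpace.single i (1 : ℝ)))⁻¹ i j)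
      (chartAt (EuclideanSpace ℝ (Fin 2)) p₀).source := by
  have h : ContinuousOn (fun p => gramMatrix g p
      fun i => chartVector p₀ p (EuclideanSpace.single i (1 : ℝ)))
      (chartAt (EuclideanSpace ℝ (Fin 2)) p₀).source :=
    continuousOn_pi.2 fun i => continuousOn_pi.2 fun j => continuousOn_inner_chartVector g p₀ _ _
  have hdet : ContinuousOn (fun p => (gramMatrix g p
      fun i => chartVector p₀ p (EuclideanSpace.single i (1 : ℝ))).det)
      (chartAt (EuclideanSpace ℝ (Fin 2)) p₀).source :=
    (continuous_id.matrix_det).comp_continuousOn h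
  have hadj : ContinuousOn (fun p => (gramMatrix g p
      fun i => chartVector p₀ p (EuclideanSpace.single i (1 : ℝ))).adjugate i j)
      (chartAt (EuclideanSpace ℝ (Fin 2)) p₀).source :=
    (continuous_id.matrix_adjugate.matrix_elem i j).comp_continuousOn h
  refine ((hdet.inv₀ fun p hp => gramMatrix_det_ne_zero g p _
    (chartVector_single_independent hp)).mul hadj).congr fun p hp => ?_
  simp [Matrix.inv_def]

/-- The standard basis of `T_p M` comes from the preferred chart at `p`, which may jump with `p`, so
the individual entries of `metricMatrix` and `partialDeriv` need not be continuous. Near each point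
the invariant expression is rewritten in one fixed chart, where every factor is. -/
lemma continuousOn_gradInner (g : SurfaceMetric M) {f h : M → ℝ} {U : Set M} (hU : IsOpen U)
    (hf : ContMDiffOn (𝓡 2) 𝓘(ℝ, ℝ) ∞ f U) (hh : ContMDiffOn (𝓡 2) 𝓘(ℝ, ℝ) ∞ h U) :
    ContinuousOn (gradInner g f h) U := by
  intro p₀ hp₀
  have hsrc := (chartAt (EuclideanSpace ℝ (Fin 2)) p₀).open_source
  have hmem : p₀ ∈ U ∩ (chartAt (EuclideanSpace ℝ (Fin 2)) p₀).source :=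
    ⟨hp₀, mem_chart_source _ p₀⟩
  have hopen : IsOpen ((extChartAt (𝓡 2) p₀).target ∩ (extChartAt (𝓡 2) p₀).symm ⁻¹' U) :=
    (continuousOn_extChartAt_symm p₀).isOpen_inter_preimage (isOpen_extChartAt_target p₀) hU
  have key : ∀ f : M → ℝ, ContMDiffOn (𝓡 2) 𝓘(ℝ, ℝ) ∞ f U → ∀ v,
      ContinuousOn (fun p => differential f p (chartVector p₀ p v))
        (U ∩ (chartAt (EuclideanSpace ℝ (Fin 2)) p₀).source) := by
    intro f hf v
    have h1 : ContDiffOn ℝ ∞ (f ∘ (extChartAt (𝓡 2) p₀).symm)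
        ((extChartAt (𝓡 2) p₀).target ∩ (extChartAt (𝓡 2) p₀).symm ⁻¹' U) := by
      rw [← contMDiffOn_iff_contDiffOn]
      exact hf.comp ((contMDiffOn_extChartAt_symm p₀).mono inter_subset_left) fun z hz => hz.2
    have h2 : ContinuousOn (fun z => fderiv ℝ (f ∘ (extChartAt (𝓡 2) p₀).symm) z v)
        ((extChartAt (𝓡 2) p₀).target ∩ (extChartAt (𝓡 2) p₀).symm ⁻¹' U) :=
      (h1.continuousOn_fderiv_of_isOpen hopen (by simp)).clm_apply continuousOn_const
    have hmaps : MapsTo (extChartAt (𝓡 2) p₀) (U ∩ (chartAt (EuclideanSpace ℝ (Fin 2)) p₀).source)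
        ((extChartAt (𝓡 2) p₀).target ∩ (extChartAt (𝓡 2) p₀).symm ⁻¹' U) := fun p hp => by
      have h3 : p ∈ (extChartAt (𝓡 2) p₀).source := by simpa using hp.2
      refine ⟨(extChartAt (𝓡 2) p₀).map_source h3, ?_⟩
      rw [mem_preimage, (extChartAt (𝓡 2) p₀).left_inv h3]
      exact hp.1
    have h4 : ContinuousOn (extChartAt (𝓡 2) p₀)
        (U ∩ (chartAt (EuclideanSpace ℝ (Fin 2)) p₀).source) :=
      (continuousOn_extChartAt p₀).mono (by rw [extChartAt_source]; exact inter_subset_right)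
    refine (h2.comp h4 hmaps).congr fun p hp => ?_
    exact differential_chartVector hp.2
      ((h1.contDiffAt (hopen.mem_nhds (hmaps hp))).differentiableAt (by simp)) v
  have : ContinuousOn (gradInner g f h) (U ∩ (chartAt (EuclideanSpace ℝ (Fin 2)) p₀).source) := by
    refine ContinuousOn.congr ?_ fun p hp => gradInner_eq_chart g f h hp.2
    refine continuousOn_finsetSum _ fun i _ => continuousOn_finsetSum _ fun j _ => ?_
    exact ((continuousOn_gramMatrix_inv g p₀ i j).mono inter_subset_right).mul
      ((key f hf _).mul (key h hh _))
  exact (this.continuousAt ((hU.inter hsrc).mem_nhds hmem)).continuousWithinAt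

/-- The components of a tangent vector in the chart at `p₀`. -/
def chartComponents (p₀ p : M) : TangentSpace (𝓡 2) p →L[ℝ] EuclideanSpace ℝ (Fin 2) :=
  mfderiv (𝓡 2) 𝓘(ℝ, EuclideanSpace ℝ (Fin 2)) (extChartAt (𝓡 2) p₀) p

/-- The metric is locally bounded below by the Euclidean metric of a chart. -/
lemma exists_mfderiv_extChartAt_sq_le (g : SurfaceMetric M) (p₀ : M) :
    ∃ C, 0 ≤ C ∧ ∀ᶠ p in 𝓝 p₀, ∀ v : TangentSpace (𝓡 2) p,
      ‖chartComponents p₀ p v‖ ^ 2 ≤ C * g.inner p v v := by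
  set G : M → Matrix (Fin 2) (Fin 2) ℝ := fun p => gramMatrix g p
      fun i => chartVector p₀ p (EuclideanSpace.single i (1 : ℝ)) with hG
  have hsrc : (chartAt (EuclideanSpace ℝ (Fin 2)) p₀).source ∈ 𝓝 p₀ :=
    (chartAt (EuclideanSpace ℝ (Fin 2)) p₀).open_source.mem_nhds (mem_chart_source _ p₀)
  have hc : ∀ i j, ContinuousAt (fun p => G p i j) p₀ := fun i j =>
    (continuousOn_inner_chartVector g p₀ _ _).continuousAt hsrc
  -- Trace over determinant bounds the reciprocal of the smaller eigenvalue of the Gram matrix, and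
  -- it is continuous at `p₀`.
  have hdet : ContinuousAt (fun p => (G p 0 0 + G p 1 1) / (G p 0 0 * G p 1 1 - G p 0 1 * G p 1 0))
      p₀ := by
    refine ((hc 0 0).add (hc 1 1)).div₀ (((hc 0 0).mul (hc 1 1)).sub ((hc 0 1).mul (hc 1 0))) ?_
    rw [← Matrix.det_fin_two]
    exact gramMatrix_det_ne_zero g p₀ _ (chartVector_single_independent (mem_chart_source _ p₀))
  refine ⟨|(G p₀ 0 0 + G p₀ 1 1) / (G p₀ 0 0 * G p₀ 1 1 - G p₀ 0 1 * G p₀ 1 0)| + 1, by positivity,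
    ?_⟩
  filter_upwards [hsrc, hdet.abs.eventually (gt_mem_nhds (lt_add_one _))] with p hp hlt v
  obtain ⟨c, hc⟩ := exists_sum_chartVector hp v
  have hw : chartComponents p₀ p v = ∑ i, c i • EuclideanSpace.single i (1 : ℝ) := by
    rw [hc]
    have := mfderiv_extChartAt_chartVector hp (∑ i, c i • EuclideanSpace.single i (1 : ℝ))
    rw [map_sum] at this
    simp only [map_smul] at this
    exact this
  have hn : ‖∑ i, c i • (EuclideanSpace.single i (1 : ℝ) : EuclideanSpace ℝ (Fin 2))‖ ^ 2
      = c 0 ^ 2 + c 1 ^ 2 := by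
    rw [EuclideanSpace.norm_sq_eq]
    simp [Fin.sum_univ_two]
  have hg : g.inner p v v = G p 0 0 * c 0 ^ 2 + (G p 0 1 + G p 1 0) * (c 0 * c 1)
      + G p 1 1 * c 1 ^ 2 := by
    rw [hc]
    simp only [Fin.sum_univ_two, map_add, map_smul, add_apply, smul_apply, smul_eq_mul]
    simp only [hG, gramMatrix, Matrix.of_apply]
    ring
  have hsym : G p 0 1 = G p 1 0 := g.symm p _ _
  have hposd := gramMatrix_det_ne_zero g p _ (chartVector_single_independent hp)
  change (G p).det ≠ 0 at hposd
  rw [Matrix.det_fin_two] at hposd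
  have h0 : 0 ≤ G p 0 0 := inner_self_nonneg' g p _
  have h1 : 0 ≤ G p 1 1 := inner_self_nonneg' g p _
  have hgn := inner_self_nonneg' g p v
  have hdpos : 0 < G p 0 0 * G p 1 1 - G p 0 1 * G p 1 0 := by
    refine lt_of_le_of_ne ?_ hposd.symm
    have hq : ∀ x y : ℝ, 0 ≤ G p 0 0 * x ^ 2 + (G p 0 1 + G p 1 0) * (x * y) + G p 1 1 * y ^ 2 := by
      intro x y
      have := inner_self_nonneg' g p (x • chartVector p₀ p (EuclideanSpace.single 0 (1 : ℝ)) +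
        y • chartVector p₀ p (EuclideanSpace.single 1 (1 : ℝ)))
      simp only [map_add, map_smul, add_apply, smul_apply, smul_eq_mul] at this
      simp only [hG, gramMatrix, Matrix.of_apply]
      linarith
    -- The vector `(G₀₁, -G₀₀)` shows `G₀₀ det G ≥ 0`. If `G₀₀ = 0`, the vector `(G₁₁ + 1, -G₀₁)`
    -- forces `G₀₁ = 0`.
    rcases h0.eq_or_lt with h | h
    · have := hq (G p 1 1 + 1) (-(G p 0 1))
      rw [← h, ← hsym] at this ⊢
      nlinarith
    · have := hq (G p 0 1) (-(G p 0 0))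
      rw [← hsym] at this ⊢
      have h5 : 0 ≤ G p 0 0 * (G p 0 0 * G p 1 1 - G p 0 1 * G p 0 1) := by nlinarith
      exact nonneg_of_mul_nonneg_right h5 h
  rw [hw, hn]
  have h6 : c 0 ^ 2 + c 1 ^ 2 ≤
      (G p 0 0 + G p 1 1) / (G p 0 0 * G p 1 1 - G p 0 1 * G p 1 0) * g.inner p v v := by
    -- Cayley–Hamilton for a symmetric 2×2 matrix: `tr G · cᵀGc - det G · |c|² = |Gc|² ≥ 0`.
    rw [div_mul_eq_mul_div, le_div_iff₀ hdpos, hg, ← hsym]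
    nlinarith [sq_nonneg (G p 0 0 * c 0 + G p 0 1 * c 1), sq_nonneg (G p 0 1 * c 0 + G p 1 1 * c 1)]
  exact h6.trans (mul_le_mul_of_nonneg_right ((le_abs_self _).trans hlt.le) hgn)

/-- A function that is smooth on `S` has locally bounded derivatives within `S`. -/
lemma exists_hasMFDerivWithinAt_bound (g : SurfaceMetric M) {f : M → ℝ} {S : Set M}
    (hf : ContMDiffOn (𝓡 2) 𝓘(ℝ, ℝ) ∞ f S) {p₀ : M} (hp₀ : p₀ ∈ S) :
    ∃ C, 0 ≤ C ∧ ∀ᶠ p in 𝓝[S] p₀, ∃ L : TangentSpace (𝓡 2) p →L[ℝ] ℝ,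
      HasMFDerivWithinAt (𝓡 2) 𝓘(ℝ, ℝ) f S p L ∧ ∀ v, (L v) ^ 2 ≤ C * g.inner p v v := by
  obtain ⟨C, hC0, hC⟩ := exists_mfderiv_extChartAt_sq_le g p₀
  have h1 := ((contMDiffWithinAt_iff.1 (hf p₀ hp₀)).2).of_le (m := 0 + 1) (by simp)
  simp only [extChartAt_model_space_eq_id, PartialEquiv.refl_coe, Function.id_comp,
    modelWithCornersSelf_coe, range_id, inter_univ] at h1
  obtain ⟨u, hu, -, -, f', hd, hcont⟩ :=
    (contDiffWithinAt_succ_iff_hasFDerivWithinAt' (by simp)).1 h1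
  have hz : extChartAt (𝓡 2) p₀ p₀ ∈ (extChartAt (𝓡 2) p₀).symm ⁻¹' S := by
    simpa using hp₀
  rw [insert_eq_of_mem hz] at hu
  have hb : ∀ᶠ z in 𝓝[(extChartAt (𝓡 2) p₀).symm ⁻¹' S] (extChartAt (𝓡 2) p₀ p₀),
      ‖f' z‖ < ‖f' (extChartAt (𝓡 2) p₀ p₀)‖ + 1 :=
    hcont.continuousWithinAt.norm.eventually (gt_mem_nhds (lt_add_one _))
  have htend : Tendsto (extChartAt (𝓡 2) p₀) (𝓝[S] p₀)
      (𝓝[(extChartAt (𝓡 2) p₀).symm ⁻¹' S] (extChartAt (𝓡 2) p₀ p₀)) := by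
    refine tendsto_nhdsWithin_iff.2 ⟨(continuousAt_extChartAt p₀).tendsto.mono_left
      nhdsWithin_le_nhds, ?_⟩
    filter_upwards [self_mem_nhdsWithin, nhdsWithin_le_nhds (extChartAt_source_mem_nhds (I := 𝓡 2) p₀)]
      with p hp hps
    rw [mem_preimage, (extChartAt (𝓡 2) p₀).left_inv hps]
    exact hp
  set K := ‖f' (extChartAt (𝓡 2) p₀ p₀)‖ + 1 with hK
  refine ⟨K ^ 2 * C, by positivity, ?_⟩
  filter_upwards [htend.eventually hb, htend.eventually hu, nhdsWithin_le_nhds hC,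
    nhdsWithin_le_nhds (extChartAt_source_mem_nhds (I := 𝓡 2) p₀)] with p hp1 hp2 hp3 hp4
  rw [extChartAt_source] at hp4
  refine ⟨_, hasMFDerivWithinAt_of_chart hp4 (hd _ hp2), fun v => ?_⟩
  have h5 := (f' (extChartAt (𝓡 2) p₀ p)).le_opNorm
    (chartComponents p₀ p v)
  change (f' (extChartAt (𝓡 2) p₀ p)
    (chartComponents p₀ p v)) ^ 2 ≤ _
  rw [← sq_abs, ← Real.norm_eq_abs]
  calc _ ≤ (‖f' (extChartAt (𝓡 2) p₀ p)‖ * ‖chartComponents p₀ p v‖) ^ 2 := by gcongr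
    _ = ‖f' (extChartAt (𝓡 2) p₀ p)‖ ^ 2 * ‖chartComponents p₀ p v‖ ^ 2 := by ring
    _ ≤ K ^ 2 * (C * g.inner p v v) := by
        have := hp3 v
        have h6 : ‖f' (extChartAt (𝓡 2) p₀ p)‖ ^ 2 ≤ K ^ 2 := by gcongr
        exact mul_le_mul h6 this (by positivity) (by positivity)
    _ = _ := by ring

end Riemannian

section Riemannian

variable {M : Type*} [TopologicalSpace M] [ChartedSpace (EuclideanSpace ℝ (Fin 2)) M]
  [IsManifold (𝓡 2) ∞ M]

/-! ### Finiteness of the Riemannian volume and of arc length -/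

lemma chartMatrix_eq_gramMatrix (g : SurfaceMetric M) (p₀ : M) {z : EuclideanSpace ℝ (Fin 2)}
    (hz : z ∈ (extChartAt (𝓡 2) p₀).target) :
    chartMatrix g p₀ z = gramMatrix g ((extChartAt (𝓡 2) p₀).symm z)
      fun i => chartVector p₀ ((extChartAt (𝓡 2) p₀).symm z)
        (EuclideanSpace.single i (1 : ℝ)) := by
  have hp : (extChartAt (𝓡 2) p₀).symm z ∈ (chartAt (EuclideanSpace ℝ (Fin 2)) p₀).source := by
    rw [← extChartAt_source (I := 𝓡 2)]
    exact (extChartAt (𝓡 2) p₀).map_target hz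
  have key : ∀ i, (mfderiv 𝓘(ℝ, EuclideanSpace ℝ (Fin 2)) (𝓡 2) (extChartAt (𝓡 2) p₀).symm z
        (tangentBasis z i)) = chartVector p₀ ((extChartAt (𝓡 2) p₀).symm z)
        (EuclideanSpace.single i (1 : ℝ)) := fun i => by
    have := mfderiv_extChartAt_symm_eq hp (EuclideanSpace.single i (1 : ℝ))
    rw [(extChartAt (𝓡 2) p₀).right_inv hz] at this
    exact this
  ext i j
  simp only [chartMatrix, gramMatrix, Matrix.of_apply]
  rw [key, key]

lemma continuousOn_chartMatrix_det (g : SurfaceMetric M) (p₀ : M) :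
    ContinuousOn (fun z => (chartMatrix g p₀ z).det) (extChartAt (𝓡 2) p₀).target := by
  have h : ContinuousOn (fun p => gramMatrix g p
      fun i => chartVector p₀ p (EuclideanSpace.single i (1 : ℝ)))
      (chartAt (EuclideanSpace ℝ (Fin 2)) p₀).source :=
    continuousOn_pi.2 fun i => continuousOn_pi.2 fun j => continuousOn_inner_chartVector g p₀ _ _
  have hdet : ContinuousOn (fun p => (gramMatrix g p
      fun i => chartVector p₀ p (EuclideanSpace.single i (1 : ℝ))).det)
      (chartAt (EuclideanSpace ℝ (Fin 2)) p₀).source :=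
    (continuous_id.matrix_det).comp_continuousOn h
  refine (hdet.comp (continuousOn_extChartAt_symm p₀) fun z hz => ?_).congr fun z hz => ?_
  · rw [← extChartAt_source (I := 𝓡 2)]
    exact (extChartAt (𝓡 2) p₀).map_target hz
  · simp only [chartMatrix_eq_gramMatrix g p₀ hz, Function.comp]

/-- The transition between two charts. -/
lemma hasFDerivAt_transition (g : SurfaceMetric M) (p₀ p₁ : M) {z : EuclideanSpace ℝ (Fin 2)}
    (hz : z ∈ (extChartAt (𝓡 2) p₁).target)
    (hz' : (extChartAt (𝓡 2) p₁).symm z ∈ (extChartAt (𝓡 2) p₀).source) :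
    ∃ T : EuclideanSpace ℝ (Fin 2) →L[ℝ] EuclideanSpace ℝ (Fin 2),
      HasFDerivAt (extChartAt (𝓡 2) p₀ ∘ (extChartAt (𝓡 2) p₁).symm) T z ∧
      (chartMatrix g p₁ z).det = T.det ^ 2 *
        (chartMatrix g p₀ (extChartAt (𝓡 2) p₀ ((extChartAt (𝓡 2) p₁).symm z))).det := by
  set p := (extChartAt (𝓡 2) p₁).symm z with hp
  have hp0 : p ∈ (chartAt (EuclideanSpace ℝ (Fin 2)) p₀).source := by simpa using hz'
  have hp1 : p ∈ (chartAt (EuclideanSpace ℝ (Fin 2)) p₁).source := by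
    rw [← extChartAt_source (I := 𝓡 2)]
    exact (extChartAt (𝓡 2) p₁).map_target hz
  have hzp : extChartAt (𝓡 2) p₁ p = z := (extChartAt (𝓡 2) p₁).right_inv hz
  let T : EuclideanSpace ℝ (Fin 2) →L[ℝ] EuclideanSpace ℝ (Fin 2) :=
    (chartComponents p₀ p).comp (chartVector p₁ p)
  have hT : ∀ v, chartVector p₀ p (T v) = chartVector p₁ p v := fun v =>
    chartVector_mfderiv_extChartAt hp0 _
  refine ⟨T, ?_, ?_⟩
  · have h1 : HasMFDerivAt (𝓡 2) 𝓘(ℝ, EuclideanSpace ℝ (Fin 2)) (extChartAt (𝓡 2) p₀) p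
        (mfderiv (𝓡 2) 𝓘(ℝ, EuclideanSpace ℝ (Fin 2)) (extChartAt (𝓡 2) p₀) p) :=
      (mdifferentiableAt_extChartAt hp0).hasMFDerivAt
    have h2 : HasMFDerivAt 𝓘(ℝ, EuclideanSpace ℝ (Fin 2)) (𝓡 2) (extChartAt (𝓡 2) p₁).symm z
        (mfderiv 𝓘(ℝ, EuclideanSpace ℝ (Fin 2)) (𝓡 2) (extChartAt (𝓡 2) p₁).symm z) := by
      have := mdifferentiableWithinAt_extChartAt_symm (I := 𝓡 2) hz
      simp only [modelWithCornersSelf_coe, range_id, mdifferentiableWithinAt_univ] at this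
      exact this.hasMFDerivAt
    have h3 := (h1.comp z h2).hasFDerivAt
    have hTeq : T = (chartComponents p₀ p).comp (mfderiv 𝓘(ℝ, EuclideanSpace ℝ (Fin 2)) (𝓡 2)
        (extChartAt (𝓡 2) p₁).symm z) := by
      ext1 v
      have := mfderiv_extChartAt_symm_eq hp1 v
      rw [hzp] at this
      exact congrArg (chartComponents p₀ p) this.symm
    rw [hTeq]
    exact h3
  · have hz0 : extChartAt (𝓡 2) p₀ p ∈ (extChartAt (𝓡 2) p₀).target :=
      (extChartAt (𝓡 2) p₀).map_source hz'
    have e0 : (extChartAt (𝓡 2) p₀).symm (extChartAt (𝓡 2) p₀ p) = p :=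
      (extChartAt (𝓡 2) p₀).left_inv hz'
    rw [chartMatrix_eq_gramMatrix g p₁ hz, chartMatrix_eq_gramMatrix g p₀ hz0, e0, ← hp]
    let P : Matrix (Fin 2) (Fin 2) ℝ := Matrix.of fun i j => T (EuclideanSpace.single j 1) i
    have hPdet : P.det = T.det := by
      rw [ContinuousLinearMap.det, ← LinearMap.det_toMatrix (EuclideanSpace.basisFun (Fin 2) ℝ).toBasis]
      congr 1
    -- The congruence law `G₁ = Pᵀ G₀ P`, which is the source of the squared determinant.
    have hmul : gramMatrix g p (fun i => chartVector p₁ p (EuclideanSpace.single i (1 : ℝ))) =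
        P.transpose * gramMatrix g p (fun i => chartVector p₀ p (EuclideanSpace.single i (1 : ℝ)))
          * P := by
      have hTe : ∀ i, chartVector p₁ p (EuclideanSpace.single i (1 : ℝ)) =
          ∑ k, P k i • chartVector p₀ p (EuclideanSpace.single k (1 : ℝ)) := fun i => by
        rw [← hT]
        obtain h := (EuclideanSpace.basisFun (Fin 2) ℝ).sum_repr (T (EuclideanSpace.single i (1 : ℝ)))
        conv_lhs => rw [← h]
        rw [map_sum]
        simp [P]
      ext i j
      simp only [gramMatrix, Matrix.of_apply, hTe, Matrix.mul_apply, Matrix.transpose_apply,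
        Fin.sum_univ_two, map_add, map_smul, add_apply, smul_apply, smul_eq_mul]
      ring
    rw [hmul, Matrix.det_mul, Matrix.det_mul, Matrix.det_transpose, hPdet]
    ring

/-- The measure `√(det g_{ij}) dz` of the chart at `p₀`. -/
def chartVolume [MeasurableSpace M] (g : SurfaceMetric M) (p₀ : M) : Measure M :=
  Measure.map (extChartAt (𝓡 2) p₀).symm
    ((volume.restrict (extChartAt (𝓡 2) p₀).target).withDensity
      fun z => ENNReal.ofReal (Real.sqrt (chartMatrix g p₀ z).det))

lemma chartVolume_apply [MeasurableSpace M] [BorelSpace M] (g : SurfaceMetric M) (p₀ : M)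
    {A : Set M} (hA : MeasurableSet A) :
    chartVolume g p₀ A =
      ∫⁻ z in (extChartAt (𝓡 2) p₀).target ∩ (extChartAt (𝓡 2) p₀).symm ⁻¹' A,
        ENNReal.ofReal (Real.sqrt (chartMatrix g p₀ z).det) := by
  have htm : MeasurableSet (extChartAt (𝓡 2) p₀).target := (isOpen_extChartAt_target p₀).measurableSet
  have hsymm : AEMeasurable (extChartAt (𝓡 2) p₀).symm
      ((volume : Measure (EuclideanSpace ℝ (Fin 2))).restrict (extChartAt (𝓡 2) p₀).target) :=
    (continuousOn_extChartAt_symm p₀).aemeasurable htm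
  have hnull : NullMeasurableSet ((extChartAt (𝓡 2) p₀).symm ⁻¹' A)
      ((volume : Measure (EuclideanSpace ℝ (Fin 2))).restrict (extChartAt (𝓡 2) p₀).target) :=
    hsymm.nullMeasurable hA
  rw [chartVolume, Measure.map_apply_of_aemeasurable
      (hsymm.mono_ac (withDensity_absolutelyContinuous _ _)) hA,
    withDensity_apply₀ _ hnull, Measure.restrict_restrict₀ hnull, inter_comm]

/-- Change of variables by the transition map, whose Jacobian is exactly the quotient of the two
densities. Only an inequality holds in general, because `A` may leave the domain of the chart at
`p₁`. -/
lemma chartVolume_le [MeasurableSpace M] [BorelSpace M] (g : SurfaceMetric M) (p₀ p₁ : M)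
    {A : Set M} (hA : MeasurableSet A) (hA₀ : A ⊆ (extChartAt (𝓡 2) p₀).source) :
    chartVolume g p₁ A ≤ chartVolume g p₀ A := by
  rw [chartVolume_apply g p₀ hA, chartVolume_apply g p₁ hA]
  classical
  set S₁ := (extChartAt (𝓡 2) p₁).target ∩ (extChartAt (𝓡 2) p₁).symm ⁻¹' A with hS₁
  have hS₁m : MeasurableSet S₁ := by
    have h := (continuousOn_extChartAt_symm (I := 𝓡 2) p₁).measurable_piecewise
      (g := fun _ => p₁) (s := (extChartAt (𝓡 2) p₁).target) continuousOn_const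
      (isOpen_extChartAt_target p₁).measurableSet
    have h2 := (isOpen_extChartAt_target (I := 𝓡 2) p₁).measurableSet.inter (h hA)
    convert h2 using 1
    ext z
    simp only [hS₁, mem_inter_iff, mem_preimage]
    refine and_congr_right fun hz => ?_
    rw [piecewise_eq_of_mem _ _ _ hz]
  have hT := fun z (hz : z ∈ S₁) => hasFDerivAt_transition g p₀ p₁ hz.1 (hA₀ hz.2)
  choose! T hT hdet using hT
  set ψ := extChartAt (𝓡 2) p₀ ∘ (extChartAt (𝓡 2) p₁).symm with hψ
  have hinj : InjOn ψ S₁ := fun z hz w hw h => by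
    have h1 := (extChartAt (𝓡 2) p₀).injOn (hA₀ hz.2) (hA₀ hw.2) h
    exact (extChartAt (𝓡 2) p₁).symm.injOn hz.1 hw.1 h1
  calc ∫⁻ z in S₁, ENNReal.ofReal (Real.sqrt (chartMatrix g p₁ z).det)
      = ∫⁻ z in S₁, ENNReal.ofReal |(T z).det| *
          ENNReal.ofReal (Real.sqrt (chartMatrix g p₀ (ψ z)).det) := by
        refine setLIntegral_congr_fun hS₁m fun z hz => ?_
        rw [hdet z hz, Real.sqrt_mul (sq_nonneg _), Real.sqrt_sq_eq_abs,
          ENNReal.ofReal_mul (abs_nonneg _)]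
        rfl
    _ = ∫⁻ z in ψ '' S₁, ENNReal.ofReal (Real.sqrt (chartMatrix g p₀ z).det) :=
        (lintegral_image_eq_lintegral_abs_det_fderiv_mul volume hS₁m
          (fun z hz => (hT z hz).hasFDerivWithinAt) hinj
          fun z => ENNReal.ofReal (Real.sqrt (chartMatrix g p₀ z).det)).symm
    _ ≤ _ := by
        refine lintegral_mono_set ?_
        rintro _ ⟨z, hz, rfl⟩
        refine ⟨(extChartAt (𝓡 2) p₀).map_source (hA₀ hz.2), ?_⟩
        rw [mem_preimage, hψ, Function.comp, (extChartAt (𝓡 2) p₀).left_inv (hA₀ hz.2)]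
        exact hz.2

/-- The value of a supremum of measures on a set is not the supremum of the values, so a single
measure dominating every chart measure is exhibited: the chart volume at `p₀` on `U`, and infinitely
many times the counting measure off `U`. A set not contained in `U` then has infinite measure, and
only subsets of `U` need an argument. -/
lemma riemannianVolume_le [MeasurableSpace M] [BorelSpace M] (g : SurfaceMetric M) (p₀ : M)
    {U : Set M} (hU : MeasurableSet U) (hU₀ : U ⊆ (extChartAt (𝓡 2) p₀).source) :
    riemannianVolume g U ≤ chartVolume g p₀ U := by
  classical
  set ν : Measure M := (chartVolume g p₀).restrict U + (⊤ : ENNReal) • Measure.count.restrict Uᶜ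
    with hν
  have hle : riemannianVolume g ≤ ν := by
    refine iSup_le fun p₁ => Measure.le_iff.2 fun A hA => ?_
    change chartVolume g p₁ A ≤ ν A
    by_cases hAU : A ⊆ U
    · have : ν A = chartVolume g p₀ A := by
        simp only [hν, Measure.add_apply, Measure.smul_apply, Measure.restrict_apply hA]
        rw [inter_eq_left.2 hAU, (disjoint_compl_right.mono_left hAU).inter_eq]
        simp
      rw [this]
      exact chartVolume_le g p₀ p₁ hA (hAU.trans hU₀)
    · have : ν A = ⊤ := by
        simp only [hν, Measure.add_apply, Measure.smul_apply, Measure.restrict_apply hA]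
        have hne : (A ∩ Uᶜ).Nonempty := by
          obtain ⟨x, hx, hxU⟩ := not_subset.1 hAU
          exact ⟨x, hx, hxU⟩
        have h0 : Measure.count (A ∩ Uᶜ) ≠ 0 := by
          rw [Ne, Measure.count_eq_zero_iff]
          exact hne.ne_empty
        rw [smul_eq_mul, ENNReal.top_mul h0, add_top]
      rw [this]
      exact le_top
  refine (hle U).trans ?_
  simp only [hν, Measure.add_apply, Measure.smul_apply, Measure.restrict_apply hU]
  simp

lemma exists_nhds_riemannianVolume_lt_top [MeasurableSpace M] [BorelSpace M]
    (g : SurfaceMetric M) (p₀ : M) : ∃ U ∈ 𝓝 p₀, riemannianVolume g U < ⊤ := by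
  set z₀ := extChartAt (𝓡 2) p₀ p₀ with hz₀
  have hc : ContinuousAt (fun z => ENNReal.ofReal (Real.sqrt (chartMatrix g p₀ z).det)) z₀ := by
    have := (continuousOn_chartMatrix_det g p₀).continuousAt
      (extChartAt_target_mem_nhds (I := 𝓡 2) p₀)
    exact ENNReal.continuous_ofReal.continuousAt.comp (Real.continuous_sqrt.continuousAt.comp this)
  set K := ENNReal.ofReal (Real.sqrt (chartMatrix g p₀ z₀).det) + 1 with hK
  have hlt : ∀ᶠ z in 𝓝 z₀, ENNReal.ofReal (Real.sqrt (chartMatrix g p₀ z).det) < K :=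
    hc.eventually (gt_mem_nhds (ENNReal.lt_add_right ENNReal.ofReal_ne_top one_ne_zero))
  obtain ⟨r, hr, hball⟩ := Metric.eventually_nhds_iff_ball.1 hlt
  refine ⟨(extChartAt (𝓡 2) p₀).source ∩ extChartAt (𝓡 2) p₀ ⁻¹' Metric.ball z₀ r, ?_, ?_⟩
  · exact inter_mem (extChartAt_source_mem_nhds (I := 𝓡 2) p₀)
      ((continuousAt_extChartAt p₀).preimage_mem_nhds (Metric.ball_mem_nhds _ hr))
  · have hop : IsOpen ((extChartAt (𝓡 2) p₀).source ∩ extChartAt (𝓡 2) p₀ ⁻¹' Metric.ball z₀ r) :=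
      (continuousOn_extChartAt p₀).isOpen_inter_preimage (isOpen_extChartAt_source p₀)
        Metric.isOpen_ball
    refine (riemannianVolume_le g p₀ hop.measurableSet inter_subset_left).trans_lt ?_
    rw [chartVolume_apply g p₀ hop.measurableSet]
    have hsub : (extChartAt (𝓡 2) p₀).target ∩ (extChartAt (𝓡 2) p₀).symm ⁻¹'
        ((extChartAt (𝓡 2) p₀).source ∩ extChartAt (𝓡 2) p₀ ⁻¹' Metric.ball z₀ r) ⊆
        Metric.ball z₀ r := fun z hz => by
      have := hz.2.2
      rwa [mem_preimage, (extChartAt (𝓡 2) p₀).right_inv hz.1] at this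
    calc _ ≤ ∫⁻ z in Metric.ball z₀ r, ENNReal.ofReal (Real.sqrt (chartMatrix g p₀ z).det) :=
          lintegral_mono_set hsub
      _ ≤ ∫⁻ z in Metric.ball z₀ r, K :=
          setLIntegral_mono' Metric.isOpen_ball.measurableSet fun z hz => (hball z hz).le
      _ = K * volume (Metric.ball z₀ r) := by simp
      _ < ⊤ := ENNReal.mul_lt_top (by simp [hK]) measure_ball_lt_top

lemma riemannianVolume_lt_top_of_isCompact [MeasurableSpace M] [BorelSpace M]
    (g : SurfaceMetric M) {K : Set M} (hK : IsCompact K) : riemannianVolume g K < ⊤ :=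
  hK.measure_lt_top_of_nhdsWithin fun p _ => by
    obtain ⟨U, hU, h⟩ := exists_nhds_riemannianVolume_lt_top g p
    exact ⟨U, mem_nhdsWithin_of_mem_nhds hU, h⟩

lemma arcLength_lt_top [MeasurableSpace M] [BorelSpace M] (g : SurfaceMetric M) {γ : ℝ → M}
    (hγ : ContMDiffOn 𝓘(ℝ, ℝ) (𝓡 2) ∞ γ (Icc 0 1)) : arcLength g γ univ < ⊤ := by
  have hcont : ContinuousOn (fun s => g.inner (γ s) (velocity γ s) (velocity γ s)) (Icc 0 1) := by
    have h1 : ContinuousOn (fun s => (⟨γ s, velocity γ s⟩ : TangentBundle (𝓡 2) M)) (Icc 0 1) := by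
      have h := hγ.continuousOn_tangentMapWithin (by simp)
        (uniqueDiffOn_Icc (zero_lt_one (α := ℝ))).uniqueMDiffOn
      have h2 : ContinuousOn (fun s : ℝ => (⟨s, (1 : ℝ)⟩ : TangentBundle 𝓘(ℝ, ℝ) ℝ)) (Icc 0 1) := by
        refine Continuous.continuousOn ?_
        exact (tangentBundleModelSpaceHomeomorph 𝓘(ℝ, ℝ)).symm.continuous.comp
          (Continuous.prodMk_left (1 : ℝ))
      exact h.comp h2 fun s hs => hs
    intro s hs
    have hg := (g.contMDiff.continuous.continuousAt (x := γ s)).comp_continuousWithinAt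
      (hγ.continuousOn s hs)
    have := hg.clm_bundle_apply₂ (F₁ := EuclideanSpace ℝ (Fin 2))
      (F₂ := EuclideanSpace ℝ (Fin 2)) (h1 s hs) (h1 s hs)
    simp only [FiberBundle.continuousWithinAt_totalSpace] at this
    exact this.2
  obtain ⟨C, hC⟩ := (isCompact_Icc.image_of_continuousOn hcont).bddAbove
  refine lt_of_le_of_lt (b := ENNReal.ofReal (Real.sqrt C)) ?_ ENNReal.ofReal_lt_top
  by_cases hm : AEMeasurable γ ((volume.restrict (Ioo (0 : ℝ) 1)).withDensity
    fun s => ENNReal.ofReal (Real.sqrt (g.inner (γ s) (velocity γ s) (velocity γ s))))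
  · rw [arcLength, Measure.map_apply_of_aemeasurable hm MeasurableSet.univ, preimage_univ,
      withDensity_apply _ MeasurableSet.univ, Measure.restrict_univ]
    calc _ ≤ ∫⁻ s in Ioo (0 : ℝ) 1, ENNReal.ofReal (Real.sqrt C) :=
          setLIntegral_mono' measurableSet_Ioo fun s hs => by
            refine ENNReal.ofReal_le_ofReal (Real.sqrt_le_sqrt (hC ⟨s, ?_, rfl⟩))
            exact Ioo_subset_Icc_self hs
      _ = _ := by simp
  -- The push-forward along a map that is not measurable is `0` by convention.
  · rw [arcLength, Measure.map_of_not_aemeasurable hm]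
    simp

end Riemannian

/-! ### Geometry of partially rectangular domains -/

lemma crossSection_subset_coordRange (c : Bool) : crossSection c ⊆ coordRange c := by
  cases c <;> simp [crossSection, coordRange]

lemma openCoordRange_subset_coordRange (c : Bool) : openCoordRange c ⊆ coordRange c := by
  cases c
  · simpa [openCoordRange, coordRange] using Ioo_subset_Icc_self
  · simp [openCoordRange, coordRange]

lemma Icc_subset_coordRange (c : Bool) :
    Icc (-(Real.pi / 2)) (Real.pi / 2) ⊆ coordRange c := by
  cases c <;> simp [coordRange]

lemma Ioo_subset_openCoordRange (c : Bool) :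
    Ioo (-(Real.pi / 2)) (Real.pi / 2) ⊆ openCoordRange c := by
  cases c <;> simp [openCoordRange]

lemma crossSection_subset_Icc (c : Bool) :
    crossSection c ⊆ Icc (-(Real.pi / 2)) (Real.pi / 2) := by
  cases c
  · simp [crossSection]
  · simpa [crossSection] using Ico_subset_Icc_self

lemma isOpen_openCoordRange (c : Bool) : IsOpen (openCoordRange c) := by
  cases c
  · simp [openCoordRange, isOpen_Ioo]
  · simp [openCoordRange]

lemma uniqueDiffOn_coordRange (c : Bool) : UniqueDiffOn ℝ (coordRange c) := by
  cases c
  · simpa [coordRange] using uniqueDiffOn_Icc (by linarith [Real.pi_pos])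
  · simp [coordRange]

/-- Every admissible `y` has a representative in the cross-section. -/
lemma exists_mem_crossSection (c : Bool) {y : ℝ} (hy : y ∈ coordRange c) :
    ∃ n : ℤ, y + n * Real.pi ∈ crossSection c ∧ (c = false → n = 0) := by
  cases c
  · exact ⟨0, by simpa [crossSection, coordRange] using hy, fun _ => rfl⟩
  · refine ⟨-toIcoDiv Real.pi_pos (-(Real.pi / 2)) y, ?_, by simp⟩
    have h := sub_toIcoDiv_zsmul_mem_Ico Real.pi_pos (-(Real.pi / 2)) y
    have e : -(Real.pi / 2) + Real.pi = Real.pi / 2 := by ring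
    rw [e] at h
    simpa [crossSection, sub_eq_add_neg] using h

lemma xRange_isOpen (t : ℝ) : IsOpen (xRange t) := isOpen_Ioo

namespace PartiallyRectangularDomain

variable {M : Type*} [TopologicalSpace M] [ChartedSpace (EuclideanSpace ℝ (Fin 2)) M]
  [IsManifold (𝓡 2) ∞ M] (X : PartiallyRectangularDomain M)

lemma rect_add_int_mul {x : ℝ} (hx : x ∈ Icc (-(Real.pi / 2)) (Real.pi / 2)) (y : ℝ) (n : ℤ)
    (hn : X.cylinder = false → n = 0) : X.rect (x, y + n * Real.pi) = X.rect (x, y) := by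
  cases hc : X.cylinder
  · simp [hn hc]
  · have h : Function.Periodic (fun y => X.rect (x, y)) Real.pi := X.rect_periodic hc x hx
    exact h.int_mul n y

lemma rect_mem_carrier {x y : ℝ} (hx : x ∈ Icc (-(Real.pi / 2)) (Real.pi / 2))
    (hy : y ∈ coordRange X.cylinder) : X.rect (x, y) ∈ X.carrier := by
  obtain ⟨n, hn, h0⟩ := exists_mem_crossSection X.cylinder hy
  rw [← X.rect_add_int_mul hx y n h0]
  exact X.rect_mapsTo (x := (x, y + n * Real.pi)) ⟨hx, hn⟩

lemma rect_notMem_rest {x y : ℝ} (hx : x ∈ Ioo (-(Real.pi / 2)) (Real.pi / 2))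
    (hy : y ∈ coordRange X.cylinder) : X.rect (x, y) ∉ X.rest := by
  obtain ⟨n, hn, h0⟩ := exists_mem_crossSection X.cylinder hy
  rw [← X.rect_add_int_mul (Ioo_subset_Icc_self hx) y n h0]
  exact fun h => h.2 ⟨(x, y + n * Real.pi), ⟨hx, hn⟩, rfl⟩

lemma rect_mem_rest {x y : ℝ} (hx : |x| = Real.pi / 2)
    (hy : y ∈ coordRange X.cylinder) : X.rect (x, y) ∈ X.rest := by
  have hxI : x ∈ Icc (-(Real.pi / 2)) (Real.pi / 2) := abs_le.1 hx.le
  refine ⟨X.rect_mem_carrier hxI hy, ?_⟩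
  rintro ⟨⟨x', y'⟩, ⟨hx', hy'⟩, h⟩
  obtain ⟨n, hn, h0⟩ := exists_mem_crossSection X.cylinder hy
  rw [← X.rect_add_int_mul hxI y n h0] at h
  have := X.rect_injOn (x₁ := (x', y')) (x₂ := (x, y + n * Real.pi))
    ⟨Ioo_subset_Icc_self hx', hy'⟩ ⟨hxI, hn⟩ h
  have h1 : x' = x := congrArg Prod.fst this
  have : |x'| < Real.pi / 2 := abs_lt.2 hx'
  rw [h1, hx] at this
  exact lt_irrefl _ this

lemma rest_subset_carrier : X.rest ⊆ X.carrier := sdiff_subset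

lemma exists_rect_of_notMem_rest {p : M} (hp : p ∈ X.carrier) (hp' : p ∉ X.rest) :
    ∃ q ∈ Ioo (-(Real.pi / 2)) (Real.pi / 2) ×ˢ crossSection X.cylinder, X.rect q = p := by
  by_contra h
  exact hp' ⟨hp, fun ⟨q, hq, he⟩ => h ⟨q, hq, he⟩⟩

lemma isCompact_rest : IsCompact X.rest :=
  X.isCompact_carrier.of_isClosed_subset X.isClosed_rest X.rest_subset_carrier

lemma seamMap_of_mem_rest (t : ℝ) {p : M} (hp : p ∈ X.rest) : X.seamMap t p = Sum.inl p := by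
  simp [seamMap, hp]

lemma seamMap_rect (t : ℝ) {q : ℝ × ℝ}
    (hq : q ∈ Ioo (-(Real.pi / 2)) (Real.pi / 2) ×ˢ crossSection X.cylinder) :
    X.seamMap t (X.rect q) = Sum.inr (q.1 + Real.sign q.1 * ((t - 1) * (Real.pi / 2)), q.2) := by
  have h1 : X.rect q ∉ X.rest :=
    X.rect_notMem_rest hq.1 (crossSection_subset_coordRange _ hq.2)
  have h2 : Function.invFunOn X.rect
      (Ioo (-(Real.pi / 2)) (Real.pi / 2) ×ˢ crossSection X.cylinder) (X.rect q) = q := by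
    have hinj : InjOn X.rect (Ioo (-(Real.pi / 2)) (Real.pi / 2) ×ˢ crossSection X.cylinder) :=
      X.rect_injOn.mono (prod_mono Ioo_subset_Icc_self le_rfl)
    exact hinj.leftInvOn_invFunOn hq
  simp only [seamMap, h1, if_false, h2]

/-- The shift of the `x`-coordinate performed by `seamMap` stays in the range of `x`. -/
lemma shift_mem_xRange {t x : ℝ} (ht : 1 ≤ t) (hx : x ∈ Ioo (-(Real.pi / 2)) (Real.pi / 2)) :
    x + Real.sign x * ((t - 1) * (Real.pi / 2)) ∈ xRange t := by
  have := Real.pi_pos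
  obtain ⟨h1, h2⟩ := hx
  have h3 : 0 ≤ (t - 1) * (Real.pi / 2) := by nlinarith
  rcases lt_trichotomy x 0 with h | h | h
  · rw [Real.sign_of_neg h]; constructor <;> nlinarith
  · rw [h, Real.sign_zero]; constructor <;> nlinarith
  · rw [Real.sign_of_pos h]; constructor <;> nlinarith

lemma apply_inr_add_int_mul {t : ℝ} {u : M ⊕ ℝ × ℝ → ℝ} (hu : X.IsPeriodic t u) {x : ℝ}
    (hx : x ∈ xRange t) (y : ℝ) (n : ℤ) (hn : X.cylinder = false → n = 0) :
    u (Sum.inr (x, y + n * Real.pi)) = u (Sum.inr (x, y)) := by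
  cases hc : X.cylinder
  · simp [hn hc]
  · have h : Function.Periodic (fun y => u (Sum.inr (x, y))) Real.pi := hu hc x hx
    exact h.int_mul n y

lemma apply_seamMap_rect {t : ℝ} (ht : 1 ≤ t) {u : M ⊕ ℝ × ℝ → ℝ} (hu : X.IsPeriodic t u) {x y : ℝ}
    (hx : x ∈ Ioo (-(Real.pi / 2)) (Real.pi / 2)) (hy : y ∈ coordRange X.cylinder) :
    u (X.seamMap t (X.rect (x, y))) =
      u (Sum.inr (x + Real.sign x * ((t - 1) * (Real.pi / 2)), y)) := by
  obtain ⟨n, hn, h0⟩ := exists_mem_crossSection X.cylinder hy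
  rw [← X.rect_add_int_mul (Ioo_subset_Icc_self hx) y n h0, X.seamMap_rect t ⟨hx, hn⟩,
    X.apply_inr_add_int_mul hu (shift_mem_xRange ht hx) y n h0]

/-- The part of the rectangle at distance at least `η` from the vertical sides. -/
def deepRect (η : ℝ) : Set M :=
  X.rect '' (Icc (-(Real.pi / 2 - η)) (Real.pi / 2 - η) ×ˢ Icc (-(Real.pi / 2)) (Real.pi / 2))

lemma isCompact_deepRect {η : ℝ} (hη : 0 ≤ η) : IsCompact (X.deepRect η) := by
  refine (isCompact_Icc.prod isCompact_Icc).image_of_continuousOn (X.rect_continuousOn.mono ?_)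
  exact prod_mono (Icc_subset_Icc (by linarith) (by linarith)) (Icc_subset_coordRange _)

lemma disjoint_rest_deepRect {η : ℝ} (hη : 0 < η) : Disjoint X.rest (X.deepRect η) := by
  rw [disjoint_left]
  rintro _ hp ⟨⟨x, y⟩, ⟨hx, hy⟩, rfl⟩
  exact X.rect_notMem_rest (x := x) (y := y) ⟨by linarith [hx.1], by linarith [hx.2]⟩
    (Icc_subset_coordRange _ hy) hp

lemma rect_mem_deepRect {η x y : ℝ} (hη : 0 ≤ η) (hx : |x| ≤ Real.pi / 2 - η)
    (hy : y ∈ coordRange X.cylinder) : X.rect (x, y) ∈ X.deepRect η := by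
  obtain ⟨n, hn, h0⟩ := exists_mem_crossSection X.cylinder hy
  have hx' := abs_le.1 hx
  rw [← X.rect_add_int_mul ⟨by linarith [hx'.1], by linarith [hx'.2]⟩ y n h0]
  exact ⟨(x, y + n * Real.pi), ⟨hx', crossSection_subset_Icc _ hn⟩, rfl⟩

/-- A neighbourhood of `W` contains all points of the rectangle near the vertical sides. -/
lemma exists_rect_mem_of_isOpen {O : Set M} (hO : IsOpen O) (hrest : X.rest ⊆ O) :
    ∃ η, 0 < η ∧ η < Real.pi / 2 ∧ ∀ x y, Real.pi / 2 - η < |x| → |x| ≤ Real.pi / 2 →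
      y ∈ coordRange X.cylinder → X.rect (x, y) ∈ O := by
  have hpi := Real.pi_pos
  set B := Icc (-(Real.pi / 2)) (Real.pi / 2) ×ˢ Icc (-(Real.pi / 2)) (Real.pi / 2) with hB
  have hcont : ContinuousOn X.rect B :=
    X.rect_continuousOn.mono (prod_mono le_rfl (Icc_subset_coordRange _))
  have hBc : IsCompact B := isCompact_Icc.prod isCompact_Icc
  have hK : IsCompact (B ∩ X.rect ⁻¹' Oᶜ) :=
    hBc.of_isClosed_subset (hcont.preimage_isClosed_of_isClosed hBc.isClosed hO.isClosed_compl)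
      inter_subset_left
  -- The points sent outside `O` form a compact set that avoids the vertical sides, so `|x|` attains
  -- on it a maximum below `π/2`.
  have hbase : ∃ m, m < Real.pi / 2 ∧ ∀ q ∈ B ∩ X.rect ⁻¹' Oᶜ, |q.1| ≤ m := by
    rcases (B ∩ X.rect ⁻¹' Oᶜ).eq_empty_or_nonempty with he | hne
    · exact ⟨0, by positivity, fun q hq => by rw [he] at hq; exact hq.elim⟩
    · obtain ⟨q, hq, hmax⟩ := hK.exists_isMaxOn hne
        (f := fun q : ℝ × ℝ => |q.1|) (by fun_prop)
      refine ⟨|q.1|, lt_of_le_of_ne (abs_le.2 hq.1.1) fun h => ?_, fun q' hq' => hmax hq'⟩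
      exact hq.2 (hrest (X.rect_mem_rest (x := q.1) (y := q.2) h (Icc_subset_coordRange _ hq.1.2)))
  obtain ⟨m, hm, hmB⟩ := hbase
  refine ⟨min (Real.pi / 2 - m) (Real.pi / 4), lt_min (by linarith) (by positivity),
    (min_le_right _ _).trans_lt (by linarith), fun x y hx hx' hy => ?_⟩
  obtain ⟨n, hn, h0⟩ := exists_mem_crossSection X.cylinder hy
  rw [← X.rect_add_int_mul (abs_le.1 hx') y n h0]
  by_contra hnot
  have := hmB (x, y + n * Real.pi) ⟨⟨abs_le.1 hx', crossSection_subset_Icc _ hn⟩, hnot⟩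
  have h3 := min_le_left (Real.pi / 2 - m) (Real.pi / 4)
  simp only at this
  linarith

/-- The derivative of the parametrization of the rectangle. -/
def rectDeriv (q : ℝ × ℝ) : ℝ × ℝ →L[ℝ] TangentSpace (𝓡 2) (X.rect q) :=
  mfderiv 𝓘(ℝ, ℝ × ℝ) (𝓡 2) X.rect q

lemma inner_rectDeriv {x y : ℝ} (hx : x ∈ Ioo (-(Real.pi / 2)) (Real.pi / 2))
    (hy : y ∈ openCoordRange X.cylinder) (v w : ℝ × ℝ) :
    X.metric.inner (X.rect (x, y)) (X.rectDeriv (x, y) v) (X.rectDeriv (x, y) w) =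
      v.1 * w.1 + v.2 * w.2 :=
  X.rect_isometry (x, y) ⟨hx, hy⟩ v w

lemma contMDiffAt_rect {x y : ℝ} (hx : x ∈ Ioo (-(Real.pi / 2)) (Real.pi / 2))
    (hy : y ∈ openCoordRange X.cylinder) : ContMDiffAt 𝓘(ℝ, ℝ × ℝ) (𝓡 2) ∞ X.rect (x, y) :=
  (X.rect_smooth.mono (prod_mono le_rfl (openCoordRange_subset_coordRange _))).contMDiffAt
    ((isOpen_Ioo.prod (isOpen_openCoordRange _)).mem_nhds ⟨hx, hy⟩)

/-- The parametrization of the rectangle is an open map. -/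
lemma rect_mem_interior_carrier {x y : ℝ} (hx : x ∈ Ioo (-(Real.pi / 2)) (Real.pi / 2))
    (hy : y ∈ openCoordRange X.cylinder) : X.rect (x, y) ∈ interior X.carrier := by
  set q₀ : ℝ × ℝ := (x, y) with hq₀
  set U := Ioo (-(Real.pi / 2)) (Real.pi / 2) ×ˢ openCoordRange X.cylinder with hU
  have hUo : IsOpen U := isOpen_Ioo.prod (isOpen_openCoordRange _)
  have hqU : q₀ ∈ U := ⟨hx, hy⟩
  have hrect : ContMDiffAt 𝓘(ℝ, ℝ × ℝ) (𝓡 2) ∞ X.rect q₀ := X.contMDiffAt_rect hx hy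
  set φ := extChartAt (𝓡 2) (X.rect q₀) with hφ
  have hΨ : ContDiffAt ℝ ∞ (φ ∘ X.rect) q₀ := by
    rw [← contMDiffAt_iff_contDiffAt]
    exact (contMDiffAt_extChartAt (I := 𝓡 2) (n := ∞)).comp q₀ hrect
  have hstrict := hΨ.hasStrictFDerivAt (by simp)
  have hderiv : fderiv ℝ (φ ∘ X.rect) q₀ =
      (chartComponents (X.rect q₀) (X.rect q₀)).comp (X.rectDeriv q₀) := by
    have h1 : HasMFDerivAt (𝓡 2) 𝓘(ℝ, EuclideanSpace ℝ (Fin 2)) φ (X.rect q₀)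
        (chartComponents (X.rect q₀) (X.rect q₀)) :=
      (mdifferentiableAt_extChartAt (I := 𝓡 2)
        (mem_chart_source (EuclideanSpace ℝ (Fin 2)) (X.rect q₀))).hasMFDerivAt
    have h2 : HasMFDerivAt 𝓘(ℝ, ℝ × ℝ) (𝓡 2) X.rect q₀ (X.rectDeriv q₀) :=
      (hrect.mdifferentiableAt (by simp)).hasMFDerivAt
    have h3 : HasMFDerivAt 𝓘(ℝ, ℝ × ℝ) 𝓘(ℝ, EuclideanSpace ℝ (Fin 2)) (φ ∘ X.rect) q₀
        ((chartComponents (X.rect q₀) (X.rect q₀)).comp (X.rectDeriv q₀)) := h1.comp q₀ h2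
    have h4 : HasFDerivAt (φ ∘ X.rect)
        ((chartComponents (X.rect q₀) (X.rect q₀)).comp (X.rectDeriv q₀)) q₀ := h3.hasFDerivAt
    exact h4.fderiv
  -- The isometry property gives `|dR v|² = v₁² + v₂²`, so the derivative is injective, hence onto
  -- because both spaces have dimension two; a surjective strict derivative makes the map open at
  -- the point.
  have hinj : Function.Injective (fderiv ℝ (φ ∘ X.rect) q₀) := by
    rw [injective_iff_map_eq_zero]
    intro v hv
    rw [hderiv] at hv
    have h0 : X.rectDeriv q₀ v = 0 := by
      have := chartVector_mfderiv_extChartAt (mem_chart_source _ (X.rect q₀)) (X.rectDeriv q₀ v)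
      rw [← this]
      exact (congrArg (chartVector (X.rect q₀) (X.rect q₀)) hv).trans (map_zero _)
    have h5 := X.inner_rectDeriv hx hy v v
    rw [← hq₀, h0, map_zero] at h5
    replace h5 : 0 = v.1 * v.1 + v.2 * v.2 := h5
    ext
    · simp only [Prod.fst_zero]; nlinarith [mul_self_nonneg v.1, mul_self_nonneg v.2]
    · simp only [Prod.snd_zero]; nlinarith [mul_self_nonneg v.1, mul_self_nonneg v.2]
  have hsurj : (fderiv ℝ (φ ∘ X.rect) q₀).range = ⊤ := by
    rw [LinearMap.range_eq_top]
    exact (LinearMap.injective_iff_surjective_of_finrank_eq_finrank (by simp)).1 hinj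
  have hmap := hstrict.map_nhds_eq_of_surj hsurj
  have hsource : φ.source ∈ 𝓝 (X.rect q₀) := extChartAt_source_mem_nhds (I := 𝓡 2) _
  have hV : U ∩ X.rect ⁻¹' φ.source ∈ 𝓝 q₀ :=
    inter_mem (hUo.mem_nhds hqU) (hrect.continuousAt.preimage_mem_nhds hsource)
  have himg : (φ ∘ X.rect) '' (U ∩ X.rect ⁻¹' φ.source) ∈ 𝓝 (φ (X.rect q₀)) := by
    have := image_mem_map (m := φ ∘ X.rect) hV
    rwa [hmap] at this
  rw [mem_interior_iff_mem_nhds]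
  filter_upwards [hsource, (continuousAt_extChartAt (I := 𝓡 2) (X.rect q₀)).preimage_mem_nhds himg]
    with p hp hp'
  obtain ⟨q, ⟨hqU', hqs⟩, hqp⟩ := hp'
  rw [← φ.injOn hqs hp hqp]
  exact X.rect_mem_carrier (x := q.1) (y := q.2) (Ioo_subset_Icc_self hqU'.1)
    (openCoordRange_subset_coordRange _ hqU'.2)

end PartiallyRectangularDomain

/-! ### Bounds for smooth functions -/

namespace PartiallyRectangularDomain

variable {M : Type*} [TopologicalSpace M] [ChartedSpace (EuclideanSpace ℝ (Fin 2)) M]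
  [IsManifold (𝓡 2) ∞ M] {X : PartiallyRectangularDomain M} {t : ℝ} {f : M ⊕ ℝ × ℝ → ℝ}

/-- Values and derivatives of a smooth function are locally bounded, and `W` is compact. The bound
holds on a whole neighbourhood `O'` of `W`, so it also covers the rectangle near its vertical sides,
which `xRange` omits. -/
lemma IsSmooth.exists_seam_bound (hf : X.IsSmooth t f) :
    ∃ O O' : Set M, IsOpen O ∧ IsOpen O' ∧ O' ⊆ O ∧ X.rest ⊆ O' ∧
      ContMDiffOn (𝓡 2) 𝓘(ℝ, ℝ) ∞ (fun p => f (X.seamMap t p)) (X.carrier ∩ O) ∧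
      ∃ C, 0 ≤ C ∧ ∀ p ∈ X.carrier ∩ O', |f (X.seamMap t p)| ≤ C ∧
        ∃ L : TangentSpace (𝓡 2) p →L[ℝ] ℝ,
          HasMFDerivWithinAt (𝓡 2) 𝓘(ℝ, ℝ) (fun p => f (X.seamMap t p)) (X.carrier ∩ O) p L ∧
          ∀ v, (L v) ^ 2 ≤ C * X.metric.inner p v v := by
  obtain ⟨-, -, O, hO, hrest, hsm⟩ := hf
  have key : ∃ O' : Set M, IsOpen O' ∧ X.rest ⊆ O' ∧
      ∃ C, 0 ≤ C ∧ ∀ p ∈ (X.carrier ∩ O) ∩ O', |f (X.seamMap t p)| ≤ C ∧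
        ∃ L : TangentSpace (𝓡 2) p →L[ℝ] ℝ,
          HasMFDerivWithinAt (𝓡 2) 𝓘(ℝ, ℝ) (fun p => f (X.seamMap t p)) (X.carrier ∩ O) p L ∧
          ∀ v, (L v) ^ 2 ≤ C * X.metric.inner p v v := by
    refine X.isCompact_rest.induction_on (p := fun A => ∃ O' : Set M, IsOpen O' ∧ A ⊆ O' ∧
      ∃ C, 0 ≤ C ∧ ∀ p ∈ (X.carrier ∩ O) ∩ O', |f (X.seamMap t p)| ≤ C ∧
        ∃ L : TangentSpace (𝓡 2) p →L[ℝ] ℝ,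
          HasMFDerivWithinAt (𝓡 2) 𝓘(ℝ, ℝ) (fun p => f (X.seamMap t p)) (X.carrier ∩ O) p L ∧
          ∀ v, (L v) ^ 2 ≤ C * X.metric.inner p v v) ?_ ?_ ?_ ?_
    · exact ⟨∅, isOpen_empty, le_rfl, 0, le_rfl, by simp⟩
    · rintro A B hAB ⟨O', h1, h2, h3⟩
      exact ⟨O', h1, hAB.trans h2, h3⟩
    · rintro A B ⟨O₁, h1, h2, C₁, h3, h4⟩ ⟨O₂, k1, k2, C₂, k3, k4⟩
      refine ⟨O₁ ∪ O₂, h1.union k1, union_subset_union h2 k2, max C₁ C₂, le_max_of_le_left h3, ?_⟩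
      rintro p ⟨hp, hp' | hp'⟩
      · obtain ⟨a1, L, a2, a3⟩ := h4 p ⟨hp, hp'⟩
        exact ⟨a1.trans (le_max_left _ _), L, a2, fun v => (a3 v).trans
          (mul_le_mul_of_nonneg_right (le_max_left _ _) (inner_self_nonneg' _ _ _))⟩
      · obtain ⟨a1, L, a2, a3⟩ := k4 p ⟨hp, hp'⟩
        exact ⟨a1.trans (le_max_right _ _), L, a2, fun v => (a3 v).trans
          (mul_le_mul_of_nonneg_right (le_max_right _ _) (inner_self_nonneg' _ _ _))⟩
    · intro p₀ hp₀
      have hmem : p₀ ∈ X.carrier ∩ O := ⟨X.rest_subset_carrier hp₀, hrest hp₀⟩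
      obtain ⟨C, hC0, hC⟩ := exists_hasMFDerivWithinAt_bound X.metric hsm hmem
      have hb : ∀ᶠ p in 𝓝[X.carrier ∩ O] p₀,
          |f (X.seamMap t p)| < |f (X.seamMap t p₀)| + 1 :=
        (hsm.continuousOn p₀ hmem).abs.eventually (gt_mem_nhds (lt_add_one _))
      obtain ⟨O', hO', hp', hsub⟩ := mem_nhdsWithin.1 (hC.and hb)
      refine ⟨O', mem_nhdsWithin_of_mem_nhds (hO'.mem_nhds hp'), O', hO', le_rfl,
        max C (|f (X.seamMap t p₀)| + 1), le_max_of_le_left hC0, ?_⟩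
      rintro p ⟨hp, hpO⟩
      obtain ⟨⟨L, a2, a3⟩, a1⟩ := hsub ⟨hpO, hp⟩
      exact ⟨a1.le.trans (le_max_right _ _), L, a2, fun v => (a3 v).trans
          (mul_le_mul_of_nonneg_right (le_max_left _ _) (inner_self_nonneg' _ _ _))⟩
  obtain ⟨O', hO', hsub, C, hC0, hC⟩ := key
  exact ⟨O, O' ∩ O, hO, hO'.inter hO, inter_subset_right, subset_inter hsub hrest, hsm, C, hC0,
    fun p hp => hC p ⟨⟨hp.1, hp.2.2⟩, hp.2.1⟩⟩

/-- Points of the rectangle of `X_t` near the vertical sides come from points of `X`. -/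
lemma exists_shift_eq {x η : ℝ} (ht : 1 ≤ t) (hη : η < Real.pi / 2) (hx : x ∈ xRange t)
    (hx' : t * (Real.pi / 2) - η < |x|) :
    ∃ c, x - c ∈ Ioo (-(Real.pi / 2)) (Real.pi / 2) ∧ Real.pi / 2 - η < |x - c| ∧
      ∀ᶠ s in 𝓝 (x - c), s + Real.sign s * ((t - 1) * (Real.pi / 2)) = s + c := by
  have := Real.pi_pos
  have h3 : 0 ≤ (t - 1) * (Real.pi / 2) := by nlinarith
  obtain ⟨h1, h2⟩ := hx
  rcases abs_cases x with ⟨ha, hx0⟩ | ⟨ha, hx0⟩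
  · rw [ha] at hx'
    have hpos : 0 < x - (t - 1) * (Real.pi / 2) := by nlinarith
    refine ⟨(t - 1) * (Real.pi / 2), ⟨by nlinarith, by nlinarith⟩, ?_, ?_⟩
    · rw [abs_of_pos hpos]; nlinarith
    · filter_upwards [lt_mem_nhds hpos] with s hs
      rw [Real.sign_of_pos hs, one_mul]
  · rw [ha] at hx'
    have hneg : x - -((t - 1) * (Real.pi / 2)) < 0 := by nlinarith
    refine ⟨-((t - 1) * (Real.pi / 2)), ⟨by nlinarith, by nlinarith⟩, ?_, ?_⟩
    · rw [abs_of_neg hneg]; nlinarith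
    · filter_upwards [gt_mem_nhds hneg] with s hs
      rw [Real.sign_of_neg hs]; ring

lemma IsSmooth.exists_bound (ht : 1 ≤ t) (hf : X.IsSmooth t f) :
    ∃ C, 0 ≤ C ∧ (∀ p ∈ X.rest, |f (Sum.inl p)| ≤ C) ∧
      ∀ x ∈ xRange t, ∀ y ∈ Icc (-(Real.pi / 2)) (Real.pi / 2), |f (Sum.inr (x, y))| ≤ C := by
  obtain ⟨O, O', hO, hO', hsub, hrest, hsm, C, hC0, hC⟩ := hf.exists_seam_bound
  obtain ⟨η, hη0, hη, hrect⟩ := X.exists_rect_mem_of_isOpen hO' hrest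
  set K := Icc (-(t * (Real.pi / 2) - η)) (t * (Real.pi / 2) - η) ×ˢ
    Icc (-(Real.pi / 2)) (Real.pi / 2) with hK
  have hKs : K ⊆ xRange t ×ˢ coordRange X.cylinder :=
    prod_mono (Icc_subset_Ioo (by linarith) (by linarith)) (Icc_subset_coordRange _)
  obtain ⟨C', hC'⟩ := ((isCompact_Icc.prod isCompact_Icc).image_of_continuousOn
    (hf.2.1.continuousOn.mono hKs).abs).bddAbove
  refine ⟨max C C', le_max_of_le_left hC0, fun p hp => ?_, fun x hx y hy => ?_⟩
  · have := (hC p ⟨X.rest_subset_carrier hp, hrest hp⟩).1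
    rw [X.seamMap_of_mem_rest t hp] at this
    exact this.trans (le_max_left _ _)
  · by_cases h : |x| ≤ t * (Real.pi / 2) - η
    · exact (hC' ⟨(x, y), ⟨abs_le.1 h, hy⟩, rfl⟩).trans (le_max_right _ _)
    · push Not at h
      obtain ⟨c, hc1, hc2, hc3⟩ := exists_shift_eq ht hη hx h
      have hy' := Icc_subset_coordRange X.cylinder hy
      have := (hC (X.rect (x - c, y)) ⟨X.rect_mem_carrier (Ioo_subset_Icc_self hc1) hy',
        hrect _ _ hc2 (abs_lt.2 hc1).le hy'⟩).1
      rw [X.apply_seamMap_rect ht hf.1 hc1 hy', hc3.self_of_nhds, sub_add_cancel] at this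
      exact this.trans (le_max_left _ _)

/-- At positive distance from the vertical sides this is compactness of a strip on which `f` is
smooth up to `y = ±π/2`. Near the vertical sides no such compact strip is available, and the bound
near `W` is carried over by `rect`, a local isometry, followed by a translation in `x`. -/
lemma IsSmooth.exists_fderiv_bound (ht : 1 ≤ t) (hf : X.IsSmooth t f) :
    ∃ C, 0 ≤ C ∧ ∀ x ∈ xRange t, ∀ y ∈ Ioo (-(Real.pi / 2)) (Real.pi / 2), ∀ v : ℝ × ℝ,
      (fderiv ℝ (fun q => f (Sum.inr q)) (x, y) v) ^ 2 ≤ C * (v.1 ^ 2 + v.2 ^ 2) := by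
  obtain ⟨O, O', hO, hO', hsub, hrest, hsm, C, hC0, hC⟩ := hf.exists_seam_bound
  obtain ⟨η, hη0, hη, hrect⟩ := X.exists_rect_mem_of_isOpen hO' hrest
  set K := Icc (-(t * (Real.pi / 2) - η)) (t * (Real.pi / 2) - η) ×ˢ
    Icc (-(Real.pi / 2)) (Real.pi / 2) with hK
  have hKs : K ⊆ xRange t ×ˢ coordRange X.cylinder :=
    prod_mono (Icc_subset_Ioo (by linarith) (by linarith)) (Icc_subset_coordRange _)
  have hud : UniqueDiffOn ℝ (xRange t ×ˢ coordRange X.cylinder) :=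
    (xRange_isOpen t).uniqueDiffOn.prod (uniqueDiffOn_coordRange _)
  have hcont := (hf.2.1.continuousOn_fderivWithin hud (by simp)).mono hKs
  obtain ⟨C', hC'⟩ := ((isCompact_Icc.prod isCompact_Icc).image_of_continuousOn hcont.norm).bddAbove
  have hopen : IsOpen (xRange t ×ˢ openCoordRange X.cylinder) :=
    (xRange_isOpen t).prod (isOpen_openCoordRange _)
  refine ⟨max C (C' ^ 2), le_max_of_le_left hC0, fun x hx y hy v => ?_⟩
  have hyo := Ioo_subset_openCoordRange X.cylinder hy
  have hyc := openCoordRange_subset_coordRange _ hyo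
  have hnn : 0 ≤ v.1 ^ 2 + v.2 ^ 2 := by positivity
  by_cases h : |x| ≤ t * (Real.pi / 2) - η
  · have h1 : ‖fderivWithin ℝ (fun q => f (Sum.inr q)) (xRange t ×ˢ coordRange X.cylinder) (x, y)‖
        ≤ C' := hC' ⟨(x, y), ⟨abs_le.1 h, Ioo_subset_Icc_self hy⟩, rfl⟩
    rw [fderivWithin_of_mem_nhds (mem_of_superset (hopen.mem_nhds ⟨hx, hyo⟩)
      (prod_mono le_rfl (openCoordRange_subset_coordRange _)))] at h1
    have h2 := (fderiv ℝ (fun q => f (Sum.inr q)) (x, y)).le_of_opNorm_le h1 v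
    have h3 : ‖v‖ ^ 2 ≤ v.1 ^ 2 + v.2 ^ 2 := by
      rw [Prod.norm_def, Real.norm_eq_abs, Real.norm_eq_abs]
      rcases max_cases |v.1| |v.2| with ⟨h, -⟩ | ⟨h, -⟩ <;> rw [h, sq_abs] <;> nlinarith [sq_nonneg v.1, sq_nonneg v.2]
    calc _ = ‖fderiv ℝ (fun q => f (Sum.inr q)) (x, y) v‖ ^ 2 := by
          rw [Real.norm_eq_abs, sq_abs]
      _ ≤ (C' * ‖v‖) ^ 2 := by gcongr
      _ = C' ^ 2 * ‖v‖ ^ 2 := by ring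
      _ ≤ _ := mul_le_mul (le_max_right _ _) h3 (by positivity) (le_max_of_le_left hC0)
  · push Not at h
    obtain ⟨c, hc1, hc2, hc3⟩ := exists_shift_eq ht hη hx h
    have hmem : X.rect (x - c, y) ∈ X.carrier ∩ O' :=
      ⟨X.rect_mem_carrier (Ioo_subset_Icc_self hc1) hyc, hrect _ _ hc2 (abs_lt.2 hc1).le hyc⟩
    obtain ⟨-, L, hL, hLb⟩ := hC _ hmem
    have hr : HasMFDerivAt 𝓘(ℝ, ℝ × ℝ) (𝓡 2) X.rect (x - c, y) (X.rectDeriv (x - c, y)) :=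
      ((X.contMDiffAt_rect hc1 hyo).mdifferentiableAt (by simp)).hasMFDerivAt
    have hpre : X.rect ⁻¹' (X.carrier ∩ O) ∈ 𝓝 (x - c, y) := by
      have h1 : X.rect ⁻¹' O ∈ 𝓝 (x - c, y) :=
        (X.contMDiffAt_rect hc1 hyo).continuousAt.preimage_mem_nhds (hO.mem_nhds (hsub hmem.2))
      have h2 : X.rect ⁻¹' X.carrier ∈ 𝓝 (x - c, y) :=
        (X.contMDiffAt_rect hc1 hyo).continuousAt.preimage_mem_nhds
          (mem_interior_iff_mem_nhds.1 (X.rect_mem_interior_carrier hc1 hyo))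
      exact inter_mem h2 h1
    have hcomp : HasMFDerivAt 𝓘(ℝ, ℝ × ℝ) 𝓘(ℝ, ℝ) ((fun p => f (X.seamMap t p)) ∘ X.rect)
        (x - c, y) (L.comp (X.rectDeriv (x - c, y))) := by
      have h1 := hL.comp (x - c, y) (hr.hasMFDerivWithinAt (s := X.rect ⁻¹' (X.carrier ∩ O)))
        le_rfl
      exact h1.hasMFDerivAt hpre
    have hfd : HasFDerivAt ((fun p => f (X.seamMap t p)) ∘ X.rect)
        (L.comp (X.rectDeriv (x - c, y))) (x - c, y) := hcomp.hasFDerivAt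
    have hev : ((fun p => f (X.seamMap t p)) ∘ X.rect) =ᶠ[𝓝 (x - c, y)]
        fun q => f (Sum.inr (q.1 + c, q.2)) := by
      have h1 : ∀ᶠ q : ℝ × ℝ in 𝓝 (x - c, y),
          q.1 + Real.sign q.1 * ((t - 1) * (Real.pi / 2)) = q.1 + c :=
        (continuous_fst.tendsto (x - c, y)).eventually hc3
      filter_upwards [h1, (isOpen_Ioo.prod (isOpen_openCoordRange X.cylinder)).mem_nhds
        (show (x - c, y) ∈ _ from ⟨hc1, hyo⟩)] with q hq hq'
      have := X.apply_seamMap_rect (x := q.1) (y := q.2) ht hf.1 hq'.1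
        (openCoordRange_subset_coordRange _ hq'.2)
      rw [hq] at this
      exact this
    have hfd2 := hfd.congr_of_eventuallyEq hev.symm
    have hfd3 : HasFDerivAt (fun q => f (Sum.inr q)) (L.comp (X.rectDeriv (x - c, y))) (x, y) := by
      have htr : HasFDerivAt (fun q : ℝ × ℝ => q - ((c, 0) : ℝ × ℝ))
          (ContinuousLinearMap.id ℝ (ℝ × ℝ)) (x, y) := (hasFDerivAt_id _).sub_const _
      have hfd2' : HasFDerivAt (fun q : ℝ × ℝ => f (Sum.inr (q.1 + c, q.2)))
        (L.comp (X.rectDeriv (x - c, y))) ((x, y) - ((c, 0) : ℝ × ℝ)) := by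
        simpa using hfd2
      have := hfd2'.comp (x, y) htr
      simpa [Function.comp_def] using this
    rw [hfd3.fderiv]
    have := hLb (X.rectDeriv (x - c, y) v)
    rw [X.inner_rectDeriv hc1 hyo] at this
    calc _ ≤ C * (v.1 * v.1 + v.2 * v.2) := this
      _ = C * (v.1 ^ 2 + v.2 ^ 2) := by ring
      _ ≤ _ := mul_le_mul_of_nonneg_right (le_max_left _ _) hnn

lemma IsSmooth.exists_gradInner_bound (hf : X.IsSmooth t f) :
    ∃ C, 0 ≤ C ∧ ∀ p ∈ X.rest ∩ interior X.carrier,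
      gradInner X.metric (fun p => f (X.seamMap t p)) (fun p => f (X.seamMap t p)) p ≤ C := by
  obtain ⟨O, O', hO, hO', hsub, hrest, hsm, C, hC0, hC⟩ := hf.exists_seam_bound
  refine ⟨C, hC0, fun p hp => ?_⟩
  obtain ⟨-, L, hL, hLb⟩ := hC p ⟨interior_subset hp.2, hrest hp.1⟩
  have hn : X.carrier ∩ O ∈ 𝓝 p :=
    inter_mem (mem_interior_iff_mem_nhds.1 hp.2) (hO.mem_nhds (hsub (hrest hp.1)))
  refine gradInner_self_le X.metric _ p C fun v => ?_
  rw [differential, (hL.hasMFDerivAt hn).mfderiv]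
  exact hLb v

end PartiallyRectangularDomain

/-! ### Integrability of smooth functions -/

lemma measurableEmbedding_inl {α β : Type*} [MeasurableSpace α] [MeasurableSpace β] :
    MeasurableEmbedding (Sum.inl : α → α ⊕ β) :=
  ⟨Sum.inl_injective, measurable_inl, fun {_} hs => measurableSet_inl_image.2 hs⟩

lemma measurableEmbedding_inr {α β : Type*} [MeasurableSpace α] [MeasurableSpace β] :
    MeasurableEmbedding (Sum.inr : β → α ⊕ β) :=
  ⟨Sum.inr_injective, measurable_inr, fun {_} hs => measurableSet_inr_image.2 hs⟩

/-- Lebesgue measure on the rectangle of `X_t`. -/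
def rectMeasure (t : ℝ) : Measure (ℝ × ℝ) :=
  volume.restrict (xRange t ×ˢ Ioo (-(Real.pi / 2)) (Real.pi / 2))

instance (t : ℝ) : IsFiniteMeasure (volume.restrict (xRange t)) :=
  ⟨by rw [Measure.restrict_apply_univ, xRange, Real.volume_Ioo]; exact ENNReal.ofReal_lt_top⟩

lemma rectMeasure_eq_prod (t : ℝ) : rectMeasure t =
    (volume.restrict (xRange t)).prod (volume.restrict (Ioo (-(Real.pi / 2)) (Real.pi / 2))) := by
  rw [rectMeasure, Measure.volume_eq_prod, Measure.prod_restrict]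

instance (t : ℝ) : IsFiniteMeasure (rectMeasure t) := by
  rw [rectMeasure_eq_prod]; infer_instance

lemma measurableSet_rect (t : ℝ) :
    MeasurableSet (xRange t ×ˢ Ioo (-(Real.pi / 2)) (Real.pi / 2)) :=
  measurableSet_Ioo.prod measurableSet_Ioo

lemma rectMeasure_eq_crossSection (t : ℝ) (c : Bool) :
    (volume : Measure (ℝ × ℝ)).restrict (xRange t ×ˢ crossSection c) = rectMeasure t := by
  have h : (volume : Measure ℝ).restrict (crossSection c) =
      volume.restrict (Ioo (-(Real.pi / 2)) (Real.pi / 2)) := by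
    refine Measure.restrict_congr_set ?_
    cases c
    · simpa [crossSection] using Ioo_ae_eq_Icc.symm
    · simpa [crossSection] using Ioo_ae_eq_Ico.symm
  rw [rectMeasure_eq_prod, ← h, Measure.prod_restrict, Measure.volume_eq_prod]

namespace PartiallyRectangularDomain

variable {M : Type*} [TopologicalSpace M] [ChartedSpace (EuclideanSpace ℝ (Fin 2)) M]
  [IsManifold (𝓡 2) ∞ M]

lemma IsPeriodic.linear {X : PartiallyRectangularDomain M} {t : ℝ} {f h : M ⊕ ℝ × ℝ → ℝ}
    (hf : X.IsPeriodic t f) (hh : X.IsPeriodic t h) (a b : ℝ) :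
    X.IsPeriodic t (a • f + b • h) := fun hc x hx y => by
  simp [hf hc x hx y, hh hc x hx y]

lemma IsSmooth.linear {X : PartiallyRectangularDomain M} {t : ℝ} {f h : M ⊕ ℝ × ℝ → ℝ}
    (hf : X.IsSmooth t f) (hh : X.IsSmooth t h) (a b : ℝ) :
    X.IsSmooth t (a • f + b • h) := by
  obtain ⟨f1, f2, O, hO, hr, f3⟩ := hf
  obtain ⟨h1, h2, O', hO', hr', h3⟩ := hh
  refine ⟨f1.linear h1 a b, (f2.const_smul a).add (h2.const_smul b), O ∩ O', hO.inter hO',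
    subset_inter hr hr', ?_⟩
  have f4 := f3.mono (inter_subset_inter_right X.carrier (inter_subset_left (s := O) (t := O')))
  have h4 := h3.mono (inter_subset_inter_right X.carrier (inter_subset_right (s := O) (t := O')))
  have ha : ∀ c : ℝ, ContMDiffOn (𝓡 2) 𝓘(ℝ, ℝ) ∞ (fun _ : M => c) (X.carrier ∩ (O ∩ O')) :=
    fun c => contMDiffOn_const
  exact ((ha a).smul f4).add ((ha b).smul h4)

/-- The space of smooth functions on `X_t`. -/
def smoothFunctions (X : PartiallyRectangularDomain M) (t : ℝ) :
    Submodule ℝ (M ⊕ ℝ × ℝ → ℝ) where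
  carrier := {f | X.IsSmooth t f}
  add_mem' {f h} hf hh := by
    have := IsSmooth.linear hf hh 1 1
    simpa using this
  zero_mem' := by
    refine ⟨fun _ _ _ _ => rfl, contDiffOn_const, univ, isOpen_univ, subset_univ _, ?_⟩
    exact contMDiffOn_const
  smul_mem' c f hf := by
    have := IsSmooth.linear hf hf c 0
    simpa using this

lemma IsTest.linear {X : PartiallyRectangularDomain M} {t : ℝ} {bc : BoundaryCondition}
    {f h : M ⊕ ℝ × ℝ → ℝ} (hf : X.IsTest t bc f) (hh : X.IsTest t bc h) (a b : ℝ) :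
    X.IsTest t bc (a • f + b • h) := by
  refine ⟨hf.1.linear hh.1 a b, fun hbc => ?_⟩
  obtain ⟨⟨K, hK, hKi, hf1⟩, hf2⟩ := hf.2 hbc
  obtain ⟨⟨K', hK', hKi', hh1⟩, hh2⟩ := hh.2 hbc
  refine ⟨⟨K ∪ K', hK.union hK', union_subset hKi hKi', fun p hp => ?_⟩, fun hc => ?_⟩
  · have e1 := hf1 p ⟨hp.1, fun h => hp.2 (Or.inl h)⟩
    have e2 := hh1 p ⟨hp.1, fun h => hp.2 (Or.inr h)⟩
    simp [e1, e2]
  · obtain ⟨δ, hδ, h1⟩ := hf2 hc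
    obtain ⟨δ', hδ', h2⟩ := hh2 hc
    refine ⟨min δ δ', lt_min hδ hδ', fun x hx y hy hlt => ?_⟩
    have e1 := h1 x hx y hy (by linarith [min_le_left δ δ'])
    have e2 := h2 x hx y hy (by linarith [min_le_right δ δ'])
    simp [e1, e2]

lemma IsTest.sub {X : PartiallyRectangularDomain M} {t : ℝ} {bc : BoundaryCondition}
    {f h : M ⊕ ℝ × ℝ → ℝ} (hf : X.IsTest t bc f) (hh : X.IsTest t bc h) :
    X.IsTest t bc (f - h) := by
  have := hf.linear hh 1 (-1)
  simpa [sub_eq_add_neg] using this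

variable (X : PartiallyRectangularDomain M) {t : ℝ} {f h : M ⊕ ℝ × ℝ → ℝ}
variable [MeasurableSpace M] [BorelSpace M]

/-- The volume of the non-rectangular part. -/
def restVolume : Measure M := (riemannianVolume X.metric).restrict X.rest

instance : IsFiniteMeasure X.restVolume :=
  ⟨by
    rw [restVolume, Measure.restrict_apply_univ]
    exact riemannianVolume_lt_top_of_isCompact X.metric X.isCompact_rest⟩

/-- The arc length on the boundary of the non-rectangular part. -/
def restBoundary : Measure M := (∑ i, arcLength X.metric (X.arc i)).restrict X.rest

instance : IsFiniteMeasure X.restBoundary := by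
  have : IsFiniteMeasure (∑ i, arcLength X.metric (X.arc i)) :=
    ⟨by
      rw [Measure.finsetSum_apply]
      exact ENNReal.sum_lt_top.2 fun i _ => arcLength_lt_top X.metric (X.arc_smooth i)⟩
  rw [restBoundary]
  infer_instance

lemma vol_eq (t : ℝ) : X.vol t =
    Measure.map Sum.inl X.restVolume + Measure.map Sum.inr (rectMeasure t) := by
  rw [vol, rectMeasure_eq_crossSection, restVolume]

instance (t : ℝ) : IsFiniteMeasure (X.vol t) := by
  rw [vol_eq]; infer_instance

/-- The horizontal sides of the rectangle of `X_t`. -/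
def sideMeasure (t : ℝ) : Measure (M ⊕ ℝ × ℝ) :=
  if X.cylinder then 0
    else
      Measure.map (fun x : ℝ => Sum.inr (x, Real.pi / 2)) (volume.restrict (xRange t)) +
        Measure.map (fun x : ℝ => Sum.inr (x, -(Real.pi / 2))) (volume.restrict (xRange t))

lemma boundaryMeasure_eq (t : ℝ) : X.boundaryMeasure t =
    Measure.map Sum.inl X.restBoundary + X.sideMeasure t := rfl

instance (t : ℝ) : IsFiniteMeasure (X.boundaryMeasure t) := by
  rw [boundaryMeasure_eq, sideMeasure]
  split_ifs <;> infer_instance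

lemma measurableEmbedding_inr_left (y : ℝ) :
    MeasurableEmbedding (fun x : ℝ => (Sum.inr (x, y) : M ⊕ ℝ × ℝ)) :=
  measurableEmbedding_inr.comp (measurableEmbedding_prod_mk_right y)

lemma measurableSet_rest [T2Space M] : MeasurableSet X.rest :=
  X.isCompact_rest.isClosed.measurableSet

variable {X}

lemma IsSmooth.continuousOn_inl (hf : X.IsSmooth t f) :
    ContinuousOn (fun p => f (Sum.inl p)) X.rest := by
  obtain ⟨-, -, O, hO, hrest, hsm⟩ := hf
  have : ContinuousOn (fun p => f (X.seamMap t p)) X.rest :=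
    hsm.continuousOn.mono fun p hp => ⟨X.rest_subset_carrier hp, hrest hp⟩
  exact this.congr fun p hp => by
    simp only [X.seamMap_of_mem_rest t hp]

lemma IsSmooth.aestronglyMeasurable_inl [T2Space M] [SecondCountableTopology M]
    (hf : X.IsSmooth t f) (μ : Measure M) :
    AEStronglyMeasurable (fun p => f (Sum.inl p)) (μ.restrict X.rest) :=
  hf.continuousOn_inl.aestronglyMeasurable X.measurableSet_rest

lemma IsSmooth.aestronglyMeasurable_inr (hf : X.IsSmooth t f) :
    AEStronglyMeasurable (fun q => f (Sum.inr q)) (rectMeasure t) :=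
  (hf.2.1.continuousOn.mono (prod_mono le_rfl
    (Ioo_subset_Icc_self.trans (Icc_subset_coordRange _)))).aestronglyMeasurable
    (measurableSet_rect t)

lemma IsSmooth.aestronglyMeasurable_vol [T2Space M] [SecondCountableTopology M]
    (hf : X.IsSmooth t f) : AEStronglyMeasurable f (X.vol t) := by
  rw [vol_eq, aestronglyMeasurable_add_measure_iff, measurableEmbedding_inl.aestronglyMeasurable_map_iff,
    measurableEmbedding_inr.aestronglyMeasurable_map_iff]
  exact ⟨hf.aestronglyMeasurable_inl _, hf.aestronglyMeasurable_inr⟩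

lemma IsSmooth.aestronglyMeasurable_side (hf : X.IsSmooth t f) {y : ℝ}
    (hy : y ∈ Icc (-(Real.pi / 2)) (Real.pi / 2)) :
    AEStronglyMeasurable (fun x => f (Sum.inr (x, y))) (volume.restrict (xRange t)) := by
  refine ContinuousOn.aestronglyMeasurable ?_ measurableSet_Ioo
  refine hf.2.1.continuousOn.comp (f := fun x => (x, y)) (by fun_prop) fun x hx => ?_
  exact ⟨hx, Icc_subset_coordRange _ hy⟩

lemma IsSmooth.aestronglyMeasurable_boundary [T2Space M] [SecondCountableTopology M]
    (hf : X.IsSmooth t f) : AEStronglyMeasurable f (X.boundaryMeasure t) := by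
  have hpi := Real.pi_pos
  rw [boundaryMeasure_eq, sideMeasure, aestronglyMeasurable_add_measure_iff,
    measurableEmbedding_inl.aestronglyMeasurable_map_iff]
  refine ⟨hf.aestronglyMeasurable_inl _, ?_⟩
  split_ifs
  · exact aestronglyMeasurable_zero_measure f
  · rw [aestronglyMeasurable_add_measure_iff,
      (measurableEmbedding_inr_left _).aestronglyMeasurable_map_iff,
      (measurableEmbedding_inr_left _).aestronglyMeasurable_map_iff]
    exact ⟨hf.aestronglyMeasurable_side ⟨by linarith, le_rfl⟩,
      hf.aestronglyMeasurable_side ⟨le_rfl, by linarith⟩⟩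

lemma IsSmooth.memLp_vol [T2Space M] [SecondCountableTopology M] (ht : 1 ≤ t)
    (hf : X.IsSmooth t f) (p : ENNReal) : MemLp f p (X.vol t) := by
  obtain ⟨C, -, h1, h2⟩ := hf.exists_bound ht
  refine MemLp.of_bound hf.aestronglyMeasurable_vol C ?_
  rw [vol_eq, ae_add_measure_iff, measurableEmbedding_inl.ae_map_iff,
    measurableEmbedding_inr.ae_map_iff]
  exact ⟨(ae_restrict_iff' X.measurableSet_rest).2 (ae_of_all _ h1),
    (ae_restrict_iff' (measurableSet_rect t)).2 (ae_of_all _ fun q hq =>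
      h2 q.1 hq.1 q.2 (Ioo_subset_Icc_self hq.2))⟩

lemma IsSmooth.memLp_boundary [T2Space M] [SecondCountableTopology M] (ht : 1 ≤ t)
    (hf : X.IsSmooth t f) (p : ENNReal) : MemLp f p (X.boundaryMeasure t) := by
  have hpi := Real.pi_pos
  obtain ⟨C, -, h1, h2⟩ := hf.exists_bound ht
  refine MemLp.of_bound hf.aestronglyMeasurable_boundary C ?_
  rw [boundaryMeasure_eq, sideMeasure, ae_add_measure_iff, measurableEmbedding_inl.ae_map_iff]
  refine ⟨(ae_restrict_iff' X.measurableSet_rest).2 (ae_of_all _ h1), ?_⟩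
  split_ifs
  · simp
  · rw [ae_add_measure_iff, (measurableEmbedding_inr_left _).ae_map_iff,
      (measurableEmbedding_inr_left _).ae_map_iff]
    exact ⟨(ae_restrict_iff' measurableSet_Ioo).2 (ae_of_all _ fun x hx =>
        h2 x hx _ ⟨by linarith, le_rfl⟩),
      (ae_restrict_iff' measurableSet_Ioo).2 (ae_of_all _ fun x hx =>
        h2 x hx _ ⟨le_rfl, by linarith⟩)⟩

/-- The partial derivative of `f` on the rectangle in the direction `v`. -/
def rectDirDeriv (v : ℝ × ℝ) (f : M ⊕ ℝ × ℝ → ℝ) (q : ℝ × ℝ) : ℝ :=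
  fderiv ℝ (fun q => f (Sum.inr q)) q v

lemma isOpen_rect (t : ℝ) : IsOpen (xRange t ×ˢ Ioo (-(Real.pi / 2)) (Real.pi / 2)) :=
  isOpen_Ioo.prod isOpen_Ioo

lemma IsSmooth.contDiffOn_rect (hf : X.IsSmooth t f) :
    ContDiffOn ℝ ∞ (fun q => f (Sum.inr q))
      (xRange t ×ˢ Ioo (-(Real.pi / 2)) (Real.pi / 2)) :=
  hf.2.1.mono (prod_mono le_rfl (Ioo_subset_Icc_self.trans (Icc_subset_coordRange _)))

lemma IsSmoothInside.contDiffOn_rect (hf : X.IsSmoothInside t f) :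
    ContDiffOn ℝ ∞ (fun q => f (Sum.inr q))
      (xRange t ×ˢ Ioo (-(Real.pi / 2)) (Real.pi / 2)) :=
  hf.2.1.mono (prod_mono le_rfl (Ioo_subset_openCoordRange _))

lemma continuousOn_rectDirDeriv (hf : ContDiffOn ℝ ∞ (fun q => f (Sum.inr q))
      (xRange t ×ˢ Ioo (-(Real.pi / 2)) (Real.pi / 2))) (v : ℝ × ℝ) :
    ContinuousOn (rectDirDeriv v f) (xRange t ×ˢ Ioo (-(Real.pi / 2)) (Real.pi / 2)) :=
  (hf.continuousOn_fderiv_of_isOpen (isOpen_rect t) (by simp)).clm_apply continuousOn_const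

lemma IsSmooth.memLp_rectDirDeriv (ht : 1 ≤ t) (hf : X.IsSmooth t f) (v : ℝ × ℝ) (p : ENNReal) :
    MemLp (rectDirDeriv v f) p (rectMeasure t) := by
  obtain ⟨C, hC0, hC⟩ := hf.exists_fderiv_bound ht
  refine MemLp.of_bound ((continuousOn_rectDirDeriv hf.contDiffOn_rect v).aestronglyMeasurable
    (measurableSet_rect t)) (Real.sqrt (C * (v.1 ^ 2 + v.2 ^ 2)))
    ((ae_restrict_iff' (measurableSet_rect t)).2 (ae_of_all _ fun q hq => ?_))
  rw [Real.norm_eq_abs]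
  exact Real.abs_le_sqrt (hC q.1 hq.1 q.2 hq.2 v)

/-- The part of the Dirichlet integral over `W`. -/
def restForm (X : PartiallyRectangularDomain M) (t : ℝ) (f h : M ⊕ ℝ × ℝ → ℝ) : ℝ :=
  ∫ p in X.rest ∩ interior X.carrier,
    gradInner X.metric (fun p => f (X.seamMap t p)) (fun p => h (X.seamMap t p)) p
      ∂(riemannianVolume X.metric)

lemma dirichletForm_eq (X : PartiallyRectangularDomain M) (t : ℝ) (f h : M ⊕ ℝ × ℝ → ℝ) :
    X.dirichletForm t f h = restForm X t f h +
      ∫ q, (rectDirDeriv (1, 0) f q * rectDirDeriv (1, 0) h q +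
        rectDirDeriv (0, 1) f q * rectDirDeriv (0, 1) h q) ∂(rectMeasure t) := rfl

lemma IsSmooth.integrableOn_gradInner [T2Space M] [SecondCountableTopology M]
    (hf : X.IsSmooth t f) (hh : X.IsSmooth t h) :
    IntegrableOn (gradInner X.metric (fun p => f (X.seamMap t p)) (fun p => h (X.seamMap t p)))
      (X.rest ∩ interior X.carrier) (riemannianVolume X.metric) := by
  have hms : MeasurableSet (X.rest ∩ interior X.carrier) :=
    X.measurableSet_rest.inter isOpen_interior.measurableSet
  obtain ⟨C, hC0, hC⟩ := hf.exists_gradInner_bound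
  obtain ⟨C', hC0', hC'⟩ := hh.exists_gradInner_bound
  obtain ⟨-, -, O, hO, hr, f3⟩ := hf
  obtain ⟨-, -, O', hO', hr', h3⟩ := hh
  have hsub1 : interior X.carrier ∩ (O ∩ O') ⊆ X.carrier ∩ O := fun p hp =>
    ⟨interior_subset hp.1, hp.2.1⟩
  have hsub2 : interior X.carrier ∩ (O ∩ O') ⊆ X.carrier ∩ O' := fun p hp =>
    ⟨interior_subset hp.1, hp.2.2⟩
  have hcont := continuousOn_gradInner X.metric (isOpen_interior.inter (hO.inter hO'))
    (f3.mono hsub1) (h3.mono hsub2)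
  refine IntegrableOn.of_bound (C := C + C') ?_ ?_ ?_
  · exact (measure_mono inter_subset_left).trans_lt
      (riemannianVolume_lt_top_of_isCompact X.metric X.isCompact_rest)
  · exact (hcont.mono fun p hp => ⟨hp.2, hr hp.1, hr' hp.1⟩).aestronglyMeasurable hms
  · refine (ae_restrict_iff' hms).2 (ae_of_all _ fun p hp => ?_)
    exact (gradInner_sq_le _ _ _ _).trans (add_le_add (hC p hp) (hC' p hp))

end PartiallyRectangularDomain

/-! ### Symmetric forms and double limits -/

lemma bilinForm_sq_le {V : Type*} [AddCommGroup V] [Module ℝ V] (B : LinearMap.BilinForm ℝ V)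
    (hsymm : ∀ x y, B x y = B y x) (hpos : ∀ x, 0 ≤ B x x) (x y : V) :
    B x y ^ 2 ≤ B x x * B y y := by
  have := LinearMap.BilinForm.apply_mul_apply_le_of_forall_zero_le B hpos x y
  rwa [hsymm y x, ← sq] at this

/-- Sequences that are Cauchy for a nonnegative symmetric form have a joint limit. -/
lemma exists_tendsto_bilinForm {V : Type*} [AddCommGroup V] [Module ℝ V]
    (B : LinearMap.BilinForm ℝ V) (hsymm : ∀ x y, B x y = B y x) (hpos : ∀ x, 0 ≤ B x x)
    {x y : ℕ → V}
    (hx : Tendsto (fun k : ℕ × ℕ => B (x k.1 - x k.2) (x k.1 - x k.2)) atTop (𝓝 0))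
    (hy : Tendsto (fun k : ℕ × ℕ => B (y k.1 - y k.2) (y k.1 - y k.2)) atTop (𝓝 0)) :
    ∃ L, Tendsto (fun k : ℕ × ℕ => B (x k.1) (y k.2)) atTop (𝓝 L) := by
  have small : ∀ {z : ℕ → V},
      Tendsto (fun k : ℕ × ℕ => B (z k.1 - z k.2) (z k.1 - z k.2)) atTop (𝓝 0) →
      ∀ δ > 0, ∃ N, ∀ n ≥ N, ∀ m ≥ N, B (z n - z m) (z n - z m) < δ := by
    intro z hz δ hδ
    obtain ⟨⟨N, N'⟩, hN⟩ := eventually_atTop.1 (hz.eventually (gt_mem_nhds hδ))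
    exact ⟨max N N', fun n hn m hm => hN (n, m) ⟨(le_max_left _ _).trans hn,
      (le_max_right _ _).trans hm⟩⟩
  have bdd : ∀ {z : ℕ → V},
      Tendsto (fun k : ℕ × ℕ => B (z k.1 - z k.2) (z k.1 - z k.2)) atTop (𝓝 0) →
      ∃ K, 0 < K ∧ ∃ N, ∀ n ≥ N, B (z n) (z n) ≤ K := by
    intro z hz
    obtain ⟨N, hN⟩ := small hz 1 one_pos
    -- From `z n = (z n - z N) + z N` and the parallelogram law, `B(z n) ≤ 2 B(z n - z N) + 2 B(z
    -- N)`.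
    refine ⟨2 + 2 * B (z N) (z N), by linarith [hpos (z N)], N, fun n hn => ?_⟩
    have h1 := hN n hn N le_rfl
    have h2 := hpos (z n - (2 : ℝ) • z N)
    simp only [map_sub, map_smul, LinearMap.sub_apply, LinearMap.smul_apply, smul_eq_mul] at h1 h2
    rw [hsymm (z N) (z n)] at h1 h2
    linarith
  obtain ⟨K, hK0, N₁, hK⟩ := bdd hy
  obtain ⟨K', hK0', N₂, hK'⟩ := bdd hx
  refine cauchySeq_tendsto_of_complete (Metric.cauchySeq_iff'.2 fun ε hε => ?_)
  obtain ⟨N₃, h3⟩ := small hx (ε ^ 2 / (4 * K)) (by positivity)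
  obtain ⟨N₄, h4⟩ := small hy (ε ^ 2 / (4 * K')) (by positivity)
  set N := max (max N₁ N₂) (max N₃ N₄) with hN
  have e1 : N₁ ≤ N := (le_max_left _ _).trans (le_max_left _ _)
  have e2 : N₂ ≤ N := (le_max_right _ _).trans (le_max_left _ _)
  have e3 : N₃ ≤ N := (le_max_left _ _).trans (le_max_right _ _)
  have e4 : N₄ ≤ N := (le_max_right _ _).trans (le_max_right _ _)
  refine ⟨(N, N), ?_⟩
  rintro ⟨n, m⟩ ⟨hn, hm⟩
  simp only at hn hm
  have a1 : |B (x n - x N) (y m)| < ε / 2 := by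
    refine abs_lt_of_sq_lt_sq ?_ (by positivity)
    calc _ ≤ _ := bilinForm_sq_le B hsymm hpos _ _
      _ ≤ B (x n - x N) (x n - x N) * K :=
        mul_le_mul_of_nonneg_left (hK m (e1.trans hm)) (hpos _)
      _ < ε ^ 2 / (4 * K) * K :=
        mul_lt_mul_of_pos_right (h3 n (e3.trans hn) N e3) hK0
      _ = (ε / 2) ^ 2 := by field_simp; ring
  have a2 : |B (x N) (y m - y N)| < ε / 2 := by
    refine abs_lt_of_sq_lt_sq ?_ (by positivity)
    calc _ ≤ _ := bilinForm_sq_le B hsymm hpos _ _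
      _ ≤ K' * B (y m - y N) (y m - y N) :=
        mul_le_mul_of_nonneg_right (hK' N e2) (hpos _)
      _ < K' * (ε ^ 2 / (4 * K')) :=
        mul_lt_mul_of_pos_left (h4 m (e4.trans hm) N e4) hK0'
      _ = (ε / 2) ^ 2 := by field_simp; ring
  rw [Real.dist_eq]
  have : B (x n) (y m) - B (x N) (y N) = B (x n - x N) (y m) + B (x N) (y m - y N) := by
    simp only [map_sub, LinearMap.sub_apply]; ring
  rw [this]
  linarith [abs_add_le (B (x n - x N) (y m)) (B (x N) (y m - y N))]

/-- A symmetric form that is linear on a subspace of a space of functions. -/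
def formOn {V : Type*} [AddCommGroup V] [Module ℝ V] (S : Submodule ℝ V) (F : V → V → ℝ)
    (hsymm : ∀ x ∈ S, ∀ y ∈ S, F x y = F y x)
    (hlin : ∀ x ∈ S, ∀ y ∈ S, ∀ z ∈ S, ∀ a b : ℝ, F (a • x + b • y) z = a * F x z + b * F y z) :
    LinearMap.BilinForm ℝ S :=
  have hadd : ∀ x y z : S, F (x + y) z = F x z + F y z := fun x y z => by
    have := hlin x x.2 y y.2 z z.2 1 1
    simpa using this
  have hsmul : ∀ (c : ℝ) (x z : S), F (c • (x : V)) z = c * F x z := fun c x z => by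
    have := hlin x x.2 x x.2 z z.2 c 0
    simpa using this
  LinearMap.mk₂ ℝ (fun x y : S => F x y) (fun x y z => hadd x y z)
    (fun c x z => hsmul c x z)
    (fun x y z => by
      have h := hadd y z x
      rw [hsymm _ (S.add_mem y.2 z.2) _ x.2, hsymm y y.2 x x.2, hsymm z z.2 x x.2] at h
      exact h)
    (fun c x z => by
      have h := hsmul c z x
      rw [hsymm _ (S.smul_mem c z.2) _ x.2, hsymm z z.2 x x.2] at h
      exact h)

/-! ### Linearity, symmetry and limits of the quadratic form. -/

namespace PartiallyRectangularDomain

variable {M : Type*} [TopologicalSpace M] [T2Space M] [SecondCountableTopology M]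
  [ChartedSpace (EuclideanSpace ℝ (Fin 2)) M]
  [IsManifold (𝓡 2) ∞ M] [MeasurableSpace M] [BorelSpace M]
variable {X : PartiallyRectangularDomain M} {t : ℝ} {f h k : M ⊕ ℝ × ℝ → ℝ}

lemma IsSmooth.mdifferentiableAt_seam (hf : X.IsSmooth t f) {p : M}
    (hp : p ∈ X.rest ∩ interior X.carrier) :
    MDifferentiableAt (𝓡 2) 𝓘(ℝ, ℝ) (fun p => f (X.seamMap t p)) p := by
  obtain ⟨-, -, O, hO, hr, f3⟩ := hf
  exact (f3.contMDiffAt (inter_mem (mem_interior_iff_mem_nhds.1 hp.2)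
    (hO.mem_nhds (hr hp.1)))).mdifferentiableAt (by simp)

lemma IsSmooth.differentiableAt_rect (hf : X.IsSmooth t f) {q : ℝ × ℝ}
    (hq : q ∈ xRange t ×ˢ Ioo (-(Real.pi / 2)) (Real.pi / 2)) :
    DifferentiableAt ℝ (fun q => f (Sum.inr q)) q :=
  (hf.contDiffOn_rect.contDiffAt ((isOpen_rect t).mem_nhds hq)).differentiableAt (by simp)

lemma IsSmooth.rectDirDeriv_linear (hf : X.IsSmooth t f) (hh : X.IsSmooth t h) (a b : ℝ)
    {q : ℝ × ℝ} (hq : q ∈ xRange t ×ˢ Ioo (-(Real.pi / 2)) (Real.pi / 2)) (v : ℝ × ℝ) :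
    rectDirDeriv v (a • f + b • h) q = a * rectDirDeriv v f q + b * rectDirDeriv v h q := by
  have := ((hf.differentiableAt_rect hq).hasFDerivAt.const_smul a).add
    ((hh.differentiableAt_rect hq).hasFDerivAt.const_smul b)
  have h2 := this.fderiv
  exact (congrArg (fun L : ℝ × ℝ →L[ℝ] ℝ => L v) h2).trans (by simp [rectDirDeriv])

lemma restForm_linear (hf : X.IsSmooth t f) (hh : X.IsSmooth t h) (hk : X.IsSmooth t k) (a b : ℝ) :
    restForm X t (a • f + b • h) k = a * restForm X t f k + b * restForm X t h k := by
  simp only [restForm]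
  rw [← integral_const_mul, ← integral_const_mul,
    ← integral_add ((hf.integrableOn_gradInner hk).const_mul a)
      ((hh.integrableOn_gradInner hk).const_mul b)]
  refine setIntegral_congr_fun (X.measurableSet_rest.inter isOpen_interior.measurableSet)
    fun p hp => ?_
  have h1 := hf.mdifferentiableAt_seam hp
  have h2 := hh.mdifferentiableAt_seam hp
  have hd : ∀ i, partialDeriv (fun p => (a • f + b • h) (X.seamMap t p)) p i =
      a * partialDeriv (fun p => f (X.seamMap t p)) p i +
      b * partialDeriv (fun p => h (X.seamMap t p)) p i := fun i => by
    have h3 := ((h1.hasMFDerivAt.const_smul a).add (h2.hasMFDerivAt.const_smul b)).mfderiv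
    exact congrArg (fun L : TangentSpace (𝓡 2) p →L[ℝ] ℝ => L (tangentBasis p i)) h3
  simp only [gradInner, hd, Finset.mul_sum, ← Finset.sum_add_distrib]
  exact Finset.sum_congr rfl fun i _ => Finset.sum_congr rfl fun j _ => by ring

lemma restForm_comm (X : PartiallyRectangularDomain M) (t : ℝ) (f h : M ⊕ ℝ × ℝ → ℝ) :
    restForm X t f h = restForm X t h f := by
  simp only [restForm]
  exact integral_congr_ae (ae_of_all _ fun p => gradInner_comm _ _ _ _)

lemma restForm_self_nonneg (X : PartiallyRectangularDomain M) (t : ℝ) (f : M ⊕ ℝ × ℝ → ℝ) :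
    0 ≤ restForm X t f f :=
  integral_nonneg fun _ => gradInner_self_nonneg _ _ _

lemma IsSmooth.integrable_deriv_mul (ht : 1 ≤ t) (hf : X.IsSmooth t f) (hh : X.IsSmooth t h)
    (v w : ℝ × ℝ) :
    Integrable (fun q => rectDirDeriv v f q * rectDirDeriv w h q) (rectMeasure t) :=
  (hf.memLp_rectDirDeriv ht v 2).integrable_mul (hh.memLp_rectDirDeriv ht w 2)

lemma dirichletForm_eq' (ht : 1 ≤ t) (hf : X.IsSmooth t f) (hh : X.IsSmooth t h) :
    X.dirichletForm t f h = restForm X t f h +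
      ((∫ q, rectDirDeriv (1, 0) f q * rectDirDeriv (1, 0) h q ∂(rectMeasure t)) +
        ∫ q, rectDirDeriv (0, 1) f q * rectDirDeriv (0, 1) h q ∂(rectMeasure t)) := by
  rw [dirichletForm_eq, integral_add (hf.integrable_deriv_mul ht hh _ _)
    (hf.integrable_deriv_mul ht hh _ _)]

lemma integral_rectDirDeriv_linear (ht : 1 ≤ t) (hf : X.IsSmooth t f) (hh : X.IsSmooth t h)
    (hk : X.IsSmooth t k) (a b : ℝ) (v : ℝ × ℝ) :
    ∫ q, rectDirDeriv v (a • f + b • h) q * rectDirDeriv v k q ∂(rectMeasure t) =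
      a * (∫ q, rectDirDeriv v f q * rectDirDeriv v k q ∂(rectMeasure t)) +
      b * ∫ q, rectDirDeriv v h q * rectDirDeriv v k q ∂(rectMeasure t) := by
  rw [← integral_const_mul, ← integral_const_mul,
    ← integral_add ((hf.integrable_deriv_mul ht hk v v).const_mul a)
      ((hh.integrable_deriv_mul ht hk v v).const_mul b)]
  refine setIntegral_congr_fun (measurableSet_rect t) fun q hq => ?_
  simp only [hf.rectDirDeriv_linear hh a b hq]
  ring

lemma dirichletForm_linear (ht : 1 ≤ t) (hf : X.IsSmooth t f) (hh : X.IsSmooth t h)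
    (hk : X.IsSmooth t k) (a b : ℝ) :
    X.dirichletForm t (a • f + b • h) k = a * X.dirichletForm t f k + b * X.dirichletForm t h k := by
  rw [dirichletForm_eq' ht (hf.linear hh a b) hk, dirichletForm_eq' ht hf hk,
    dirichletForm_eq' ht hh hk, restForm_linear hf hh hk, integral_rectDirDeriv_linear ht hf hh hk,
    integral_rectDirDeriv_linear ht hf hh hk]
  ring

lemma dirichletForm_comm (X : PartiallyRectangularDomain M) (t : ℝ) (f h : M ⊕ ℝ × ℝ → ℝ) :
    X.dirichletForm t f h = X.dirichletForm t h f := by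
  rw [dirichletForm_eq, dirichletForm_eq, restForm_comm]
  congr 1
  exact integral_congr_ae (ae_of_all _ fun q => by ring)

lemma dirichletForm_self_nonneg (X : PartiallyRectangularDomain M) (t : ℝ) (f : M ⊕ ℝ × ℝ → ℝ) :
    0 ≤ X.dirichletForm t f f := by
  rw [dirichletForm_eq]
  refine add_nonneg (restForm_self_nonneg X t f) (integral_nonneg fun q => ?_)
  exact add_nonneg (mul_self_nonneg _) (mul_self_nonneg _)

lemma integral_boundary_linear (ht : 1 ≤ t) (hf : X.IsSmooth t f) (hh : X.IsSmooth t h)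
    (hk : X.IsSmooth t k) (a b : ℝ) :
    ∫ z, (a • f + b • h) z * k z ∂(X.boundaryMeasure t) =
      a * (∫ z, f z * k z ∂(X.boundaryMeasure t)) + b * ∫ z, h z * k z ∂(X.boundaryMeasure t) := by
  have h1 : Integrable (fun z => f z * k z) (X.boundaryMeasure t) :=
    (hf.memLp_boundary ht 2).integrable_mul (hk.memLp_boundary ht 2)
  have h2 : Integrable (fun z => h z * k z) (X.boundaryMeasure t) :=
    (hh.memLp_boundary ht 2).integrable_mul (hk.memLp_boundary ht 2)
  rw [← integral_const_mul, ← integral_const_mul, ← integral_add (h1.const_mul a) (h2.const_mul b)]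
  exact integral_congr_ae (ae_of_all _ fun z => by
    simp only [Pi.add_apply, Pi.smul_apply, smul_eq_mul]; ring)

/-- The energy controlling both terms of the quadratic form. -/
def energy (X : PartiallyRectangularDomain M) (t : ℝ) (bc : BoundaryCondition)
    (f : M ⊕ ℝ × ℝ → ℝ) : ℝ :=
  X.dirichletForm t f f + |bc.coeff| * ∫ z, f z ^ 2 ∂(X.boundaryMeasure t)

/-- A sequence that is Cauchy for the energy. -/
def IsEnergyCauchy (X : PartiallyRectangularDomain M) (t : ℝ) (bc : BoundaryCondition)
    (f : ℕ → M ⊕ ℝ × ℝ → ℝ) : Prop :=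
  Tendsto (fun k : ℕ × ℕ => X.energy t bc (f k.1 - f k.2)) atTop (𝓝 0)

lemma integral_boundary_sq_nonneg (X : PartiallyRectangularDomain M) (t : ℝ)
    (f : M ⊕ ℝ × ℝ → ℝ) : 0 ≤ ∫ z, f z ^ 2 ∂(X.boundaryMeasure t) :=
  integral_nonneg fun _ => sq_nonneg _

lemma IsEnergyCauchy.dirichletForm {bc : BoundaryCondition} {f : ℕ → M ⊕ ℝ × ℝ → ℝ}
    (hf : X.IsEnergyCauchy t bc f) :
    Tendsto (fun k : ℕ × ℕ => X.dirichletForm t (f k.1 - f k.2) (f k.1 - f k.2)) atTop (𝓝 0) :=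
  squeeze_zero (fun _ => X.dirichletForm_self_nonneg t _) (fun _ => le_add_of_nonneg_right
    (mul_nonneg (abs_nonneg _) (X.integral_boundary_sq_nonneg t _))) hf

lemma IsEnergyCauchy.boundary {bc : BoundaryCondition} {f : ℕ → M ⊕ ℝ × ℝ → ℝ}
    (hf : X.IsEnergyCauchy t bc f) :
    Tendsto (fun k : ℕ × ℕ => |bc.coeff| * ∫ z, (f k.1 - f k.2) z ^ 2 ∂(X.boundaryMeasure t))
      atTop (𝓝 0) :=
  squeeze_zero (fun _ => mul_nonneg (abs_nonneg _) (X.integral_boundary_sq_nonneg t _))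
    (fun _ => le_add_of_nonneg_left (X.dirichletForm_self_nonneg t _)) hf

/-- Along energy-Cauchy sequences the quadratic form has a joint limit. -/
lemma exists_tendsto_laplaceForm (ht : 1 ≤ t) {bc : BoundaryCondition} {f h : ℕ → M ⊕ ℝ × ℝ → ℝ}
    (hfs : ∀ n, X.IsSmooth t (f n)) (hhs : ∀ n, X.IsSmooth t (h n))
    (hf : X.IsEnergyCauchy t bc f) (hh : X.IsEnergyCauchy t bc h) :
    ∃ L, Tendsto (fun k : ℕ × ℕ => X.laplaceForm t bc (f k.1) (h k.2)) atTop (𝓝 L) := by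
  let S := X.smoothFunctions t
  let x : ℕ → S := fun n => ⟨f n, hfs n⟩
  let y : ℕ → S := fun n => ⟨h n, hhs n⟩
  let B₁ : LinearMap.BilinForm ℝ S := formOn S (X.dirichletForm t)
    (fun f _ h _ => dirichletForm_comm X t f h)
    (fun f hf h hh k hk a b => dirichletForm_linear ht hf hh hk a b)
  let B₂ : LinearMap.BilinForm ℝ S := formOn S
    (fun f h => ∫ z, f z * h z ∂(X.boundaryMeasure t))
    (fun f _ h _ => by simp only [mul_comm])
    (fun f hf h hh k hk a b => integral_boundary_linear ht hf hh hk a b)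
  obtain ⟨L₁, hL₁⟩ := exists_tendsto_bilinForm B₁ (fun x y => dirichletForm_comm X t x y)
    (fun x => X.dirichletForm_self_nonneg t x) (x := x) (y := y) hf.dirichletForm hh.dirichletForm
  -- The energy controls boundary values only after multiplication by `|β|`, and not at all when `β
  -- = 0`. The limit is therefore taken for the nonnegative form `|β| ∫ f h`, and the sign of `β` is
  -- restored afterwards.
  obtain ⟨L₂, hL₂⟩ := exists_tendsto_bilinForm (|bc.coeff| • B₂)
    (fun x y => by
      change |bc.coeff| * (∫ z, x.1 z * y.1 z ∂_) = |bc.coeff| * (∫ z, y.1 z * x.1 z ∂_)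
      simp only [mul_comm (x.1 _)])
    (fun x => mul_nonneg (abs_nonneg _) (integral_nonneg fun z => mul_self_nonneg _))
    (x := x) (y := y)
    (by have := hf.boundary; simp only [sq] at this; exact this)
    (by have := hh.boundary; simp only [sq] at this; exact this)
  refine ⟨L₁ - Real.sign bc.coeff * L₂, (hL₁.sub (hL₂.const_mul _)).congr fun k => ?_⟩
  change X.dirichletForm t (f k.1) (h k.2) - Real.sign bc.coeff * (|bc.coeff| *
    ∫ z, f k.1 z * h k.2 z ∂_) = _
  have hs : Real.sign bc.coeff * |bc.coeff| = bc.coeff := by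
    rcases lt_trichotomy bc.coeff 0 with h | h | h
    · rw [Real.sign_of_neg h, abs_of_neg h]; ring
    · rw [h]; simp
    · rw [Real.sign_of_pos h, abs_of_pos h]; ring
  rw [laplaceForm, ← mul_assoc, hs]

end PartiallyRectangularDomain

/-! ### Stretching maps -/

/-- A diffeomorphism `J` of the line, with derivative `r`, that maps `(-tπ/2, tπ/2)` onto
`(-sπ/2, sπ/2)` and is a translation near the ends. -/
structure IsStretch (t s : ℝ) (J r : ℝ → ℝ) : Prop where
  smooth : ContDiff ℝ ∞ J
  hasDerivAt : ∀ x, HasDerivAt J (r x) x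
  pos : ∀ x, 0 < r x
  ends : ∃ η, 0 < η ∧ η < Real.pi / 2 ∧
    (∀ x, t * (Real.pi / 2) - η ≤ x → J x = x + (s - t) * (Real.pi / 2)) ∧
    ∀ x, x ≤ -(t * (Real.pi / 2) - η) → J x = x - (s - t) * (Real.pi / 2)

namespace IsStretch

variable {t s : ℝ} {J r : ℝ → ℝ}

lemma strictMono (hJ : IsStretch t s J r) : StrictMono J :=
  strictMono_of_deriv_pos fun x => by rw [(hJ.hasDerivAt x).deriv]; exact hJ.pos x

lemma smooth_deriv (hJ : IsStretch t s J r) : ContDiff ℝ ∞ r := by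
  have h : deriv J = r := funext fun x => (hJ.hasDerivAt x).deriv
  rw [← h]
  exact (contDiff_infty_iff_deriv.1 hJ.smooth).2

lemma surjective (hJ : IsStretch t s J r) : Function.Surjective J := by
  obtain ⟨η, -, -, h1, h2⟩ := hJ.ends
  refine hJ.smooth.continuous.surjective ?_ ?_
  · refine Tendsto.congr' (f₁ := fun x => x + (s - t) * (Real.pi / 2)) ?_
      (tendsto_atTop_add_const_right _ _ tendsto_id)
    filter_upwards [eventually_ge_atTop (t * (Real.pi / 2) - η)] with x hx using (h1 x hx).symm
  · refine Tendsto.congr' (f₁ := fun x => x - (s - t) * (Real.pi / 2)) ?_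
      (tendsto_atBot_add_const_right _ _ tendsto_id)
    filter_upwards [eventually_le_atBot (-(t * (Real.pi / 2) - η))] with x hx using (h2 x hx).symm

lemma apply_right (hJ : IsStretch t s J r) : J (t * (Real.pi / 2)) = s * (Real.pi / 2) := by
  obtain ⟨η, h0, -, h1, -⟩ := hJ.ends
  rw [h1 _ (by linarith)]; ring

lemma apply_left (hJ : IsStretch t s J r) : J (-(t * (Real.pi / 2))) = -(s * (Real.pi / 2)) := by
  obtain ⟨η, h0, -, -, h1⟩ := hJ.ends
  rw [h1 _ (by linarith)]; ring

lemma mem_xRange (hJ : IsStretch t s J r) {x : ℝ} : J x ∈ xRange s ↔ x ∈ xRange t := by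
  change -(s * (Real.pi / 2)) < J x ∧ J x < s * (Real.pi / 2) ↔ _
  rw [← hJ.apply_left, ← hJ.apply_right, hJ.strictMono.lt_iff_lt, hJ.strictMono.lt_iff_lt]
  rfl

lemma image_xRange (hJ : IsStretch t s J r) : J '' xRange t = xRange s := by
  ext y
  constructor
  · rintro ⟨x, hx, rfl⟩
    exact hJ.mem_xRange.2 hx
  · intro hy
    obtain ⟨x, rfl⟩ := hJ.surjective y
    exact ⟨x, hJ.mem_xRange.1 hy, rfl⟩

/-- Stretchings form a groupoid, so every statement about pulling functions back from `X_s` to `X_t`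
also gives the opposite direction, with the weight `r⁻¹` expressed at the preimage point. -/
lemma exists_inverse (hJ : IsStretch t s J r) :
    ∃ K, IsStretch s t K (fun x => (r (K x))⁻¹) ∧ (∀ x, K (J x) = x) ∧ ∀ x, J (K x) = x := by
  let e : ℝ ≃ₜ ℝ := (hJ.strictMono.orderIsoOfSurjective J hJ.surjective).toHomeomorph
  have he : ∀ x, e x = J x := fun x => rfl
  have hKJ : ∀ x, e.symm (J x) = x := fun x => e.symm_apply_apply x
  have hJK : ∀ x, J (e.symm x) = x := fun x => e.apply_symm_apply x
  refine ⟨e.symm, ⟨?_, fun x => ?_, fun x => inv_pos.2 (hJ.pos _), ?_⟩, hKJ, hJK⟩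
  · exact e.contDiff_symm_deriv (fun x => (hJ.pos x).ne') hJ.hasDerivAt hJ.smooth
  · exact (hJ.hasDerivAt (e.symm x)).of_local_left_inverse e.symm.continuous.continuousAt
      (hJ.pos _).ne' (Eventually.of_forall hJK)
  · obtain ⟨η, h0, h0', h1, h2⟩ := hJ.ends
    refine ⟨η, h0, h0', fun x hx => ?_, fun x hx => ?_⟩
    · have := h1 (x + (t - s) * (Real.pi / 2)) (by linarith)
      rw [show x + (t - s) * (Real.pi / 2) + (s - t) * (Real.pi / 2) = x by ring] at this
      rw [← this, hKJ, this]
    · have := h2 (x - (t - s) * (Real.pi / 2)) (by linarith)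
      rw [show x - (t - s) * (Real.pi / 2) - (s - t) * (Real.pi / 2) = x by ring] at this
      rw [← this, hKJ, this]

end IsStretch

/-- A smooth function of `x` that equals `1` near the ends of `(-tπ/2, tπ/2)`. -/
structure IsEndWeight (t : ℝ) (m : ℝ → ℝ) : Prop where
  smooth : ContDiff ℝ ∞ m
  ends : ∃ η, 0 < η ∧ ∀ x, t * (Real.pi / 2) - η ≤ |x| → m x = 1

lemma isEndWeight_one (t : ℝ) : IsEndWeight t fun _ => 1 :=
  ⟨contDiff_const, 1, one_pos, fun _ _ => rfl⟩

lemma IsEndWeight.exists_bound {t : ℝ} {m : ℝ → ℝ} (hm : IsEndWeight t m) :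
    ∃ C, 0 ≤ C ∧ ∀ x, |m x| ≤ C ∧ |deriv m x| ≤ C := by
  obtain ⟨η, hη, h⟩ := hm.ends
  set a := |t * (Real.pi / 2)| with ha
  have hc : Continuous (deriv m) := (contDiff_infty_iff_deriv.1 hm.smooth).2.continuous
  obtain ⟨C₁, h1⟩ := (isCompact_Icc (a := -a) (b := a)).bddAbove_image hm.smooth.continuous.abs.continuousOn
  obtain ⟨C₂, h2⟩ := (isCompact_Icc (a := -a) (b := a)).bddAbove_image hc.abs.continuousOn
  refine ⟨max 1 (max C₁ C₂), le_max_of_le_left zero_le_one, fun x => ?_⟩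
  by_cases hx : |x| ≤ a
  · exact ⟨(h1 ⟨x, abs_le.1 hx, rfl⟩).trans ((le_max_left _ _).trans (le_max_right _ _)),
      (h2 ⟨x, abs_le.1 hx, rfl⟩).trans ((le_max_right _ _).trans (le_max_right _ _))⟩
  · push Not at hx
    have hlt : t * (Real.pi / 2) - η < |x| := by linarith [le_abs_self (t * (Real.pi / 2))]
    have hev : m =ᶠ[𝓝 x] fun _ => 1 := by
      filter_upwards [(continuous_abs.tendsto x).eventually (lt_mem_nhds hlt)] with z hz
        using h z hz.le
    rw [hev.deriv_eq, hev.self_of_nhds]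
    simp

lemma IsStretch.isEndWeight_deriv {t s : ℝ} {J r : ℝ → ℝ} (hJ : IsStretch t s J r) :
    IsEndWeight t r := by
  obtain ⟨η, h0, h0', h1, h2⟩ := hJ.ends
  -- Halving `η` leaves room for `J` to be a translation in a full neighbourhood of `x`, so that its
  -- derivative there is `1`.
  refine ⟨hJ.smooth_deriv, η / 2, by positivity, fun x hx => ?_⟩
  refine (hJ.hasDerivAt x).unique ?_
  rcases le_abs.1 hx with h | h
  · refine ((hasDerivAt_id x).add_const ((s - t) * (Real.pi / 2))).congr_of_eventuallyEq ?_
    filter_upwards [lt_mem_nhds (show t * (Real.pi / 2) - η < x by linarith)] with z hz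
      using h1 z hz.le
  · refine ((hasDerivAt_id x).sub_const ((s - t) * (Real.pi / 2))).congr_of_eventuallyEq ?_
    filter_upwards [gt_mem_nhds (show x < -(t * (Real.pi / 2) - η) by linarith)] with z hz
      using h2 z hz.le

lemma IsStretch.isEndWeight_inv_deriv {t s : ℝ} {J r : ℝ → ℝ} (hJ : IsStretch t s J r) :
    IsEndWeight t fun x => (r x)⁻¹ := by
  obtain ⟨h1, η, h2, h3⟩ := hJ.isEndWeight_deriv
  exact ⟨h1.inv fun x => (hJ.pos x).ne', η, h2, fun x hx => by rw [h3 x hx, inv_one]⟩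

/-- The pull-back of a function on `X_s` to `X_t` by the map `(x, y) ↦ (J x, y)` of the rectangles,
multiplied by `m x`. -/
def transport {M : Type*} (m J : ℝ → ℝ) (f : M ⊕ ℝ × ℝ → ℝ) : M ⊕ ℝ × ℝ → ℝ :=
  Sum.elim (fun p => f (Sum.inl p)) fun q => m q.1 * f (Sum.inr (J q.1, q.2))

lemma transport_sub {M : Type*} (m J : ℝ → ℝ) (f h : M ⊕ ℝ × ℝ → ℝ) :
    transport m J f - transport m J h = transport m J (f - h) := by
  funext z
  rcases z with p | q
  · simp [transport]
  · simp [transport, mul_sub]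

namespace PartiallyRectangularDomain

variable {M : Type*} [TopologicalSpace M] [ChartedSpace (EuclideanSpace ℝ (Fin 2)) M]
  [IsManifold (𝓡 2) ∞ M] {X : PartiallyRectangularDomain M} {t s : ℝ} {J r m : ℝ → ℝ}
  {f h : M ⊕ ℝ × ℝ → ℝ}

variable (X) in
-- Outside the deep part of the rectangle `seamMap t` and `seamMap s` are translations to the
-- respective ends, and `J` is the translation intertwining them. Seen from a neighbourhood of `W`,
-- transport is thus the identity, which is why it preserves smoothness across the seam.
lemma exists_transport_seamMap (hJ : IsStretch t s J r) (hm : IsEndWeight t m) :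
    ∃ η, 0 < η ∧ η < Real.pi / 2 ∧ ∀ p ∈ X.carrier, p ∉ X.deepRect η → ∀ f : M ⊕ ℝ × ℝ → ℝ,
      transport m J f (X.seamMap t p) = f (X.seamMap s p) := by
  obtain ⟨η₁, h0, h0', h1, h2⟩ := hJ.ends
  obtain ⟨η₂, k0, k1⟩ := hm.ends
  refine ⟨min η₁ η₂, lt_min h0 k0, (min_le_left _ _).trans_lt h0', fun p hp hpd f => ?_⟩
  by_cases hr : p ∈ X.rest
  · simp [X.seamMap_of_mem_rest _ hr, transport]
  · obtain ⟨q, hq, rfl⟩ := X.exists_rect_of_notMem_rest hp hr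
    have hlt : Real.pi / 2 - min η₁ η₂ < |q.1| := by
      by_contra hle
      push Not at hle
      exact hpd (X.rect_mem_deepRect (x := q.1) (y := q.2) (lt_min h0 k0).le hle
        (crossSection_subset_coordRange _ hq.2))
    have e1 := min_le_left η₁ η₂
    have e2 := min_le_right η₁ η₂
    rw [X.seamMap_rect t hq, X.seamMap_rect s hq]
    rcases abs_cases q.1 with ⟨ha, hs⟩ | ⟨ha, hs⟩
    · have hpos : 0 < q.1 := by linarith
      rw [Real.sign_of_pos hpos]
      simp only [transport, Sum.elim_inr]
      rw [k1 _ (le_trans (by linarith) (le_abs_self _)), h1 _ (by linarith)]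
      ring_nf
    · rw [Real.sign_of_neg hs]
      simp only [transport, Sum.elim_inr]
      rw [k1 _ (le_trans (by linarith) (neg_le_abs _)), h2 _ (by linarith)]
      ring_nf

lemma IsPeriodic.transport (hJ : IsStretch t s J r) (hf : X.IsPeriodic s f) :
    X.IsPeriodic t (transport m J f) := fun hc x hx y => by
  simp only [_root_.transport, Sum.elim_inr]
  rw [hf hc (J x) (hJ.mem_xRange.2 hx)]

lemma IsSmooth.transport [T2Space M] (hJ : IsStretch t s J r) (hm : IsEndWeight t m)
    (hf : X.IsSmooth s f) : X.IsSmooth t (transport m J f) := by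
  obtain ⟨hp, hR, O, hO, hrest, hsm⟩ := hf
  obtain ⟨η, h0, h0', hη⟩ := X.exists_transport_seamMap hJ hm
  refine ⟨hp.transport hJ, ?_, O ∩ (X.deepRect η)ᶜ,
    hO.inter (X.isCompact_deepRect h0.le).isClosed.isOpen_compl,
    subset_inter hrest fun p hp hd => (X.disjoint_rest_deepRect h0).le_bot ⟨hp, hd⟩, ?_⟩
  · refine (hm.smooth.comp contDiff_fst).contDiffOn.mul
      (hR.comp (f := fun q : ℝ × ℝ => (J q.1, q.2)) ?_ ?_)
    · exact ((hJ.smooth.comp contDiff_fst).prodMk contDiff_snd).contDiffOn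
    · exact fun q hq => ⟨hJ.mem_xRange.2 hq.1, hq.2⟩
  · exact (hsm.mono fun p hp => ⟨hp.1, hp.2.1⟩).congr fun p hp => hη p hp.1 hp.2.2 f

/-- Near `W` the old compact set `K` still works. Where `J` is not a translation, `K` has to be
enlarged by the deep part of the rectangle. If there are horizontal sides, only `|y| ≤ π/2 - δ` is
added, so that the set stays in the interior; a cylinder has no horizontal sides and its deep part
lies in the interior. -/
lemma VanishesNearBoundary.transport (ht : 1 ≤ t) (hJ : IsStretch t s J r) (hm : IsEndWeight t m)
    (hp : X.IsPeriodic s f) (hf : X.VanishesNearBoundary s f) :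
    X.VanishesNearBoundary t (transport m J f) := by
  have hpi := Real.pi_pos
  obtain ⟨⟨K, hK, hKi, hf1⟩, hf2⟩ := hf
  obtain ⟨η, h0, h0', hη⟩ := X.exists_transport_seamMap hJ hm
  have hIcc : Icc (-(Real.pi / 2 - η)) (Real.pi / 2 - η) ⊆ Ioo (-(Real.pi / 2)) (Real.pi / 2) :=
    Icc_subset_Ioo (by linarith) (by linarith)
  have hzero : ∀ Kd : Set M, (∀ x y, |x| ≤ Real.pi / 2 - η → |y| ≤ Real.pi / 2 →
      X.rect (x, y) ∉ Kd → ∀ x ∈ xRange s, f (Sum.inr (x, y)) = 0) →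
      ∀ p ∈ X.carrier \ (K ∪ Kd), _root_.transport m J f (X.seamMap t p) = 0 := by
    rintro Kd hd p ⟨hp1, hp2⟩
    by_cases hpd : p ∈ X.deepRect η
    · obtain ⟨⟨x, y⟩, ⟨hx, hy⟩, rfl⟩ := hpd
      rw [X.apply_seamMap_rect ht (hp.transport hJ) (hIcc hx) (Icc_subset_coordRange _ hy)]
      simp only [_root_.transport, Sum.elim_inr]
      rw [hd x y (abs_le.2 hx) (abs_le.2 hy) (fun h => hp2 (Or.inr h)) _
        (hJ.mem_xRange.2 (shift_mem_xRange ht (hIcc hx))), mul_zero]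
    · rw [hη p hp1 hpd f]
      exact hf1 p ⟨hp1, fun h => hp2 (Or.inl h)⟩
  cases hc : X.cylinder
  · obtain ⟨δ, hδ, hf3⟩ := hf2 hc
    refine ⟨⟨K ∪ X.rect '' (Icc (-(Real.pi / 2 - η)) (Real.pi / 2 - η) ×ˢ
      Icc (-(Real.pi / 2 - δ)) (Real.pi / 2 - δ)), hK.union ?_, union_subset hKi ?_,
      hzero _ fun x y hx hy hxy x' hx' => ?_⟩, fun _ => ⟨δ, hδ, fun x hx y hy hlt => ?_⟩⟩
    · refine (isCompact_Icc.prod isCompact_Icc).image_of_continuousOn (X.rect_continuousOn.mono ?_)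
      refine prod_mono (hIcc.trans Ioo_subset_Icc_self) (Subset.trans ?_ (Icc_subset_coordRange _))
      exact Icc_subset_Icc (by linarith) (by linarith)
    · rintro _ ⟨⟨x, y⟩, ⟨hx, hy⟩, rfl⟩
      exact X.rect_mem_interior_carrier (hIcc hx) (Ioo_subset_openCoordRange _
        ⟨by linarith [hy.1], by linarith [hy.2]⟩)
    · refine hf3 x' hx' y (abs_le.1 hy) ?_
      by_contra hle
      push Not at hle
      exact hxy ⟨(x, y), ⟨abs_le.1 hx, abs_le.1 hle⟩, rfl⟩
    · simp only [_root_.transport, Sum.elim_inr]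
      rw [hf3 _ (hJ.mem_xRange.2 hx) y hy hlt, mul_zero]
  · refine ⟨⟨K ∪ X.deepRect η, hK.union (X.isCompact_deepRect h0.le), union_subset hKi ?_,
      hzero _ fun x y hx hy hxy x' hx' => ?_⟩, fun h => absurd h (by simp [hc])⟩
    · rintro _ ⟨⟨x, y⟩, ⟨hx, hy⟩, rfl⟩
      exact X.rect_mem_interior_carrier (hIcc hx) (by simp [hc, openCoordRange])
    · exact absurd ⟨(x, y), ⟨abs_le.1 hx, abs_le.1 hy⟩, rfl⟩ hxy

lemma IsTest.transport [T2Space M] {bc : BoundaryCondition} (ht : 1 ≤ t) (hJ : IsStretch t s J r)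
    (hm : IsEndWeight t m) (hf : X.IsTest s bc f) : X.IsTest t bc (transport m J f) :=
  ⟨hf.1.transport hJ hm, fun hbc => (hf.2 hbc).transport ht hJ hm hf.1.1⟩

end PartiallyRectangularDomain

/-! ### Changes of variables -/

/-- The injection `S` carries `ρ μ` to `ν`, for a positive function `ρ`. -/
structure IsDensityMap {α β : Type*} [MeasurableSpace α] [MeasurableSpace β] (S : α → β)
    (ρ : α → ℝ) (μ : Measure α) (ν : Measure β) : Prop where
  embedding : MeasurableEmbedding S
  measurable : Measurable ρ
  pos : ∀ z, 0 < ρ z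
  map_eq : Measure.map S (μ.withDensity fun z => ENNReal.ofReal (ρ z)) = ν

namespace IsDensityMap

variable {α β : Type*} [MeasurableSpace α] [MeasurableSpace β] {S : α → β} {ρ : α → ℝ}
  {μ : Measure α} {ν : Measure β}

lemma lintegral_eq (h : IsDensityMap S ρ μ ν) (F : β → ENNReal) :
    ∫⁻ z, F z ∂ν = ∫⁻ z, ENNReal.ofReal (ρ z) * F (S z) ∂μ := by
  rw [← h.map_eq, h.embedding.lintegral_map, lintegral_withDensity_eq_lintegral_mul_non_measurable]
  · rfl
  · exact h.measurable.ennreal_ofReal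
  · exact Eventually.of_forall fun z => ENNReal.ofReal_lt_top

lemma integrable_iff (h : IsDensityMap S ρ μ ν) (F : β → ℝ) :
    Integrable F ν ↔ Integrable (fun z => ρ z * F (S z)) μ := by
  rw [← h.map_eq, h.embedding.integrable_map_iff,
    integrable_withDensity_iff_integrable_smul' h.measurable.ennreal_ofReal
      (Eventually.of_forall fun z => ENNReal.ofReal_lt_top)]
  simp only [ENNReal.toReal_ofReal (h.pos _).le, smul_eq_mul, Function.comp]

lemma integral_eq (h : IsDensityMap S ρ μ ν) (F : β → ℝ) :
    ∫ z, F z ∂ν = ∫ z, ρ z * F (S z) ∂μ := by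
  rw [← h.map_eq, h.embedding.integral_map,
    integral_withDensity_eq_integral_toReal_smul h.measurable.ennreal_ofReal
      (Eventually.of_forall fun z => ENNReal.ofReal_lt_top)]
  simp only [ENNReal.toReal_ofReal (h.pos _).le, smul_eq_mul]

lemma aestronglyMeasurable_comp (h : IsDensityMap S ρ μ ν) {F : β → ℝ}
    (hF : AEStronglyMeasurable F ν) : AEStronglyMeasurable (fun z => F (S z)) μ := by
  rw [← h.map_eq, h.embedding.aestronglyMeasurable_map_iff] at hF
  exact hF.mono_ac (withDensity_absolutelyContinuous' h.measurable.ennreal_ofReal.aemeasurable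
    (Eventually.of_forall fun z => (ENNReal.ofReal_pos.2 (h.pos z)).ne'))

lemma eLpNorm_sq_eq {α : Type*} [MeasurableSpace α] {μ : Measure α} (F : α → ℝ) :
    eLpNorm F 2 μ = (∫⁻ z, ENNReal.ofReal (F z ^ 2) ∂μ) ^ (1 / 2 : ℝ) := by
  rw [eLpNorm_eq_lintegral_rpow_enorm_toReal (by norm_num) (by norm_num)]
  norm_num
  congr 2
  funext z
  rw [← ofReal_norm, ← ENNReal.ofReal_pow (norm_nonneg _), Real.norm_eq_abs, sq_abs]

lemma eLpNorm_le (h : IsDensityMap S ρ μ ν) {w : α → ℝ} {C : ℝ} (hC : 0 ≤ C)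
    (hw : ∀ z, w z ^ 2 ≤ C * ρ z) (F : β → ℝ) :
    eLpNorm (fun z => w z * F (S z)) 2 μ ≤ ENNReal.ofReal (Real.sqrt C) * eLpNorm F 2 ν := by
  rw [eLpNorm_sq_eq, eLpNorm_sq_eq, h.lintegral_eq, Real.sqrt_eq_rpow,
    ← ENNReal.ofReal_rpow_of_nonneg hC (by norm_num), ← ENNReal.mul_rpow_of_nonneg _ _ (by norm_num)]
  gcongr
  rw [← lintegral_const_mul' _ _ ENNReal.ofReal_ne_top]
  refine lintegral_mono fun z => ?_
  rw [← ENNReal.ofReal_mul (h.pos z).le, ← ENNReal.ofReal_mul hC]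
  refine ENNReal.ofReal_le_ofReal ?_
  nlinarith [hw z, sq_nonneg (F (S z))]

/-- Half a power of the density makes transplantation norm preserving; this is the weight that
occurs in `DependsSmoothly`. -/
lemma eLpNorm_eq (h : IsDensityMap S ρ μ ν) (F : β → ℝ) :
    eLpNorm (fun z => Real.sqrt (ρ z) * F (S z)) 2 μ = eLpNorm F 2 ν := by
  rw [eLpNorm_sq_eq, eLpNorm_sq_eq, h.lintegral_eq]
  congr 2
  funext z
  rw [← ENNReal.ofReal_mul (h.pos z).le, mul_pow, Real.sq_sqrt (h.pos z).le]

lemma memLp (h : IsDensityMap S ρ μ ν) {w : α → ℝ} {C : ℝ} (hC : 0 ≤ C) (hwm : Measurable w)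
    (hw : ∀ z, w z ^ 2 ≤ C * ρ z) {F : β → ℝ} (hF : MemLp F 2 ν) :
    MemLp (fun z => w z * F (S z)) 2 μ :=
  ⟨hwm.aestronglyMeasurable.mul (h.aestronglyMeasurable_comp hF.1),
    (h.eLpNorm_le hC hw F).trans_lt (ENNReal.mul_lt_top ENNReal.ofReal_lt_top hF.2)⟩

end IsDensityMap

/-- The map `(x, y) ↦ (J x, y)` of the rectangles, extended by the identity. -/
def stretchMap (M : Type*) (J : ℝ → ℝ) : M ⊕ ℝ × ℝ → M ⊕ ℝ × ℝ :=
  Sum.map id fun q => (J q.1, q.2)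

/-- The function `m(x)` on the rectangle, extended by `1`. -/
def endWeight (M : Type*) (m : ℝ → ℝ) : M ⊕ ℝ × ℝ → ℝ :=
  Sum.elim (fun _ => 1) fun q => m q.1

lemma transport_eq {M : Type*} (m J : ℝ → ℝ) (f : M ⊕ ℝ × ℝ → ℝ) :
    transport m J f = fun z => endWeight M m z * f (stretchMap M J z) := by
  funext z
  rcases z with p | q <;> simp [transport, endWeight, stretchMap]

lemma measurable_endWeight {M : Type*} [MeasurableSpace M] {m : ℝ → ℝ} (hm : Measurable m) :
    Measurable (endWeight M m) :=
  measurable_const.sumElim (hm.comp measurable_fst)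

lemma IsDensityMap.withDensity_prod {t s : ℝ} {J r : ℝ → ℝ}
    (h : IsDensityMap J r (volume.restrict (xRange t)) (volume.restrict (xRange s))) :
    IsDensityMap (fun q : ℝ × ℝ => (J q.1, q.2)) (fun q => r q.1) (rectMeasure t)
      (rectMeasure s) := by
  refine ⟨h.embedding.prodMap MeasurableEmbedding.id, h.measurable.comp measurable_fst,
    fun q => h.pos _, ?_⟩
  have h1 : SigmaFinite ((volume.restrict (xRange t)).withDensity
      fun z => ENNReal.ofReal (r z)) := by
    refine SigmaFinite.withDensity_of_ne_top (Eventually.of_forall fun z => ENNReal.ofReal_ne_top)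
  rw [rectMeasure_eq_prod, rectMeasure_eq_prod, ← h.map_eq,
    ← prod_withDensity_left h.measurable.ennreal_ofReal]
  have := Measure.map_prod_map ((volume.restrict (xRange t)).withDensity
      fun z => ENNReal.ofReal (r z)) (volume.restrict (Ioo (-(Real.pi / 2)) (Real.pi / 2)))
      h.embedding.measurable measurable_id
  rw [Measure.map_id] at this
  exact this.symm

namespace IsStretch

variable {t s : ℝ} {J r : ℝ → ℝ}

lemma isDensityMap (hJ : IsStretch t s J r) :
    IsDensityMap J r (volume.restrict (xRange t)) (volume.restrict (xRange s)) := by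
  have he : MeasurableEmbedding J :=
    hJ.smooth.continuous.measurableEmbedding hJ.strictMono.injective
  refine ⟨he, hJ.smooth_deriv.continuous.measurable, hJ.pos, ?_⟩
  refine Measure.ext_of_lintegral _ fun f hf => ?_
  rw [he.lintegral_map, lintegral_withDensity_eq_lintegral_mul_non_measurable]
  · rw [← hJ.image_xRange, lintegral_image_eq_lintegral_abs_deriv_mul (s := xRange t) measurableSet_Ioo
      (fun x _ => (hJ.hasDerivAt x).hasDerivWithinAt) hJ.strictMono.injective.injOn]
    simp only [abs_of_pos (hJ.pos _)]
    rfl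
  · exact hJ.smooth_deriv.continuous.measurable.ennreal_ofReal
  · exact Eventually.of_forall fun z => ENNReal.ofReal_lt_top

lemma isDensityMap_rect (hJ : IsStretch t s J r) :
    IsDensityMap (fun q : ℝ × ℝ => (J q.1, q.2)) (fun q => r q.1) (rectMeasure t)
      (rectMeasure s) := hJ.isDensityMap.withDensity_prod

end IsStretch

lemma measurableEmbedding_stretchMap {M : Type*} [MeasurableSpace M] {J : ℝ → ℝ}
    (hJ : MeasurableEmbedding J) : MeasurableEmbedding (stretchMap M J) := by
  have h2 : MeasurableEmbedding fun q : ℝ × ℝ => (J q.1, q.2) :=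
    hJ.prodMap MeasurableEmbedding.id
  refine ⟨Function.injective_id.sumMap h2.injective, ?_, fun A hA => ?_⟩
  · exact (measurable_inl.comp measurable_id).sumElim (measurable_inr.comp h2.measurable)
  · have : stretchMap M J '' A = Sum.inl '' (Sum.inl ⁻¹' A) ∪
        Sum.inr '' ((fun q : ℝ × ℝ => (J q.1, q.2)) '' (Sum.inr ⁻¹' A)) := by
      ext z
      rcases z with p | q <;> simp [stretchMap]
    rw [this]
    exact (measurableEmbedding_inl.measurableSet_image.2 (measurable_inl hA)).union
      (measurableEmbedding_inr.measurableSet_image.2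
        (h2.measurableSet_image.2 (measurable_inr hA)))

lemma withDensity_map_of_comp {α β γ : Type*} [MeasurableSpace α] [MeasurableSpace β]
    [MeasurableSpace γ] {e : α → β} (he : MeasurableEmbedding e) {S : β → γ} (hS : Measurable S)
    (μ : Measure α) {ρ : β → ENNReal} (hρ : Measurable ρ) :
    Measure.map S ((Measure.map e μ).withDensity ρ) =
      Measure.map (S ∘ e) (μ.withDensity (ρ ∘ e)) := by
  refine Measure.ext_of_lintegral _ fun f hf => ?_
  rw [lintegral_map hf hS, lintegral_map hf (hS.comp he.measurable),
    lintegral_withDensity_eq_lintegral_mul _ hρ (g := fun a => f (S a)) (hf.comp hS), he.lintegral_map,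
    lintegral_withDensity_eq_lintegral_mul _ (hρ.comp he.measurable)
      (g := fun a => f ((S ∘ e) a)) (hf.comp (hS.comp he.measurable))]
  rfl

namespace PartiallyRectangularDomain

variable {M : Type*} [TopologicalSpace M] [ChartedSpace (EuclideanSpace ℝ (Fin 2)) M]
  [IsManifold (𝓡 2) ∞ M] [MeasurableSpace M] [BorelSpace M]

lemma isDensityMap_vol (X : PartiallyRectangularDomain M) {t s : ℝ} {J r : ℝ → ℝ}
    (h : IsDensityMap J r (volume.restrict (xRange t)) (volume.restrict (xRange s))) :
    IsDensityMap (stretchMap M J) (endWeight M r) (X.vol t) (X.vol s) := by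
  have hE := measurableEmbedding_stretchMap (M := M) h.embedding
  have hw := (measurable_endWeight (M := M) h.measurable).ennreal_ofReal
  refine ⟨hE, measurable_endWeight h.measurable, ?_, ?_⟩
  · rintro (p | q)
    exacts [one_pos, h.pos _]
  · rw [vol_eq, vol_eq, withDensity_add_measure, Measure.map_add _ _ hE.measurable,
      withDensity_map_of_comp measurableEmbedding_inl hE.measurable _ hw,
      withDensity_map_of_comp measurableEmbedding_inr hE.measurable _ hw,
      ← h.withDensity_prod.map_eq, Measure.map_map measurableEmbedding_inr.measurable
        h.withDensity_prod.embedding.measurable]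
    congr 1
    have : ((fun z => ENNReal.ofReal (endWeight M r z)) ∘ Sum.inl : M → ENNReal) = 1 := by
      funext p; simp [endWeight]
    rw [this, withDensity_one]
    rfl

/-- The horizontal sides are stretched by the same factor `r` as the area, and `W` is untouched. A
single weight `r⁻¹` therefore cancels the Jacobian both in the interior and on the boundary, for
every Robin coefficient. -/
lemma isDensityMap_boundary (X : PartiallyRectangularDomain M) {t s : ℝ} {J r : ℝ → ℝ}
    (h : IsDensityMap J r (volume.restrict (xRange t)) (volume.restrict (xRange s))) :
    IsDensityMap (stretchMap M J) (endWeight M r) (X.boundaryMeasure t) (X.boundaryMeasure s) := by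
  have hE := measurableEmbedding_stretchMap (M := M) h.embedding
  have hw := (measurable_endWeight (M := M) h.measurable).ennreal_ofReal
  refine ⟨hE, measurable_endWeight h.measurable, ?_, ?_⟩
  · rintro (p | q)
    exacts [one_pos, h.pos _]
  · have hside : ∀ y : ℝ, Measure.map (stretchMap M J) ((Measure.map
        (fun x : ℝ => (Sum.inr (x, y) : M ⊕ ℝ × ℝ)) (volume.restrict (xRange t))).withDensity
          fun z => ENNReal.ofReal (endWeight M r z)) =
        Measure.map (fun x : ℝ => (Sum.inr (x, y) : M ⊕ ℝ × ℝ)) (volume.restrict (xRange s)) := by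
      intro y
      rw [withDensity_map_of_comp (measurableEmbedding_inr_left y) hE.measurable _ hw,
        ← h.map_eq, Measure.map_map (measurableEmbedding_inr_left y).measurable
          h.embedding.measurable]
      rfl
    have h1 : ((fun z => ENNReal.ofReal (endWeight M r z)) ∘ Sum.inl : M → ENNReal) = 1 := by
      funext p; simp [endWeight]
    rw [boundaryMeasure_eq, boundaryMeasure_eq, withDensity_add_measure,
      Measure.map_add _ _ hE.measurable,
      withDensity_map_of_comp measurableEmbedding_inl hE.measurable _ hw, h1, withDensity_one]
    congr 1
    unfold sideMeasure
    split_ifs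
    · simp
    · rw [withDensity_add_measure, Measure.map_add _ _ hE.measurable, hside, hside]

end PartiallyRectangularDomain

/-! ### Convergence in `L²` -/

section LTwo

variable {α : Type*} [MeasurableSpace α] {μ : Measure α}

lemma eLpNorm_two_eq {F : α → ℝ} (hF : MemLp F 2 μ) :
    eLpNorm F 2 μ = ENNReal.ofReal (Real.sqrt (∫ z, F z ^ 2 ∂μ)) := by
  rw [IsDensityMap.eLpNorm_sq_eq, Real.sqrt_eq_rpow,
    ← ENNReal.ofReal_rpow_of_nonneg (integral_nonneg fun z => sq_nonneg _) (by norm_num),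
    ofReal_integral_eq_lintegral_ofReal hF.integrable_sq (ae_of_all _ fun z => sq_nonneg _)]

lemma integral_sq_eq {F : α → ℝ} (hF : MemLp F 2 μ) :
    ∫ z, F z ^ 2 ∂μ = (eLpNorm F 2 μ).toReal ^ 2 := by
  rw [eLpNorm_two_eq hF, ENNReal.toReal_ofReal (Real.sqrt_nonneg _),
    Real.sq_sqrt (integral_nonneg fun z => sq_nonneg _)]

lemma tendsto_eLpNorm_two_iff {ι : Type*} {l : Filter ι} {F : ι → α → ℝ}
    (hF : ∀ n, MemLp (F n) 2 μ) :
    Tendsto (fun n => eLpNorm (F n) 2 μ) l (𝓝 0) ↔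
      Tendsto (fun n => ∫ z, F n z ^ 2 ∂μ) l (𝓝 0) := by
  constructor
  · intro h
    have h1 := (ENNReal.tendsto_toReal ENNReal.zero_ne_top).comp h
    have h2 := h1.pow 2
    rw [ENNReal.toReal_zero, zero_pow two_ne_zero] at h2
    exact h2.congr fun n => (integral_sq_eq (hF n)).symm
  · intro h
    have h1 := ENNReal.tendsto_ofReal ((Real.continuous_sqrt.tendsto 0).comp h)
    rw [Real.sqrt_zero, ENNReal.ofReal_zero] at h1
    exact h1.congr fun n => (eLpNorm_two_eq (hF n)).symm

lemma tendsto_integral_mul {ι : Type*} {l : Filter ι} {F G : ι → α → ℝ} {F₀ G₀ : α → ℝ}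
    (hF : ∀ n, MemLp (F n) 2 μ) (hG : ∀ n, MemLp (G n) 2 μ) (hF₀ : MemLp F₀ 2 μ)
    (hG₀ : MemLp G₀ 2 μ) (h1 : Tendsto (fun n => eLpNorm (F n - F₀) 2 μ) l (𝓝 0))
    (h2 : Tendsto (fun n => eLpNorm (G n - G₀) 2 μ) l (𝓝 0)) :
    Tendsto (fun n => ∫ z, F n z * G n z ∂μ) l (𝓝 (∫ z, F₀ z * G₀ z ∂μ)) := by
  have key : ∀ {f g : α → ℝ} (hf : MemLp f 2 μ) (hg : MemLp g 2 μ),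
      inner ℝ (hf.toLp f) (hg.toLp g) = ∫ z, f z * g z ∂μ := fun {f g} hf hg => by
    rw [L2.inner_def]
    refine integral_congr_ae ?_
    filter_upwards [hf.coeFn_toLp, hg.coeFn_toLp] with z h1 h2
    rw [h1, h2]
    simp [mul_comm]
  have e1 := (Lp.tendsto_Lp_iff_tendsto_eLpNorm'' F hF F₀ hF₀).2 h1
  have e2 := (Lp.tendsto_Lp_iff_tendsto_eLpNorm'' G hG G₀ hG₀).2 h2
  have e3 := e1.inner (𝕜 := ℝ) e2
  rw [key hF₀ hG₀] at e3
  exact e3.congr fun n => key (hF n) (hG n)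

lemma exists_tendsto_eLpNorm {F : ℕ → α → ℝ} (hF : ∀ n, MemLp (F n) 2 μ)
    (h : Tendsto (fun k : ℕ × ℕ => ∫ z, (F k.1 - F k.2) z ^ 2 ∂μ) atTop (𝓝 0)) :
    ∃ G, MemLp G 2 μ ∧ Tendsto (fun n => eLpNorm (F n - G) 2 μ) atTop (𝓝 0) := by
  have h1 := (tendsto_eLpNorm_two_iff fun k : ℕ × ℕ => (hF k.1).sub (hF k.2)).2 h
  have h2 : CauchySeq fun n => (hF n).toLp (F n) := by
    rw [cauchySeq_iff_tendsto_dist_atTop_0]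
    have h3 := (ENNReal.tendsto_toReal ENNReal.zero_ne_top).comp h1
    refine h3.congr fun k => ?_
    rw [dist_edist, Lp.edist_toLp_toLp]
    rfl
  obtain ⟨G, hG⟩ := cauchySeq_tendsto_of_complete h2
  refine ⟨G, Lp.memLp G, ?_⟩
  rw [Lp.tendsto_Lp_iff_tendsto_eLpNorm'] at hG
  refine hG.congr fun n => eLpNorm_congr_ae ?_
  filter_upwards [(hF n).coeFn_toLp] with z hz
  simp [hz]

lemma tendsto_eLpNorm_linear {ι : Type*} {l : Filter ι} {F G : ι → α → ℝ} {F₀ G₀ : α → ℝ}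
    (hF : ∀ n, MemLp (F n) 2 μ) (hG : ∀ n, MemLp (G n) 2 μ) (hF₀ : MemLp F₀ 2 μ)
    (hG₀ : MemLp G₀ 2 μ) (h1 : Tendsto (fun n => eLpNorm (F n - F₀) 2 μ) l (𝓝 0))
    (h2 : Tendsto (fun n => eLpNorm (G n - G₀) 2 μ) l (𝓝 0)) (a b : ℝ) :
    Tendsto (fun n => eLpNorm (a • F n + b • G n - (a • F₀ + b • G₀)) 2 μ) l (𝓝 0) := by
  have h : Tendsto (fun n => ‖a‖ₑ * eLpNorm (F n - F₀) 2 μ + ‖b‖ₑ * eLpNorm (G n - G₀) 2 μ) l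
      (𝓝 0) := by
    have := (ENNReal.Tendsto.const_mul h1 (Or.inr (enorm_ne_top (x := a)))).add
      (ENNReal.Tendsto.const_mul h2 (Or.inr (enorm_ne_top (x := b))))
    simpa using this
  refine tendsto_of_tendsto_of_tendsto_of_le_of_le tendsto_const_nhds h (fun _ => zero_le)
    fun n => ?_
  have e : a • F n + b • G n - (a • F₀ + b • G₀) = a • (F n - F₀) + b • (G n - G₀) := by
    rw [smul_sub, smul_sub]; abel
  rw [e, ← eLpNorm_const_smul, ← eLpNorm_const_smul]
  exact eLpNorm_add_le (((hF n).sub hF₀).1.const_smul a) (((hG n).sub hG₀).1.const_smul b)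
    (by norm_num)

end LTwo

/-! ### Transport of the quadratic form -/

lemma gradInner_congr {M : Type*} [TopologicalSpace M]
    [ChartedSpace (EuclideanSpace ℝ (Fin 2)) M] [IsManifold (𝓡 2) ∞ M] (g : SurfaceMetric M)
    {f f' h h' : M → ℝ} {p : M} (hf : f =ᶠ[𝓝 p] f') (hh : h =ᶠ[𝓝 p] h') :
    gradInner g f h p = gradInner g f' h' p := by
  have key : ∀ {f f' : M → ℝ}, f =ᶠ[𝓝 p] f' → partialDeriv f p = partialDeriv f' p :=
    fun {f f'} hf => by
      have h1 : (mfderiv (𝓡 2) 𝓘(ℝ, ℝ) f p : EuclideanSpace ℝ (Fin 2) →L[ℝ] ℝ) =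
        mfderiv (𝓡 2) 𝓘(ℝ, ℝ) f' p := hf.mfderiv_eq
      funext i
      exact congrArg (fun L : EuclideanSpace ℝ (Fin 2) →L[ℝ] ℝ => L (tangentBasis p i)) h1
  simp only [gradInner, key hf, key hh]

namespace PartiallyRectangularDomain

variable {M : Type*} [TopologicalSpace M] [T2Space M] [SecondCountableTopology M]
  [ChartedSpace (EuclideanSpace ℝ (Fin 2)) M]
  [IsManifold (𝓡 2) ∞ M] [MeasurableSpace M] [BorelSpace M]
variable {X : PartiallyRectangularDomain M} {t s : ℝ} {f h k : M ⊕ ℝ × ℝ → ℝ}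
  {J r K m : ℝ → ℝ} {bc : BoundaryCondition}

variable (X) in
lemma transport_seam_eventuallyEq (hJ : IsStretch t s J r) (hm : IsEndWeight t m)
    (f : M ⊕ ℝ × ℝ → ℝ) {p : M} (hp : p ∈ X.rest ∩ interior X.carrier) :
    (fun p => transport m J f (X.seamMap t p)) =ᶠ[𝓝 p] fun p => f (X.seamMap s p) := by
  obtain ⟨η, h0, h0', hη⟩ := X.exists_transport_seamMap hJ hm
  have hd : p ∉ X.deepRect η := fun hd => (X.disjoint_rest_deepRect h0).le_bot ⟨hp.1, hd⟩
  filter_upwards [mem_interior_iff_mem_nhds.1 hp.2,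
    (X.isCompact_deepRect h0.le).isClosed.isOpen_compl.mem_nhds hd] with p' h1 h2
  exact hη p' h1 h2 f

lemma restForm_congr {f' h' : M ⊕ ℝ × ℝ → ℝ}
    (hf : ∀ p ∈ X.rest ∩ interior X.carrier,
      (fun p => f (X.seamMap t p)) =ᶠ[𝓝 p] fun p => f' (X.seamMap s p))
    (hh : ∀ p ∈ X.rest ∩ interior X.carrier,
      (fun p => h (X.seamMap t p)) =ᶠ[𝓝 p] fun p => h' (X.seamMap s p)) :
    restForm X t f h = restForm X s f' h' :=
  setIntegral_congr_fun (X.measurableSet_rest.inter isOpen_interior.measurableSet)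
    fun p hp => gradInner_congr X.metric (hf p hp) (hh p hp)

lemma rectDirDeriv_transport (hm : ContDiff ℝ ∞ m) {q : ℝ × ℝ} (hJ : HasDerivAt J (r q.1) q.1)
    (hf : DifferentiableAt ℝ (fun q => f (Sum.inr q)) (J q.1, q.2)) :
    rectDirDeriv (1, 0) (transport m J f) q = deriv m q.1 * f (Sum.inr (J q.1, q.2)) +
        m q.1 * (r q.1 * rectDirDeriv (1, 0) f (J q.1, q.2)) ∧
      rectDirDeriv (0, 1) (transport m J f) q =
        m q.1 * rectDirDeriv (0, 1) f (J q.1, q.2) := by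
  have h1 : HasFDerivAt (fun q : ℝ × ℝ => m q.1)
      ((ContinuousLinearMap.toSpanSingleton ℝ (deriv m q.1)).comp
        (ContinuousLinearMap.fst ℝ ℝ ℝ)) q :=
    ((hm.differentiable (by simp)) q.1).hasDerivAt.hasFDerivAt.comp q hasFDerivAt_fst
  have h2 : HasFDerivAt (fun q : ℝ × ℝ => (J q.1, q.2))
      (((ContinuousLinearMap.toSpanSingleton ℝ (r q.1)).comp
        (ContinuousLinearMap.fst ℝ ℝ ℝ)).prod (ContinuousLinearMap.snd ℝ ℝ ℝ)) q :=
    (hJ.hasFDerivAt.comp q hasFDerivAt_fst).prodMk hasFDerivAt_snd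
  have h3 := HasFDerivAt.comp (g := fun q : ℝ × ℝ => f (Sum.inr q)) q hf.hasFDerivAt h2
  have h4 := (h1.mul h3).fderiv
  constructor
  · refine (congrArg (fun L : ℝ × ℝ →L[ℝ] ℝ => L (1, 0)) h4).trans ?_
    have e : ((r q.1, 0) : ℝ × ℝ) = r q.1 • (1, 0) := by simp
    simp only [rectDirDeriv, Function.comp_apply, add_apply, smul_apply,
      ContinuousLinearMap.comp_apply, ContinuousLinearMap.prod_apply,
      ContinuousLinearMap.coe_fst', ContinuousLinearMap.coe_snd',
      ContinuousLinearMap.toSpanSingleton_apply, smul_eq_mul, one_mul]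
    rw [e, map_smul, smul_eq_mul]
    ring
  · refine (congrArg (fun L : ℝ × ℝ →L[ℝ] ℝ => L (0, 1)) h4).trans ?_
    simp [rectDirDeriv]

end PartiallyRectangularDomain

lemma memLp_bdd_mul {α : Type*} [MeasurableSpace α] {μ : Measure α} {w F : α → ℝ} {p : ENNReal}
    {C : ℝ} (hF : MemLp F p μ) (hw : AEStronglyMeasurable w μ) (hC : ∀ z, |w z| ≤ C) :
    MemLp (fun z => w z * F z) p μ :=
  hF.of_le_mul (hw.mul hF.1) (c := C) (ae_of_all _ fun z => by
    rw [Real.norm_eq_abs, Real.norm_eq_abs, abs_mul]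
    exact mul_le_mul_of_nonneg_right (hC z) (abs_nonneg _))

lemma IsDensityMap.integral_le {α β : Type*} [MeasurableSpace α] [MeasurableSpace β] {S : α → β}
    {ρ : α → ℝ} {μ : Measure α} {ν : Measure β} (h : IsDensityMap S ρ μ ν) {F : β → ℝ} {G : α → ℝ}
    {C : ℝ} (hF : Integrable F ν) (hG : ∀ z, 0 ≤ G z)
    (hGF : ∀ᵐ z ∂μ, G z ≤ C * (ρ z * F (S z))) : ∫ z, G z ∂μ ≤ C * ∫ z, F z ∂ν := by
  rw [h.integral_eq, ← integral_const_mul]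
  exact integral_mono_of_nonneg (ae_of_all _ hG) (((h.integrable_iff F).1 hF).const_mul C) hGF

/-- The vector field `(r⁻¹ ∂ (r⁻¹ f) - ∂ f)` by which the stretching changes the derivative. -/
def stretchFlux {M : Type*} (r : ℝ → ℝ) (f : M ⊕ ℝ × ℝ → ℝ) (q : ℝ × ℝ) : ℝ :=
  ((r q.1)⁻¹ ^ 2 - 1) * PartiallyRectangularDomain.rectDirDeriv (1, 0) f q -
    deriv r q.1 * (r q.1)⁻¹ ^ 3 * f (Sum.inr q)

namespace PartiallyRectangularDomain

variable {M : Type*} [TopologicalSpace M] [T2Space M] [SecondCountableTopology M]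
  [ChartedSpace (EuclideanSpace ℝ (Fin 2)) M]
  [IsManifold (𝓡 2) ∞ M] [MeasurableSpace M] [BorelSpace M]
variable {X : PartiallyRectangularDomain M} {t s : ℝ} {f h k : M ⊕ ℝ × ℝ → ℝ}
  {J r K m : ℝ → ℝ} {bc : BoundaryCondition}

lemma memLp_inr {f : M ⊕ ℝ × ℝ → ℝ} {p : ENNReal} (hf : MemLp f p (X.vol t)) :
    MemLp (fun q => f (Sum.inr q)) p (rectMeasure t) := by
  rw [vol_eq] at hf
  have := hf.mono_measure (Measure.le_add_left le_rfl)
  exact (measurableEmbedding_inr.memLp_map_measure_iff).1 this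

lemma eLpNorm_inr_le (X : PartiallyRectangularDomain M) (t : ℝ) (f : M ⊕ ℝ × ℝ → ℝ)
    (p : ENNReal) : eLpNorm (fun q => f (Sum.inr q)) p (rectMeasure t) ≤ eLpNorm f p (X.vol t) := by
  rw [vol_eq]
  refine le_trans (le_of_eq ?_) (eLpNorm_mono_measure f (Measure.le_add_left le_rfl))
  rw [measurableEmbedding_inr.eLpNorm_map_measure]
  rfl

lemma integral_inr_sq_le (hf : MemLp f 2 (X.vol t)) :
    ∫ q, f (Sum.inr q) ^ 2 ∂(rectMeasure t) ≤ ∫ z, f z ^ 2 ∂(X.vol t) := by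
  have h1 := hf.integrable_sq
  rw [vol_eq] at h1 ⊢
  rw [integral_add_measure h1.left_of_add_measure h1.right_of_add_measure,
    measurableEmbedding_inr.integral_map]
  exact le_add_of_nonneg_left (integral_nonneg fun z => sq_nonneg _)

lemma IsSmooth.memLp_stretchFlux (ht : 1 ≤ t) (hJ : IsStretch t s J r) (hf : X.IsSmooth t f) :
    MemLp (stretchFlux r f) 2 (rectMeasure t) := by
  obtain ⟨C, hC0, hC⟩ := hJ.isEndWeight_deriv.exists_bound
  obtain ⟨D, hD0, hD⟩ := hJ.isEndWeight_inv_deriv.exists_bound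
  have hc : Continuous (deriv r) := (contDiff_infty_iff_deriv.1 hJ.smooth_deriv).2.continuous
  have hi : Continuous fun x => (r x)⁻¹ := hJ.isEndWeight_inv_deriv.smooth.continuous
  refine MemLp.sub ?_ ?_
  · refine memLp_bdd_mul (C := D ^ 2 + 1) (hf.memLp_rectDirDeriv ht _ 2) ?_ fun q => ?_
    · exact (((hi.comp continuous_fst).pow 2).sub continuous_const).aestronglyMeasurable
    · refine (abs_sub _ _).trans ?_
      rw [abs_pow, abs_one]
      gcongr
      exact (hD _).1
  · refine memLp_bdd_mul (C := C * D ^ 3) (memLp_inr (hf.memLp_vol ht 2)) ?_ fun q => ?_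
    · exact ((hc.comp continuous_fst).mul ((hi.comp continuous_fst).pow 3)).aestronglyMeasurable
    · rw [abs_mul, abs_pow]
      gcongr
      · exact (hC _).2
      · exact (hD _).1

/-- The change of the quadratic form under stretching. -/
lemma laplaceForm_transport (ht : 1 ≤ t) (hs : 1 ≤ s) (hJ : IsStretch t s J r)
    (hK : IsStretch s t K fun x => (r (K x))⁻¹) (hKJ : ∀ x, K (J x) = x)
    (hf : X.IsSmooth t f) (hk : X.IsSmooth s k) :
    X.laplaceForm s bc k (transport (fun x => (r (K x))⁻¹) K f) =
      X.laplaceForm t bc (transport (fun _ => 1) J k) f +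
        ∫ q, rectDirDeriv (1, 0) (transport (fun _ => 1) J k) q * stretchFlux r f q
          ∂(rectMeasure t) := by
  set F := transport (fun x => (r (K x))⁻¹) K f with hF
  set k' := transport (fun _ => 1) J k with hk'
  have hFs : X.IsSmooth s F := hf.transport hK hK.isEndWeight_deriv
  have hks : X.IsSmooth t k' := hk.transport hJ (isEndWeight_one t)
  -- In a neighbourhood of each interior point of `X` that lies in `W`, both transports are the
  -- identity in seam coordinates, so this part of the form does not see the stretching.
  have hrest : restForm X s k F = restForm X t k' f :=
    restForm_congr (fun p hp => (X.transport_seam_eventuallyEq hJ (isEndWeight_one t) k hp).symm)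
      fun p hp => X.transport_seam_eventuallyEq hK hK.isEndWeight_deriv f hp
  have hbd : ∫ z, k z * F z ∂(X.boundaryMeasure s) = ∫ z, k' z * f z ∂(X.boundaryMeasure t) := by
    rw [(X.isDensityMap_boundary hJ.isDensityMap).integral_eq]
    refine integral_congr_ae (ae_of_all _ fun z => ?_)
    rcases z with p | q
    · simp [hF, hk', transport, endWeight, stretchMap]
    · have := (hJ.pos q.1).ne'
      simp only [hF, hk', transport, endWeight, stretchMap, Sum.elim_inr, Sum.map_inr, hKJ]
      field_simp
  have hder : ∀ q ∈ xRange t ×ˢ Ioo (-(Real.pi / 2)) (Real.pi / 2),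
      (r q.1 * rectDirDeriv (1, 0) k (J q.1, q.2) = rectDirDeriv (1, 0) k' q ∧
        rectDirDeriv (0, 1) k (J q.1, q.2) = rectDirDeriv (0, 1) k' q) ∧
      rectDirDeriv (1, 0) F (J q.1, q.2) = (r q.1)⁻¹ ^ 2 * rectDirDeriv (1, 0) f q -
        deriv r q.1 * (r q.1)⁻¹ ^ 3 * f (Sum.inr q) ∧
      rectDirDeriv (0, 1) F (J q.1, q.2) = (r q.1)⁻¹ * rectDirDeriv (0, 1) f q := by
    intro q hq
    have h1 := rectDirDeriv_transport (f := k) (J := J) (r := r) (m := fun _ => 1) (q := q)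
      contDiff_const (hJ.hasDerivAt q.1) (hk.differentiableAt_rect ⟨hJ.mem_xRange.2 hq.1, hq.2⟩)
    have h2 := rectDirDeriv_transport (f := f) (J := K) (r := fun x => (r (K x))⁻¹)
      (q := (J q.1, q.2)) hK.smooth_deriv (hK.hasDerivAt _)
      (by simp only [hKJ]; exact hf.differentiableAt_rect hq)
    have h3 : HasDerivAt (fun x => (r (K x))⁻¹)
        (-(deriv r q.1 * (r q.1)⁻¹) / r q.1 ^ 2) (J q.1) := by
      have e1 := hK.hasDerivAt (J q.1)
      have e2 : HasDerivAt r (deriv r q.1) (K (J q.1)) := by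
        rw [hKJ]
        exact ((hJ.smooth_deriv.differentiable (by simp)) q.1).hasDerivAt
      have e3 := (e2.comp (J q.1) e1).inv (by simpa [hKJ] using (hJ.pos q.1).ne')
      simp only [hKJ, Function.comp_def] at e3
      exact e3
    simp only [hKJ, h3.deriv, deriv_const, zero_mul, zero_add, one_mul] at h1 h2
    refine ⟨⟨h1.1.symm, h1.2.symm⟩, h2.1.trans ?_, h2.2⟩
    have := (hJ.pos q.1).ne'
    field_simp
    ring
  -- The Jacobian `r` is used up by `∂ₓk' = r · (∂ₓk) ∘ J`. What remains is `(∂ₓF) ∘ J = r⁻¹ ∂ₓ(r⁻¹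
  -- f)`, and the flux is its excess over `∂ₓf`.
  have hx : ∫ q, rectDirDeriv (1, 0) k q * rectDirDeriv (1, 0) F q ∂(rectMeasure s) =
      (∫ q, rectDirDeriv (1, 0) k' q * rectDirDeriv (1, 0) f q ∂(rectMeasure t)) +
      ∫ q, rectDirDeriv (1, 0) k' q * stretchFlux r f q ∂(rectMeasure t) := by
    have hint : Integrable (fun q => rectDirDeriv (1, 0) k' q * stretchFlux r f q)
        (rectMeasure t) :=
      (hks.memLp_rectDirDeriv ht _ 2).integrable_mul (hf.memLp_stretchFlux ht hJ)
    rw [hJ.isDensityMap_rect.integral_eq, ← integral_add (hks.integrable_deriv_mul ht hf _ _) hint]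
    refine setIntegral_congr_fun (measurableSet_rect t) fun q hq => ?_
    obtain ⟨⟨h1, -⟩, h2, -⟩ := hder q hq
    simp only [h2, ← h1, stretchFlux]
    ring
  -- Here the Jacobian `r` meets exactly the weight `r⁻¹`, and no error remains.
  have hy : ∫ q, rectDirDeriv (0, 1) k q * rectDirDeriv (0, 1) F q ∂(rectMeasure s) =
      ∫ q, rectDirDeriv (0, 1) k' q * rectDirDeriv (0, 1) f q ∂(rectMeasure t) := by
    rw [hJ.isDensityMap_rect.integral_eq]
    refine setIntegral_congr_fun (measurableSet_rect t) fun q hq => ?_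
    obtain ⟨⟨-, h1⟩, -, h2⟩ := hder q hq
    have := (hJ.pos q.1).ne'
    simp only [h2, h1]
    field_simp
  rw [laplaceForm, laplaceForm, dirichletForm_eq' hs hk hFs, dirichletForm_eq' ht hks hf, hrest,
    hbd, hx, hy]
  ring

lemma integral_mul_transport (hJ : IsStretch t s J r) (hKJ : ∀ x, K (J x) = x)
    (k f : M ⊕ ℝ × ℝ → ℝ) :
    ∫ z, k z * transport (fun x => (r (K x))⁻¹) K f z ∂(X.vol s) =
      ∫ z, transport (fun _ => 1) J k z * f z ∂(X.vol t) := by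
  rw [(X.isDensityMap_vol hJ.isDensityMap).integral_eq]
  refine integral_congr_ae (ae_of_all _ fun z => ?_)
  rcases z with p | q
  · simp [transport, endWeight, stretchMap]
  · have := (hJ.pos q.1).ne'
    simp only [transport, endWeight, stretchMap, Sum.elim_inr, Sum.map_inr, hKJ]
    field_simp

/-! ### Bounds for transported functions -/

lemma exists_sq_le_endWeight (hJ : IsStretch t s J r) (hm : IsEndWeight t m) :
    ∃ C, 0 ≤ C ∧ ∀ z, endWeight M m z ^ 2 ≤ C * endWeight M r z := by
  obtain ⟨A, hA0, hA⟩ := hm.exists_bound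
  obtain ⟨D, hD0, hD⟩ := hJ.isEndWeight_inv_deriv.exists_bound
  refine ⟨A ^ 2 * D + 1, by positivity, fun z => ?_⟩
  rcases z with p | q
  · simp [endWeight]; positivity
  · have h1 := (hA q.1).1
    have h2 := (hD q.1).1
    have h3 := hJ.pos q.1
    have h4 : 1 ≤ D * r q.1 := by
      rw [abs_of_pos (inv_pos.2 h3)] at h2
      calc 1 = (r q.1)⁻¹ * r q.1 := by field_simp
        _ ≤ D * r q.1 := by gcongr
    have h5 : m q.1 ^ 2 ≤ A ^ 2 := sq_le_sq.2 (by rwa [abs_of_nonneg hA0])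
    simp only [endWeight, Sum.elim_inr]
    nlinarith [mul_le_mul_of_nonneg_left h4 (sq_nonneg A)]

lemma memLp_transport (hJ : IsStretch t s J r) (hm : IsEndWeight t m)
    (hf : MemLp f 2 (X.vol s)) : MemLp (transport m J f) 2 (X.vol t) := by
  obtain ⟨C, hC0, hC⟩ := exists_sq_le_endWeight (M := M) hJ hm
  rw [transport_eq]
  exact (X.isDensityMap_vol hJ.isDensityMap).memLp hC0
    (measurable_endWeight hm.smooth.continuous.measurable) hC hf

variable (X) in
lemma exists_eLpNorm_transport_le (hJ : IsStretch t s J r) (hm : IsEndWeight t m) :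
    ∃ C : ℝ, ∀ f, eLpNorm (transport m J f) 2 (X.vol t) ≤
      ENNReal.ofReal C * eLpNorm f 2 (X.vol s) := by
  obtain ⟨C, hC0, hC⟩ := exists_sq_le_endWeight (M := M) hJ hm
  refine ⟨Real.sqrt C, fun f => ?_⟩
  rw [transport_eq]
  exact (X.isDensityMap_vol hJ.isDensityMap).eLpNorm_le hC0 hC f

variable (X) in
-- Ensures that transport maps energy-Cauchy sequences that also converge in `L²` to energy-Cauchy
-- sequences. The `L²` norm must appear on the right because the derivative of the weight `m` falls
-- on `f` itself.
lemma exists_energy_transport_le (ht : 1 ≤ t) (hs : 1 ≤ s) (bc : BoundaryCondition)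
    (hJ : IsStretch t s J r) (hm : IsEndWeight t m) :
    ∃ C, 0 ≤ C ∧ ∀ f, X.IsSmooth s f → X.energy t bc (transport m J f) ≤
      C * (X.energy s bc f + ∫ z, f z ^ 2 ∂(X.vol s)) := by
  obtain ⟨A, hA0, hA⟩ := hm.exists_bound
  obtain ⟨B, hB0, hB⟩ := hJ.isEndWeight_deriv.exists_bound
  obtain ⟨D, hD0, hD⟩ := hJ.isEndWeight_inv_deriv.exists_bound
  obtain ⟨C₁, h10, h1⟩ := exists_sq_le_endWeight (M := M) hJ hm
  -- The factor `2 A² (1 + B²)` comes from squaring `m' f + m r ∂ₓf`, and `D` from inserting the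
  -- Jacobian through `1 ≤ D r`.
  set C₂ := 2 * A ^ 2 * D * (1 + B ^ 2) with hC₂
  set C₃ := A ^ 2 * D with hC₃
  have h20 : 0 ≤ C₂ := by positivity
  have h30 : 0 ≤ C₃ := by positivity
  have hr1 : ∀ x, 1 ≤ D * r x := fun x => by
    have h2 := (hD x).1
    rw [abs_of_pos (inv_pos.2 (hJ.pos x))] at h2
    calc 1 = (r x)⁻¹ * r x := by field_simp [(hJ.pos x).ne']
      _ ≤ D * r x := mul_le_mul_of_nonneg_right h2 (hJ.pos x).le
  refine ⟨1 + C₁ + C₂ + C₃, by positivity, fun f hf => ?_⟩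
  have hT : X.IsSmooth t (transport m J f) := hf.transport hJ hm
  have hrest : restForm X t (transport m J f) (transport m J f) = restForm X s f f :=
    restForm_congr (fun p hp => X.transport_seam_eventuallyEq hJ hm f hp)
      fun p hp => X.transport_seam_eventuallyEq hJ hm f hp
  have hbd : ∫ z, transport m J f z ^ 2 ∂(X.boundaryMeasure t) ≤
      C₁ * ∫ z, f z ^ 2 ∂(X.boundaryMeasure s) := by
    refine (X.isDensityMap_boundary hJ.isDensityMap).integral_le
      (hf.memLp_boundary hs 2).integrable_sq (fun z => sq_nonneg _) (ae_of_all _ fun z => ?_)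
    rw [transport_eq, mul_pow, ← mul_assoc]
    exact mul_le_mul_of_nonneg_right (h1 z) (sq_nonneg _)
  have hder : ∀ q ∈ xRange t ×ˢ Ioo (-(Real.pi / 2)) (Real.pi / 2), _ := fun q hq =>
    rectDirDeriv_transport (f := f) (J := J) (r := r) (q := q)
      hm.smooth (hJ.hasDerivAt q.1) (hf.differentiableAt_rect ⟨hJ.mem_xRange.2 hq.1, hq.2⟩)
  have hfsq : Integrable (fun q => f (Sum.inr q) ^ 2) (rectMeasure s) :=
    (memLp_inr (hf.memLp_vol hs 2)).integrable_sq
  have hx : ∫ q, rectDirDeriv (1, 0) (transport m J f) q * rectDirDeriv (1, 0) (transport m J f) q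
      ∂(rectMeasure t) ≤ C₂ * ∫ q, (f (Sum.inr q) ^ 2 +
        rectDirDeriv (1, 0) f q * rectDirDeriv (1, 0) f q) ∂(rectMeasure s) := by
    refine hJ.isDensityMap_rect.integral_le (hfsq.add (hf.integrable_deriv_mul hs hf _ _))
      (fun z => mul_self_nonneg _) ((ae_restrict_iff' (measurableSet_rect t)).2
        (ae_of_all _ fun q hq => ?_))
    rw [(hder q hq).1]
    set a := f (Sum.inr (J q.1, q.2))
    set b := rectDirDeriv (1, 0) f (J q.1, q.2)
    have e1 : deriv m q.1 ^ 2 ≤ A ^ 2 := sq_le_sq.2 (by rw [abs_of_nonneg hA0]; exact (hA _).2)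
    have e2 : m q.1 ^ 2 ≤ A ^ 2 := sq_le_sq.2 (by rw [abs_of_nonneg hA0]; exact (hA _).1)
    have e3 : r q.1 ^ 2 ≤ B ^ 2 := sq_le_sq.2 (by rw [abs_of_nonneg hB0]; exact (hB _).1)
    calc _ ≤ 2 * (deriv m q.1 ^ 2 * a ^ 2 + m q.1 ^ 2 * r q.1 ^ 2 * b ^ 2) := by
          nlinarith [sq_nonneg (deriv m q.1 * a - m q.1 * (r q.1 * b))]
      _ ≤ 2 * (A ^ 2 * a ^ 2 + A ^ 2 * B ^ 2 * b ^ 2) := by gcongr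
      _ ≤ 2 * A ^ 2 * (1 + B ^ 2) * (a ^ 2 + b * b) * 1 := by
          nlinarith [mul_nonneg (sq_nonneg A) (sq_nonneg b),
            mul_nonneg (mul_nonneg (sq_nonneg A) (sq_nonneg B)) (sq_nonneg a)]
      _ ≤ 2 * A ^ 2 * (1 + B ^ 2) * (a ^ 2 + b * b) * (D * r q.1) :=
          mul_le_mul_of_nonneg_left (hr1 _) (by nlinarith [mul_nonneg (mul_nonneg (sq_nonneg A) (by positivity : 0 ≤ 1 + B ^ 2)) (add_nonneg (sq_nonneg a) (mul_self_nonneg b))])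
      _ = _ := by ring
  have hy : ∫ q, rectDirDeriv (0, 1) (transport m J f) q * rectDirDeriv (0, 1) (transport m J f) q
      ∂(rectMeasure t) ≤ C₃ * ∫ q, rectDirDeriv (0, 1) f q * rectDirDeriv (0, 1) f q
        ∂(rectMeasure s) := by
    refine hJ.isDensityMap_rect.integral_le (hf.integrable_deriv_mul hs hf _ _)
      (fun z => mul_self_nonneg _) ((ae_restrict_iff' (measurableSet_rect t)).2
        (ae_of_all _ fun q hq => ?_))
    rw [(hder q hq).2]
    set b := rectDirDeriv (0, 1) f (J q.1, q.2)
    have e2 : m q.1 ^ 2 ≤ A ^ 2 := sq_le_sq.2 (by rw [abs_of_nonneg hA0]; exact (hA _).1)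
    calc _ = m q.1 ^ 2 * b ^ 2 := by ring
      _ ≤ A ^ 2 * b ^ 2 * 1 := by rw [mul_one]; gcongr
      _ ≤ A ^ 2 * b ^ 2 * (D * r q.1) := mul_le_mul_of_nonneg_left (hr1 _) (by positivity)
      _ = _ := by ring
  rw [integral_add hfsq (hf.integrable_deriv_mul hs hf _ _)] at hx
  rw [energy, energy, dirichletForm_eq' ht hT hT, dirichletForm_eq' hs hf hf, hrest]
  have i1 := integral_inr_sq_le (hf.memLp_vol hs 2)
  have i2 := restForm_self_nonneg X s f
  have i3 : 0 ≤ ∫ q, rectDirDeriv (1, 0) f q * rectDirDeriv (1, 0) f q ∂(rectMeasure s) :=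
    integral_nonneg fun q => mul_self_nonneg _
  have i4 : 0 ≤ ∫ q, rectDirDeriv (0, 1) f q * rectDirDeriv (0, 1) f q ∂(rectMeasure s) :=
    integral_nonneg fun q => mul_self_nonneg _
  have i5 := X.integral_boundary_sq_nonneg s f
  have i6 : 0 ≤ ∫ q, f (Sum.inr q) ^ 2 ∂(rectMeasure s) := integral_nonneg fun q => sq_nonneg _
  have i7 := mul_le_mul_of_nonneg_left hbd (abs_nonneg bc.coeff)
  generalize (∫ q, rectDirDeriv (1, 0) f q * rectDirDeriv (1, 0) f q ∂(rectMeasure s)) = x1 at *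
  generalize (∫ q, rectDirDeriv (0, 1) f q * rectDirDeriv (0, 1) f q ∂(rectMeasure s)) = x2 at *
  generalize (∫ z, f z ^ 2 ∂(X.boundaryMeasure s)) = x3 at *
  generalize (∫ z, f z ^ 2 ∂(X.vol s)) = x4 at *
  generalize (∫ q, f (Sum.inr q) ^ 2 ∂(rectMeasure s)) = x5 at *
  generalize restForm X s f f = x6 at *
  have hB : 0 ≤ |bc.coeff| * x3 := mul_nonneg (abs_nonneg _) i5
  generalize |bc.coeff| = β at *
  have j1 : C₂ * (x5 + x1) ≤ C₂ * (x4 + x1) := mul_le_mul_of_nonneg_left (by linarith) h20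
  have j2 : 0 ≤ C₁ * (x6 + x1 + x2 + x4) := mul_nonneg h10 (by linarith)
  have j3 : 0 ≤ C₂ * (x6 + x2 + β * x3) := mul_nonneg h20 (by linarith)
  have j4 : 0 ≤ C₃ * (x6 + x1 + x4 + β * x3) := mul_nonneg h30 (by linarith)
  linarith

end PartiallyRectangularDomain

namespace PartiallyRectangularDomain

variable {M : Type*} [TopologicalSpace M] [T2Space M] [SecondCountableTopology M]
  [ChartedSpace (EuclideanSpace ℝ (Fin 2)) M]
  [IsManifold (𝓡 2) ∞ M] [MeasurableSpace M] [BorelSpace M]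
variable {X : PartiallyRectangularDomain M} {t s : ℝ} {f h : ℕ → M ⊕ ℝ × ℝ → ℝ}
  {u v : M ⊕ ℝ × ℝ → ℝ} {J r K m : ℝ → ℝ} {bc : BoundaryCondition} {E : ℝ}

/-! ### Elements of the form domain -/

/-- The test functions `f n` converge to `u` in the form domain. -/
structure IsApprox (X : PartiallyRectangularDomain M) (t : ℝ) (bc : BoundaryCondition)
    (f : ℕ → M ⊕ ℝ × ℝ → ℝ) (u : M ⊕ ℝ × ℝ → ℝ) : Prop where
  test : ∀ n, X.IsTest t bc (f n)
  memLp : MemLp u 2 (X.vol t)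
  tendsto : Tendsto (fun n => eLpNorm (f n - u) 2 (X.vol t)) atTop (𝓝 0)
  energy : X.IsEnergyCauchy t bc f

lemma laplaceForm_comm (X : PartiallyRectangularDomain M) (t : ℝ) (bc : BoundaryCondition)
    (f h : M ⊕ ℝ × ℝ → ℝ) : X.laplaceForm t bc f h = X.laplaceForm t bc h f := by
  rw [laplaceForm, laplaceForm, dirichletForm_comm]
  simp only [mul_comm (f _)]

/-- Parallelogram law: the right side is the energy of `a f + b h` plus that of `a f - b h`, and the
latter is nonnegative. -/
lemma energy_linear_le (ht : 1 ≤ t) {f h : M ⊕ ℝ × ℝ → ℝ} (hf : X.IsSmooth t f)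
    (hh : X.IsSmooth t h) (a b : ℝ) : X.energy t bc (a • f + b • h) ≤
      2 * a ^ 2 * X.energy t bc f + 2 * b ^ 2 * X.energy t bc h := by
  have hp := hf.linear hh a b
  have hm := hf.linear hh a (-b)
  have e1 := X.dirichletForm_self_nonneg t (a • f + (-b) • h)
  have e2 : 0 ≤ ∫ z, (a • f + (-b) • h) z * (a • f + (-b) • h) z ∂(X.boundaryMeasure t) :=
    integral_nonneg fun z => mul_self_nonneg _
  have e3 := mul_nonneg (abs_nonneg bc.coeff) e2
  rw [integral_boundary_linear ht hf hh hm] at e3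
  simp only [fun z => mul_comm (f z) ((a • f + (-b) • h) z),
    fun z => mul_comm (h z) ((a • f + (-b) • h) z)] at e3
  rw [integral_boundary_linear ht hf hh hf, integral_boundary_linear ht hf hh hh] at e3
  rw [dirichletForm_linear ht hf hh hm, dirichletForm_comm X t f, dirichletForm_comm X t h,
    dirichletForm_linear ht hf hh hf, dirichletForm_linear ht hf hh hh] at e1
  simp only [energy, sq ((_ : M ⊕ ℝ × ℝ → ℝ) _)]
  rw [integral_boundary_linear ht hf hh hp]
  simp only [fun z => mul_comm (f z) ((a • f + b • h) z),
    fun z => mul_comm (h z) ((a • f + b • h) z)]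
  rw [integral_boundary_linear ht hf hh hf, integral_boundary_linear ht hf hh hh,
    dirichletForm_linear ht hf hh hp, dirichletForm_comm X t f, dirichletForm_comm X t h,
    dirichletForm_linear ht hf hh hf, dirichletForm_linear ht hf hh hh]
  simp only [fun z => mul_comm (h z) (f z), dirichletForm_comm X t h f] at e1 e3 ⊢
  linarith

namespace IsApprox

lemma isSmooth (hf : X.IsApprox t bc f u) (n : ℕ) : X.IsSmooth t (f n) := (hf.test n).1

lemma memLp_seq (ht : 1 ≤ t) (hf : X.IsApprox t bc f u) (n : ℕ) : MemLp (f n) 2 (X.vol t) :=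
  (hf.isSmooth n).memLp_vol ht 2

lemma tendsto_integral_sub_sq (ht : 1 ≤ t) (hf : X.IsApprox t bc f u) :
    Tendsto (fun k : ℕ × ℕ => ∫ z, (f k.1 - f k.2) z ^ 2 ∂(X.vol t)) atTop (𝓝 0) := by
  rw [← tendsto_eLpNorm_two_iff fun k : ℕ × ℕ => (hf.memLp_seq ht k.1).sub (hf.memLp_seq ht k.2)]
  have h1 : Tendsto (fun k : ℕ × ℕ => eLpNorm (f k.1 - u) 2 (X.vol t) +
      eLpNorm (f k.2 - u) 2 (X.vol t)) atTop (𝓝 0) := by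
    rw [← prod_atTop_atTop_eq]
    simpa using (hf.tendsto.comp tendsto_fst).add (hf.tendsto.comp tendsto_snd)
  refine tendsto_of_tendsto_of_tendsto_of_le_of_le tendsto_const_nhds h1 (fun _ => zero_le)
    fun k => ?_
  have e : f k.1 - f k.2 = (f k.1 - u) - (f k.2 - u) := by abel
  rw [e]
  exact eLpNorm_sub_le ((hf.memLp_seq ht _).sub hf.memLp).1 ((hf.memLp_seq ht _).sub hf.memLp).1
    (by norm_num)

lemma transport (ht : 1 ≤ t) (hs : 1 ≤ s) (hJ : IsStretch t s J r) (hm : IsEndWeight t m)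
    (hf : X.IsApprox s bc f u) :
    X.IsApprox t bc (fun n => transport m J (f n)) (transport m J u) := by
  refine ⟨fun n => (hf.test n).transport ht hJ hm, memLp_transport hJ hm hf.memLp, ?_, ?_⟩
  · obtain ⟨C, hC⟩ := X.exists_eLpNorm_transport_le hJ hm
    have h1 := ENNReal.Tendsto.const_mul hf.tendsto
      (Or.inr (ENNReal.ofReal_ne_top (r := C)))
    rw [mul_zero] at h1
    refine tendsto_of_tendsto_of_tendsto_of_le_of_le tendsto_const_nhds h1 (fun _ => zero_le)
      fun n => ?_
    simp only [transport_sub]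
    exact hC _
  · obtain ⟨C, hC0, hC⟩ := X.exists_energy_transport_le ht hs bc hJ hm
    have h1 := (hf.energy.add (hf.tendsto_integral_sub_sq hs)).const_mul C
    rw [add_zero, mul_zero] at h1
    refine squeeze_zero (fun k => ?_) (fun k => ?_) h1
    · exact add_nonneg (X.dirichletForm_self_nonneg t _)
        (mul_nonneg (abs_nonneg _) (X.integral_boundary_sq_nonneg t _))
    · simp only [transport_sub]
      exact hC _ (IsTest.sub (hf.test _) (hf.test _)).1

lemma linear (ht : 1 ≤ t) (hf : X.IsApprox t bc f u) (hh : X.IsApprox t bc h v) (a b : ℝ) :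
    X.IsApprox t bc (fun n => a • f n + b • h n) (a • u + b • v) := by
  refine ⟨fun n => (hf.test n).linear (hh.test n) a b,
    (hf.memLp.const_smul a).add (hh.memLp.const_smul b),
    tendsto_eLpNorm_linear (hf.memLp_seq ht) (hh.memLp_seq ht) hf.memLp hh.memLp hf.tendsto
      hh.tendsto a b, ?_⟩
  have h1 := (hf.energy.const_mul (2 * a ^ 2)).add (hh.energy.const_mul (2 * b ^ 2))
  rw [mul_zero, mul_zero, add_zero] at h1
  refine squeeze_zero (fun k => ?_) (fun k => ?_) h1
  · exact add_nonneg (X.dirichletForm_self_nonneg t _)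
      (mul_nonneg (abs_nonneg _) (X.integral_boundary_sq_nonneg t _))
  · have e : a • f k.1 + b • h k.1 - (a • f k.2 + b • h k.2) =
        a • (f k.1 - f k.2) + b • (h k.1 - h k.2) := by
      rw [smul_sub, smul_sub]; abel
    simp only [e]
    exact energy_linear_le ht (IsTest.sub (hf.test _) (hf.test _)).1
      (IsTest.sub (hh.test _) (hh.test _)).1 a b

end IsApprox

/-- Extends the weak equation from a fixed test function to sequences `h n` approximating an
arbitrary element of the form domain, with both arguments of the form varying together. The
approximating sequence of `u` is fixed once and serves for all `h`. -/
lemma IsEigenfunction.exists_isApprox (ht : 1 ≤ t) (hu : X.IsEigenfunction t bc u E) :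
    ∃ f, X.IsApprox t bc f u ∧ ∀ h v, X.IsApprox t bc h v →
      Tendsto (fun n => X.laplaceForm t bc (f n) (h n)) atTop (𝓝 (E * ∫ z, u z * v z ∂(X.vol t))) := by
  obtain ⟨f, h1, h2, h3, h4⟩ := hu.weak
  have h3' : X.IsEnergyCauchy t bc f := h3
  have hf : X.IsApprox t bc f u := ⟨h1, hu.memLp, h2, h3'⟩
  refine ⟨f, hf, fun h v hh => ?_⟩
  obtain ⟨L, hL⟩ := exists_tendsto_laplaceForm ht hf.isSmooth hh.isSmooth hf.energy hh.energy
  have hlim : Tendsto (fun n => E * ∫ z, u z * h n z ∂(X.vol t)) atTop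
      (𝓝 (E * ∫ z, u z * v z ∂(X.vol t))) :=
    (tendsto_integral_mul (F := fun _ => u) (fun _ => hu.memLp) (hh.memLp_seq ht) hu.memLp hh.memLp
      (by simp) hh.tendsto).const_mul E
  -- The joint limit `L` is computed as an iterated limit: for a fixed test function the weak
  -- equation gives the inner limit, and `L²` convergence the outer one. The diagonal then has the
  -- same limit.
  have hL' : Tendsto (fun n => E * ∫ z, u z * h n z ∂(X.vol t)) atTop (𝓝 L) := by
    rw [Metric.tendsto_atTop]
    intro ε hε
    obtain ⟨⟨N₁, N₂⟩, hN⟩ := Metric.tendsto_atTop.1 hL (ε / 2) (by positivity)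
    refine ⟨N₂, fun m hm => lt_of_le_of_lt ?_ (half_lt_self hε)⟩
    refine le_of_tendsto ((h4 (h m) (hh.test m)).dist tendsto_const_nhds) ?_
    filter_upwards [eventually_ge_atTop N₁] with n hn
    exact (hN (n, m) ⟨hn, hm⟩).le
  have hdiag : Tendsto (fun n : ℕ => (n, n)) atTop atTop := tendsto_atTop_diagonal
  have hc := hL.comp hdiag
  rw [← tendsto_nhds_unique hlim hL'] at hc
  exact hc

/-- The eigenvalues on `X_t` and `X_s` differ by the flux term. -/
lemma IsEigenfunction.tendsto_stretchFlux {E' : ℝ} (ht : 1 ≤ t) (hs : 1 ≤ s)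
    (hJ : IsStretch t s J r) (hu : X.IsEigenfunction t bc u E) (hv : X.IsEigenfunction s bc v E') :
    ∃ f h, X.IsApprox t bc f u ∧
      X.IsApprox t bc h (_root_.transport (fun _ => 1) J v) ∧
      Tendsto (fun n => ∫ q, rectDirDeriv (1, 0) (h n) q * stretchFlux r (f n) q ∂(rectMeasure t))
        atTop (𝓝 ((E' - E) * ∫ z, _root_.transport (fun _ => 1) J v z * u z ∂(X.vol t))) := by
  obtain ⟨K, hK, hKJ, hJK⟩ := hJ.exists_inverse
  obtain ⟨f, hf, hf'⟩ := hu.exists_isApprox ht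
  obtain ⟨k, hk, hk'⟩ := hv.exists_isApprox hs
  have hh := hk.transport ht hs hJ (isEndWeight_one t)
  refine ⟨f, _, hf, hh, ?_⟩
  -- The equation of `v` is tested with `u` pushed forward with the weight `r⁻¹`, and that of `u`
  -- with `v` pulled back with the weight `1`. Both give the same `L²` pairing, so subtraction
  -- isolates `E' - E`.
  have h1 := hk' _ _ (hf.transport hs ht hK hK.isEndWeight_deriv)
  have h2 := hf' _ _ hh
  rw [integral_mul_transport hJ hKJ] at h1
  simp only [mul_comm (u _)] at h2
  have h3 := h1.sub h2
  rw [← sub_mul] at h3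
  refine h3.congr fun n => ?_
  rw [laplaceForm_transport ht hs hJ hK hKJ (hf.isSmooth n) (hk.isSmooth n),
    laplaceForm_comm X t bc (f n)]
  ring

end PartiallyRectangularDomain

/-! ### Integration by parts on the rectangle -/

/-- Since `H` vanishes on `U` off a compact subset, its extension by zero is differentiable on the
whole line with compact support. -/
lemma integral_deriv_eq_zero_of_compact {U K : Set ℝ} (hU : IsOpen U) (hK : IsCompact K)
    (hKU : K ⊆ U) {H H' : ℝ → ℝ} (hd : ∀ x ∈ U, HasDerivAt H (H' x) x)
    (h0 : ∀ x ∈ U, x ∉ K → H x = 0) (hi : IntegrableOn H' U) : ∫ x in U, H' x = 0 := by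
  have hg : ∀ x, HasDerivAt (U.indicator H) (U.indicator H' x) x := fun x => by
    by_cases hx : x ∈ U
    · rw [indicator_of_mem hx]
      refine (hd x hx).congr_of_eventuallyEq ?_
      filter_upwards [hU.mem_nhds hx] with z hz using indicator_of_mem hz _
    · rw [indicator_of_notMem hx]
      refine (hasDerivAt_const x (0 : ℝ)).congr_of_eventuallyEq ?_
      filter_upwards [hK.isClosed.isOpen_compl.mem_nhds fun h => hx (hKU h)] with z hz
      by_cases hzU : z ∈ U
      · rw [indicator_of_mem hzU, h0 z hzU hz]
      · exact indicator_of_notMem hzU _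
  have hc : Continuous (U.indicator H) := continuous_iff_continuousAt.2 fun x => (hg x).continuousAt
  have hs : HasCompactSupport (U.indicator H) := HasCompactSupport.intro hK fun x hx => by
    by_cases hzU : x ∈ U
    · rw [indicator_of_mem hzU, h0 x hzU hx]
    · exact indicator_of_notMem hzU _
  rw [← integral_indicator hU.measurableSet]
  exact integral_eq_zero_of_hasDerivAt_of_integrable hg
    ((integrable_indicator_iff hU.measurableSet).2 hi) (hc.integrable_of_hasCompactSupport hs)

/-- Fubini and the one-dimensional case on horizontal lines. Only `x`-derivatives are integrated, so
nothing is required of `H` near `y = ±π/2`. -/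
lemma integral_rect_deriv_eq_zero {t : ℝ} {K : Set ℝ} (hK : IsCompact K) (hKt : K ⊆ xRange t)
    {H H' : ℝ × ℝ → ℝ}
    (hd : ∀ q ∈ xRange t ×ˢ Ioo (-(Real.pi / 2)) (Real.pi / 2),
      HasDerivAt (fun x => H (x, q.2)) (H' q) q.1)
    (h0 : ∀ q ∈ xRange t ×ˢ Ioo (-(Real.pi / 2)) (Real.pi / 2), q.1 ∉ K → H q = 0)
    (hi : Integrable H' (rectMeasure t)) : ∫ q, H' q ∂(rectMeasure t) = 0 := by
  rw [rectMeasure_eq_prod] at hi ⊢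
  rw [integral_prod_symm _ hi]
  refine (setIntegral_congr_fun measurableSet_Ioo fun y hy => ?_).trans (integral_zero _ _)
  -- A line on which `H'` is not integrable needs no separate treatment: its integral is `0` by
  -- convention.
  by_cases hiy : IntegrableOn (fun x => H' (x, y)) (xRange t)
  · exact integral_deriv_eq_zero_of_compact (xRange_isOpen t) hK hKt
      (fun x hx => hd (x, y) ⟨hx, hy⟩) (fun x hx => h0 (x, y) ⟨hx, hy⟩) hiy
  · exact integral_undef hiy

namespace PartiallyRectangularDomain

variable {M : Type*} [TopologicalSpace M] [T2Space M] [SecondCountableTopology M]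
  [ChartedSpace (EuclideanSpace ℝ (Fin 2)) M]
  [IsManifold (𝓡 2) ∞ M] [MeasurableSpace M] [BorelSpace M]
variable {X : PartiallyRectangularDomain M} {t s : ℝ} {f h : ℕ → M ⊕ ℝ × ℝ → ℝ}
  {u v : M ⊕ ℝ × ℝ → ℝ} {J r K m : ℝ → ℝ} {bc : BoundaryCondition} {E : ℝ}

lemma hasDerivAt_rectDirDeriv {u : M ⊕ ℝ × ℝ → ℝ} {q : ℝ × ℝ}
    (hu : DifferentiableAt ℝ (fun q => u (Sum.inr q)) q) :
    HasDerivAt (fun x => u (Sum.inr (x, q.2))) (rectDirDeriv (1, 0) u q) q.1 := by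
  have h1 : HasDerivAt (fun x : ℝ => (x, q.2)) ((1, 0) : ℝ × ℝ) q.1 :=
    (hasDerivAt_id q.1).prodMk (hasDerivAt_const q.1 q.2)
  exact hu.hasFDerivAt.comp_hasDerivAt q.1 h1

lemma integral_rectDirDeriv_mul {u : M ⊕ ℝ × ℝ → ℝ} {C : Set ℝ} (hC : IsCompact C)
    (hCt : C ⊆ xRange t)
    (hu : ContDiffOn ℝ ∞ (fun q => u (Sum.inr q)) (xRange t ×ˢ Ioo (-(Real.pi / 2)) (Real.pi / 2)))
    {G G' : ℝ × ℝ → ℝ}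
    (hd : ∀ q ∈ xRange t ×ˢ Ioo (-(Real.pi / 2)) (Real.pi / 2),
      HasDerivAt (fun x => G (x, q.2)) (G' q) q.1)
    (h0 : ∀ q ∈ xRange t ×ˢ Ioo (-(Real.pi / 2)) (Real.pi / 2), q.1 ∉ C → G q = 0)
    (h1 : Integrable (fun q => rectDirDeriv (1, 0) u q * G q) (rectMeasure t))
    (h2 : Integrable (fun q => u (Sum.inr q) * G' q) (rectMeasure t)) :
    ∫ q, rectDirDeriv (1, 0) u q * G q ∂(rectMeasure t) =
      -∫ q, u (Sum.inr q) * G' q ∂(rectMeasure t) := by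
  rw [eq_neg_iff_add_eq_zero, ← integral_add h1 h2]
  refine integral_rect_deriv_eq_zero (H := fun q => u (Sum.inr q) * G q) hC hCt
    (fun q hq => ?_) (fun q hq hqC => by simp only [h0 q hq hqC, mul_zero]) (h1.add h2)
  exact (hasDerivAt_rectDirDeriv ((hu.contDiffAt ((isOpen_rect t).mem_nhds hq)).differentiableAt
    (by simp))).mul (hd q hq)

lemma IsApprox.tendsto_inr (hf : X.IsApprox t bc f u) :
    Tendsto (fun n => eLpNorm ((fun q => f n (Sum.inr q)) - fun q => u (Sum.inr q)) 2
      (rectMeasure t)) atTop (𝓝 0) :=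
  tendsto_of_tendsto_of_tendsto_of_le_of_le tendsto_const_nhds hf.tendsto (fun _ => zero_le)
    fun n => eLpNorm_inr_le X t (f n - u) 2

/-- The `x`-derivatives of approximating test functions converge in `L²` on the rectangle. -/
lemma IsApprox.tendsto_rectDirDeriv (ht : 1 ≤ t) (hf : X.IsApprox t bc f u)
    (hu : ContDiffOn ℝ ∞ (fun q => u (Sum.inr q))
      (xRange t ×ˢ Ioo (-(Real.pi / 2)) (Real.pi / 2))) :
    MemLp (rectDirDeriv (1, 0) u) 2 (rectMeasure t) ∧
      Tendsto (fun n => eLpNorm (rectDirDeriv (1, 0) (f n) - rectDirDeriv (1, 0) u) 2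
        (rectMeasure t)) atTop (𝓝 0) := by
  set U := xRange t ×ˢ Ioo (-(Real.pi / 2)) (Real.pi / 2) with hU
  have hfm : ∀ n, MemLp (rectDirDeriv (1, 0) (f n)) 2 (rectMeasure t) := fun n =>
    (hf.isSmooth n).memLp_rectDirDeriv ht _ 2
  -- The Dirichlet integral dominates the squared norm of the `x`-derivative on the rectangle, so
  -- these derivatives are Cauchy in `L²` and have a limit `D`.
  have hc : Tendsto (fun k : ℕ × ℕ => ∫ q, (rectDirDeriv (1, 0) (f k.1) -
      rectDirDeriv (1, 0) (f k.2)) q ^ 2 ∂(rectMeasure t)) atTop (𝓝 0) := by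
    refine squeeze_zero (fun k => integral_nonneg fun q => sq_nonneg _) (fun k => ?_)
      hf.energy.dirichletForm
    have hk := (IsTest.sub (hf.test k.1) (hf.test k.2)).1
    rw [dirichletForm_eq' ht hk hk]
    have e1 : ∫ q, (rectDirDeriv (1, 0) (f k.1) - rectDirDeriv (1, 0) (f k.2)) q ^ 2
        ∂(rectMeasure t) = ∫ q, rectDirDeriv (1, 0) (f k.1 - f k.2) q *
          rectDirDeriv (1, 0) (f k.1 - f k.2) q ∂(rectMeasure t) := by
      refine setIntegral_congr_fun (measurableSet_rect t) fun q hq => ?_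
      have := (hf.isSmooth k.1).rectDirDeriv_linear (hf.isSmooth k.2) 1 (-1) hq (1, 0)
      rw [show (1 : ℝ) • f k.1 + (-1 : ℝ) • f k.2 = f k.1 - f k.2 by
        rw [one_smul, neg_one_smul, sub_eq_add_neg]] at this
      simp only [this, Pi.sub_apply]
      ring
    rw [e1]
    have e2 := restForm_self_nonneg X t (f k.1 - f k.2)
    have e3 : 0 ≤ ∫ q, rectDirDeriv (0, 1) (f k.1 - f k.2) q *
        rectDirDeriv (0, 1) (f k.1 - f k.2) q ∂(rectMeasure t) :=
      integral_nonneg fun q => mul_self_nonneg _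
    linarith
  obtain ⟨D, hD, hlim⟩ := exists_tendsto_eLpNorm hfm hc
  have hux := continuousOn_rectDirDeriv hu (1, 0)
  -- `D` is the weak `x`-derivative of `u`: against a bump function the derivative is moved to `θ`,
  -- the limit is taken there, and the derivative is moved back.
  have hint : ∀ θ : ℝ × ℝ → ℝ, ContDiff ℝ ∞ θ → HasCompactSupport θ → tsupport θ ⊆ U →
      ∫ q, D q * θ q ∂(rectMeasure t) = ∫ q, rectDirDeriv (1, 0) u q * θ q ∂(rectMeasure t) := by
    intro θ hθ hθc hθU
    set θ' : ℝ × ℝ → ℝ := fun q => fderiv ℝ θ q (1, 0) with hθ'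
    have hθ'c : Continuous θ' := (hθ.continuous_fderiv (by simp)).clm_apply continuous_const
    have hθd : ∀ q, HasDerivAt (fun x => θ (x, q.2)) (θ' q) q.1 := fun q => by
      have h1 : HasDerivAt (fun x : ℝ => (x, q.2)) ((1, 0) : ℝ × ℝ) q.1 :=
        (hasDerivAt_id q.1).prodMk (hasDerivAt_const q.1 q.2)
      exact ((hθ.differentiable (by simp)) q).hasFDerivAt.comp_hasDerivAt q.1 h1
    have hθ's : HasCompactSupport θ' := hθc.fderiv_apply (𝕜 := ℝ) (1, 0)
    have hmem : MemLp θ 2 (rectMeasure t) :=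
      (hθ.continuous.memLp_of_hasCompactSupport hθc).restrict _
    have hmem' : MemLp θ' 2 (rectMeasure t) := (hθ'c.memLp_of_hasCompactSupport hθ's).restrict _
    have hC : IsCompact (Prod.fst '' tsupport θ) := hθc.isCompact.image continuous_fst
    have hCt : Prod.fst '' tsupport θ ⊆ xRange t := by
      rintro _ ⟨q, hq, rfl⟩
      exact (hθU hq).1
    have h0 : ∀ q : ℝ × ℝ, q.1 ∉ Prod.fst '' tsupport θ → θ q = 0 := fun q hq =>
      image_eq_zero_of_notMem_tsupport fun h => hq ⟨q, h, rfl⟩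
    have hus : tsupport (fun q => rectDirDeriv (1, 0) u q * θ q) ⊆ U :=
      (tsupport_mul_subset_right).trans hθU
    have huθ : Integrable (fun q => rectDirDeriv (1, 0) u q * θ q) (rectMeasure t) := by
      have : ContinuousOn (fun q => rectDirDeriv (1, 0) u q * θ q) U :=
        hux.mul hθ.continuous.continuousOn
      refine ((((this.mono hθU).integrableOn_compact (μ := volume)
        hθc.isCompact).integrable_of_forall_notMem_eq_zero ?_)).restrict
      intro q hq
      rw [image_eq_zero_of_notMem_tsupport hq, mul_zero]
    have l1 := tendsto_integral_mul hfm (fun _ => hmem) hD hmem hlim (by simp)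
    have l2 := (tendsto_integral_mul (fun n => memLp_inr (hf.memLp_seq ht n)) (fun _ => hmem')
      (memLp_inr hf.memLp) hmem' hf.tendsto_inr (by simp)).neg
    rw [integral_rectDirDeriv_mul hC hCt hu (fun q _ => hθd q) (fun q _ => h0 q) huθ
      ((memLp_inr hf.memLp).integrable_mul hmem')]
    refine tendsto_nhds_unique l1 (l2.congr fun n => ?_)
    exact (integral_rectDirDeriv_mul hC hCt (hf.isSmooth n).contDiffOn_rect (fun q _ => hθd q)
      (fun q _ => h0 q) ((hfm n).integrable_mul hmem)
      ((memLp_inr (hf.memLp_seq ht n)).integrable_mul hmem')).symm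
  -- By the fundamental lemma of the calculus of variations the weak derivative agrees almost
  -- everywhere with the classical one, which exists because `u` is smooth inside.
  have hDu : D =ᵐ[rectMeasure t] rectDirDeriv (1, 0) u := by
    have hDloc : LocallyIntegrableOn D U :=
      IntegrableOn.locallyIntegrableOn (hD.integrable (by norm_num))
    have huloc : LocallyIntegrableOn (rectDirDeriv (1, 0) u) U :=
      hux.locallyIntegrableOn (measurableSet_rect t)
    have hz := (isOpen_rect t).ae_eq_zero_of_integral_contDiff_smul_eq_zero (hDloc.sub huloc)
      fun θ hθ hθc hθU => by
        have hE := hint θ hθ hθc hθU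
        have i1 : Integrable (fun q => D q * θ q) (rectMeasure t) :=
          hD.integrable_mul
            ((hθ.continuous.memLp_of_hasCompactSupport (p := 2) hθc).restrict _)
        have i2 : Integrable (fun q => rectDirDeriv (1, 0) u q * θ q) (rectMeasure t) := by
          have : ContinuousOn (fun q => rectDirDeriv (1, 0) u q * θ q) U :=
            hux.mul hθ.continuous.continuousOn
          refine ((((this.mono hθU).integrableOn_compact (μ := volume)
            hθc.isCompact).integrable_of_forall_notMem_eq_zero ?_)).restrict
          intro q hq
          rw [image_eq_zero_of_notMem_tsupport hq, mul_zero]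
        have e : ∫ q, θ q • (D - rectDirDeriv (1, 0) u) q =
            ∫ q in U, (D q * θ q - rectDirDeriv (1, 0) u q * θ q) := by
          rw [← setIntegral_eq_integral_of_forall_compl_eq_zero (s := U)]
          · refine integral_congr_ae (ae_of_all _ fun q => ?_)
            simp only [Pi.sub_apply, smul_eq_mul]
            ring
          · intro q hq
            rw [image_eq_zero_of_notMem_tsupport fun h => hq (hθU h), zero_smul]
        rw [e]
        have := integral_sub i1 i2
        rw [hE, sub_self] at this
        exact this
    refine (ae_restrict_iff' (measurableSet_rect t)).2 ?_
    filter_upwards [hz] with q hq hqU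
    exact sub_eq_zero.1 (hq hqU)
  refine ⟨(memLp_congr_ae hDu).1 hD, hlim.congr fun n => eLpNorm_congr_ae ?_⟩
  filter_upwards [hDu] with q hq
  simp [hq]

end PartiallyRectangularDomain

/-! ### Difference quotients along the rectangle -/

/-- A smooth function with compact support in `(-tπ/2, tπ/2)`. -/
structure IsCutoff (t : ℝ) (κ : ℝ → ℝ) : Prop where
  smooth : ContDiff ℝ ∞ κ
  compact : HasCompactSupport κ
  subset : tsupport κ ⊆ xRange t

namespace IsCutoff

variable {t : ℝ} {κ : ℝ → ℝ}

lemma exists_ends (hκ : IsCutoff t κ) : ∃ η, 0 < η ∧ η < Real.pi / 2 ∧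
    ∀ x, t * (Real.pi / 2) - η ≤ |x| → κ x = 0 := by
  have hpi := Real.pi_pos
  rcases (tsupport κ).eq_empty_or_nonempty with he | hne
  · exact ⟨Real.pi / 4, by positivity, by linarith, fun x _ =>
      image_eq_zero_of_notMem_tsupport (by simp [he])⟩
  · obtain ⟨z, hz, hmax⟩ := hκ.compact.isCompact.exists_isMaxOn hne continuous_abs.continuousOn
    have hz' : |z| < t * (Real.pi / 2) := abs_lt.2 (hκ.subset hz)
    refine ⟨min ((t * (Real.pi / 2) - |z|) / 2) (Real.pi / 4), lt_min (by linarith) (by positivity),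
      (min_le_right _ _).trans_lt (by linarith), fun x hx => ?_⟩
    refine image_eq_zero_of_notMem_tsupport fun hxs => ?_
    have h1 : |x| ≤ |z| := hmax hxs
    have h2 := min_le_left ((t * (Real.pi / 2) - |z|) / 2) (Real.pi / 4)
    linarith

lemma deriv (hκ : IsCutoff t κ) : IsCutoff t (deriv κ) :=
  ⟨(contDiff_infty_iff_deriv.1 hκ.smooth).2, hκ.compact.deriv,
    tsupport_deriv_subset.trans hκ.subset⟩

lemma exists_bound (hκ : IsCutoff t κ) : ∃ A, 0 ≤ A ∧ ∀ x, |κ x| ≤ A := by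
  obtain ⟨A, hA⟩ := hκ.compact.exists_bound_of_continuous hκ.smooth.continuous
  exact ⟨A, (norm_nonneg _).trans (hA 0), hA⟩

lemma hasDerivAt (hκ : IsCutoff t κ) (x : ℝ) : HasDerivAt κ (_root_.deriv κ x) x :=
  ((hκ.smooth.differentiable (by simp)) x).hasDerivAt

/-- Displacement by `h κ` is a stretching of `X_t` onto itself, so the transplantation results apply
with `s = t` and difference quotients stay in the form domain. The bound `h A ≤ 1/2` keeps the
Jacobian between `1/2` and `3/2`. -/
lemma isStretch (hκ : IsCutoff t κ) {A h : ℝ} (hA : ∀ x, |_root_.deriv κ x| ≤ A) (h0 : 0 ≤ h)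
    (hh : h * A ≤ 1 / 2) :
    IsStretch t t (fun x => x + h * κ x) (fun x => 1 + h * _root_.deriv κ x) ∧
      ∀ x, 1 / 2 ≤ 1 + h * _root_.deriv κ x ∧ 1 + h * _root_.deriv κ x ≤ 3 / 2 := by
  have hb : ∀ x, |h * _root_.deriv κ x| ≤ 1 / 2 := fun x => by
    rw [abs_mul, abs_of_nonneg h0]
    exact (mul_le_mul_of_nonneg_left (hA x) h0).trans hh
  refine ⟨⟨contDiff_id.add (contDiff_const.mul hκ.smooth),
    fun x => (hasDerivAt_id x).add ((hκ.hasDerivAt x).const_mul h), fun x => ?_, ?_⟩, fun x => ?_⟩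
  · linarith [(abs_le.1 (hb x)).1]
  · obtain ⟨η, h1, h2, h3⟩ := hκ.exists_ends
    refine ⟨η, h1, h2, fun x hx => ?_, fun x hx => ?_⟩
    · simp [h3 x (hx.trans (le_abs_self x))]
    · simp [h3 x (by linarith [neg_le_abs x])]
  · constructor <;> linarith [(abs_le.1 (hb x)).1, (abs_le.1 (hb x)).2]

end IsCutoff

/-- Jensen's inequality for the mean over `[0, h]`, from nonnegativity of the variance. -/
lemma intervalIntegral_sq_le {w : ℝ → ℝ} {h : ℝ} (h0 : 0 < h) (hw : ContinuousOn w (Icc 0 h)) :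
    (h⁻¹ * ∫ θ in (0)..h, w θ) ^ 2 ≤ h⁻¹ * ∫ θ in (0)..h, w θ ^ 2 := by
  have hu : uIcc 0 h = Icc 0 h := uIcc_of_le h0.le
  have i1 : IntervalIntegrable w volume 0 h := ContinuousOn.intervalIntegrable (by rwa [hu])
  have i2 : IntervalIntegrable (fun θ => w θ ^ 2) volume 0 h :=
    ContinuousOn.intervalIntegrable (by rw [hu]; exact hw.pow 2)
  set m := h⁻¹ * ∫ θ in (0)..h, w θ with hm
  have hm' : ∫ θ in (0)..h, w θ = h * m := by rw [hm]; field_simp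
  have h1 : 0 ≤ ∫ θ in (0)..h, (w θ - m) ^ 2 :=
    intervalIntegral.integral_nonneg h0.le fun θ _ => sq_nonneg _
  have h2 : ∫ θ in (0)..h, (w θ - m) ^ 2 = (∫ θ in (0)..h, w θ ^ 2) - h * m ^ 2 := by
    have e : ∀ θ, (w θ - m) ^ 2 = w θ ^ 2 - 2 * m * w θ + m ^ 2 := fun θ => by ring
    simp only [e]
    rw [intervalIntegral.integral_add (i2.sub (i1.const_mul _)) intervalIntegrable_const,
      intervalIntegral.integral_sub i2 (i1.const_mul _), intervalIntegral.integral_const_mul, hm',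
      intervalIntegral.integral_const, smul_eq_mul]
    ring
  have h3 : h * m ^ 2 ≤ ∫ θ in (0)..h, w θ ^ 2 := by linarith
  calc m ^ 2 = h⁻¹ * (h * m ^ 2) := by field_simp
    _ ≤ _ := by gcongr

namespace PartiallyRectangularDomain

variable {M : Type*} [TopologicalSpace M] [T2Space M] [SecondCountableTopology M]
  [ChartedSpace (EuclideanSpace ℝ (Fin 2)) M]
  [IsManifold (𝓡 2) ∞ M] [MeasurableSpace M] [BorelSpace M]
variable {X : PartiallyRectangularDomain M} {t s : ℝ} {κ : ℝ → ℝ} {u f : M ⊕ ℝ × ℝ → ℝ}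
  {bc : BoundaryCondition}

/-- The difference quotient of `u` along the vector field `κ ∂_x`. -/
def diffQuot (κ : ℝ → ℝ) (h : ℝ) (u : M ⊕ ℝ × ℝ → ℝ) : M ⊕ ℝ × ℝ → ℝ :=
  h⁻¹ • transport (fun _ => 1) (fun x => x + h * κ x) u + (-h⁻¹) • u

lemma diffQuot_inl (κ : ℝ → ℝ) (h : ℝ) (u : M ⊕ ℝ × ℝ → ℝ) (p : M) :
    diffQuot κ h u (Sum.inl p) = 0 := by
  simp [diffQuot, transport]

lemma diffQuot_inr (κ : ℝ → ℝ) (h : ℝ) (u : M ⊕ ℝ × ℝ → ℝ) (q : ℝ × ℝ) :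
    diffQuot κ h u (Sum.inr q) = h⁻¹ * (u (Sum.inr (q.1 + h * κ q.1, q.2)) - u (Sum.inr q)) := by
  simp only [diffQuot, transport, Pi.add_apply, Pi.smul_apply, Sum.elim_inr, smul_eq_mul]
  ring

/-- The difference quotient is the mean over `θ ∈ [0, h]` of `κ · ∂ₓu(x + θκ, y)`. Jensen and
Tonelli reduce the estimate to a fixed `θ`, where `x ↦ x + θκ` is a change of variables with
Jacobian at least `1/2`; this is the factor `2`. -/
lemma lintegral_diffQuot_le (hκ : IsCutoff t κ) {A h : ℝ} (hA : ∀ x, |deriv κ x| ≤ A)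
    (hA' : ∀ x, |κ x| ≤ A) (h0 : 0 < h) (hh : h * A ≤ 1 / 2)
    (hu : ContDiffOn ℝ ∞ (fun q => u (Sum.inr q))
      (xRange t ×ˢ Ioo (-(Real.pi / 2)) (Real.pi / 2))) :
    ∫⁻ q, ENNReal.ofReal (diffQuot κ h u (Sum.inr q) ^ 2) ∂(rectMeasure t) ≤
      ENNReal.ofReal (2 * A ^ 2) *
        ∫⁻ q, ENNReal.ofReal (rectDirDeriv (1, 0) u q ^ 2) ∂(rectMeasure t) := by
  have hA0 : 0 ≤ A := (abs_nonneg _).trans (hA 0)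
  set U := xRange t ×ˢ Ioo (-(Real.pi / 2)) (Real.pi / 2) with hU
  have hst : ∀ θ ∈ Icc 0 h, _ := fun θ hθ => hκ.isStretch (h := θ) hA hθ.1
    ((mul_le_mul_of_nonneg_right hθ.2 hA0).trans hh)
  have hmem : ∀ q ∈ U, ∀ θ ∈ Icc 0 h, (q.1 + θ * κ q.1, q.2) ∈ U := fun q hq θ hθ =>
    ⟨(hst θ hθ).1.mem_xRange.2 hq.1, hq.2⟩
  have hux := continuousOn_rectDirDeriv hu (1, 0)
  set g : (ℝ × ℝ) × ℝ → ℝ := fun z =>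
    κ z.1.1 * rectDirDeriv (1, 0) u (z.1.1 + z.2 * κ z.1.1, z.1.2) with hg
  have hgc : ContinuousOn g (U ×ˢ Icc 0 h) := by
    have hκc := hκ.smooth.continuous
    refine ContinuousOn.mul (by fun_prop) (hux.comp (by fun_prop) ?_)
    rintro ⟨q, θ⟩ ⟨hq, hθ⟩
    exact hmem q hq θ hθ
  have hpt : ∀ q ∈ U, ENNReal.ofReal (diffQuot κ h u (Sum.inr q) ^ 2) ≤
      ENNReal.ofReal h⁻¹ * ∫⁻ θ in Icc 0 h, ENNReal.ofReal (g (q, θ) ^ 2) := by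
    intro q hq
    have hc : ContinuousOn (fun θ => g (q, θ)) (Icc 0 h) :=
      hgc.comp (by fun_prop) fun θ hθ => ⟨hq, hθ⟩
    have hftc : ∫ θ in (0)..h, g (q, θ) =
        u (Sum.inr (q.1 + h * κ q.1, q.2)) - u (Sum.inr q) := by
      have hd : ∀ θ ∈ uIcc 0 h, HasDerivAt (fun θ => u (Sum.inr (q.1 + θ * κ q.1, q.2)))
          (g (q, θ)) θ := fun θ hθ => by
        rw [uIcc_of_le h0.le] at hθ
        have h1 := hasDerivAt_rectDirDeriv (u := u) (q := (q.1 + θ * κ q.1, q.2))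
          ((hu.contDiffAt ((isOpen_rect t).mem_nhds (hmem q hq θ hθ))).differentiableAt (by simp))
        have h2 : HasDerivAt (fun θ => q.1 + θ * κ q.1) (κ q.1) θ := by
          simpa using ((hasDerivAt_id θ).mul_const (κ q.1)).const_add q.1
        exact (h1.comp θ h2).congr_deriv (mul_comm _ _)
      have := intervalIntegral.integral_eq_sub_of_hasDerivAt hd
        (ContinuousOn.intervalIntegrable (by rwa [uIcc_of_le h0.le]))
      simpa using this
    rw [diffQuot_inr, ← hftc]
    have hci : IntegrableOn (fun θ => g (q, θ) ^ 2) (Icc 0 h) :=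
      (hc.pow 2).integrableOn_compact isCompact_Icc
    refine (ENNReal.ofReal_le_ofReal (intervalIntegral_sq_le h0 hc)).trans (le_of_eq ?_)
    rw [ENNReal.ofReal_mul (inv_nonneg.2 h0.le), intervalIntegral.integral_of_le h0.le,
      ← integral_Icc_eq_integral_Ioc, ofReal_integral_eq_lintegral_ofReal hci
        (ae_of_all _ fun θ => sq_nonneg _)]
  have hθ : ∀ θ ∈ Icc 0 h, ∫⁻ q, ENNReal.ofReal (g (q, θ) ^ 2) ∂(rectMeasure t) ≤
      ENNReal.ofReal (2 * A ^ 2) *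
        ∫⁻ q, ENNReal.ofReal (rectDirDeriv (1, 0) u q ^ 2) ∂(rectMeasure t) := by
    intro θ hθ
    obtain ⟨hJ, hr⟩ := hst θ hθ
    rw [hJ.isDensityMap_rect.lintegral_eq
      (fun q => ENNReal.ofReal (rectDirDeriv (1, 0) u q ^ 2)),
      ← lintegral_const_mul' _ _ ENNReal.ofReal_ne_top]
    refine lintegral_mono fun q => ?_
    have hr' := (hr q.1).1
    have hκ2 : κ q.1 ^ 2 ≤ A ^ 2 := sq_le_sq.2 (by rw [abs_of_nonneg hA0]; exact hA' _)
    rw [← ENNReal.ofReal_mul (by linarith), ← ENNReal.ofReal_mul (by positivity)]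
    refine ENNReal.ofReal_le_ofReal ?_
    simp only [hg, mul_pow]
    set b := rectDirDeriv (1, 0) u (q.1 + θ * κ q.1, q.2) ^ 2 with hb
    have hb0 : 0 ≤ b := sq_nonneg _
    calc κ q.1 ^ 2 * b ≤ A ^ 2 * b * 1 := by rw [mul_one]; gcongr
      _ ≤ A ^ 2 * b * (2 * (1 + θ * deriv κ q.1)) :=
        mul_le_mul_of_nonneg_left (by linarith) (by positivity)
      _ = _ := by ring
  calc _ ≤ ∫⁻ q in U, (ENNReal.ofReal h⁻¹ *
          ∫⁻ θ in Icc (0 : ℝ) h, ENNReal.ofReal (g (q, θ) ^ 2)) :=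
        setLIntegral_mono' (measurableSet_rect t) hpt
    _ = ENNReal.ofReal h⁻¹ * ∫⁻ q, (∫⁻ θ in Icc (0 : ℝ) h, ENNReal.ofReal (g (q, θ) ^ 2))
          ∂(rectMeasure t) := by rw [lintegral_const_mul' _ _ ENNReal.ofReal_ne_top]; rfl
    _ = ENNReal.ofReal h⁻¹ * ∫⁻ θ in Icc (0 : ℝ) h, (∫⁻ q, ENNReal.ofReal (g (q, θ) ^ 2)
          ∂(rectMeasure t)) := by
        rw [lintegral_lintegral_swap]
        rw [rectMeasure, Measure.prod_restrict]
        exact ((hgc.pow 2).aemeasurable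
          ((measurableSet_rect t).prod measurableSet_Icc)).ennreal_ofReal
    _ ≤ ENNReal.ofReal h⁻¹ * ∫⁻ _ in Icc (0 : ℝ) h, (ENNReal.ofReal (2 * A ^ 2) *
          ∫⁻ q, ENNReal.ofReal (rectDirDeriv (1, 0) u q ^ 2) ∂(rectMeasure t)) := by
        gcongr 1
        exact setLIntegral_mono' measurableSet_Icc hθ
    _ = _ := by
        rw [setLIntegral_const, Real.volume_Icc, sub_zero, mul_comm _ (ENNReal.ofReal h),
          ← mul_assoc, ← ENNReal.ofReal_mul (inv_nonneg.2 h0.le), inv_mul_cancel₀ h0.ne',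
          ENNReal.ofReal_one, one_mul]

/-- A trace inequality on the horizontal sides of the rectangle. -/
lemma integral_boundary_sq_le (ht : 1 ≤ t) (hf : X.IsSmooth t f)
    (h0 : ∀ p, f (Sum.inl p) = 0) {c : ℝ} (hc : 0 ≤ c) :
    c * ∫ z, f z ^ 2 ∂(X.boundaryMeasure t) ≤
      1 / 2 * (∫ q, rectDirDeriv (0, 1) f q ^ 2 ∂(rectMeasure t)) +
        (2 * c / Real.pi + 2 * c ^ 2) * ∫ q, f (Sum.inr q) ^ 2 ∂(rectMeasure t) := by
  have hpi := Real.pi_pos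
  have hN : 0 ≤ ∫ q, f (Sum.inr q) ^ 2 ∂(rectMeasure t) := integral_nonneg fun q => sq_nonneg _
  have hB : 0 ≤ ∫ q, rectDirDeriv (0, 1) f q ^ 2 ∂(rectMeasure t) :=
    integral_nonneg fun q => sq_nonneg _
  have hi := (hf.memLp_boundary ht 2).integrable_sq
  rw [boundaryMeasure_eq] at hi ⊢
  rw [integral_add_measure hi.left_of_add_measure hi.right_of_add_measure,
    measurableEmbedding_inl.integral_map]
  simp only [h0]
  rw [integral_congr_ae (g := fun _ => (0 : ℝ)) (ae_of_all _ fun p => by simp), integral_zero,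
    zero_add]
  have hi2 := hi.right_of_add_measure
  unfold sideMeasure at hi2 ⊢
  split_ifs at hi2 ⊢ with hcyl
  · rw [integral_zero_measure, mul_zero]
    positivity
  rw [integral_add_measure hi2.left_of_add_measure hi2.right_of_add_measure,
    (measurableEmbedding_inr_left _).integral_map, (measurableEmbedding_inr_left _).integral_map]
  have j1 : Integrable (fun x => f (Sum.inr (x, Real.pi / 2)) ^ 2) (volume.restrict (xRange t)) :=
    (measurableEmbedding_inr_left (M := M) _).integrable_map_iff.1 hi2.left_of_add_measure
  have j2 : Integrable (fun x => f (Sum.inr (x, -(Real.pi / 2))) ^ 2)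
      (volume.restrict (xRange t)) :=
    (measurableEmbedding_inr_left (M := M) _).integrable_map_iff.1 hi2.right_of_add_measure
  have hfm := memLp_inr (hf.memLp_vol ht 2)
  have hdm := hf.memLp_rectDirDeriv ht (0, 1) 2
  have hym : MemLp (fun q : ℝ × ℝ => q.2 * f (Sum.inr q)) 2 (rectMeasure t) := by
    refine hfm.of_le_mul (c := Real.pi / 2) (continuous_snd.aestronglyMeasurable.mul hfm.1)
      ((ae_restrict_iff' (measurableSet_rect t)).2 (ae_of_all _ fun q hq => ?_))
    rw [norm_mul, Real.norm_eq_abs]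
    gcongr
    exact abs_le.2 ⟨hq.2.1.le, hq.2.2.le⟩
  have k2 : Integrable (fun q => (q.2 * f (Sum.inr q)) * rectDirDeriv (0, 1) f q)
    (rectMeasure t) := hym.integrable_mul hdm
  have k3 : Integrable (fun q => f (Sum.inr q) ^ 2 +
      2 * ((q.2 * f (Sum.inr q)) * rectDirDeriv (0, 1) f q)) (rectMeasure t) :=
    hfm.integrable_sq.add (k2.const_mul 2)
  -- Integrate `∂_y (y f²)` over a vertical section: the field `y ∂_y` points outwards, with length
  -- `π/2`, at both ends, so the two boundary values enter with the same sign.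
  have hsec : ∀ x ∈ xRange t, ∫ y in Ioo (-(Real.pi / 2)) (Real.pi / 2),
      (f (Sum.inr (x, y)) ^ 2 + 2 * ((y * f (Sum.inr (x, y))) * rectDirDeriv (0, 1) f (x, y))) =
      Real.pi / 2 * (f (Sum.inr (x, Real.pi / 2)) ^ 2 + f (Sum.inr (x, -(Real.pi / 2))) ^ 2) := by
    intro x hx
    have hle : -(Real.pi / 2) ≤ Real.pi / 2 := by linarith
    have hcont : ContinuousOn (fun y => f (Sum.inr (x, y))) (Icc (-(Real.pi / 2)) (Real.pi / 2)) :=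
      hf.2.1.continuousOn.comp (by fun_prop) fun y hy => ⟨hx, Icc_subset_coordRange _ hy⟩
    have hder : ∀ y ∈ Ioo (-(Real.pi / 2)) (Real.pi / 2),
        HasDerivAt (fun y => y * f (Sum.inr (x, y)) ^ 2) (f (Sum.inr (x, y)) ^ 2 +
          2 * ((y * f (Sum.inr (x, y))) * rectDirDeriv (0, 1) f (x, y))) y := fun y hy => by
      have h1 : HasDerivAt (fun y : ℝ => (x, y)) ((0, 1) : ℝ × ℝ) y :=
        (hasDerivAt_const y x).prodMk (hasDerivAt_id y)
      have h2 : HasDerivAt (fun y => f (Sum.inr (x, y))) (rectDirDeriv (0, 1) f (x, y)) y :=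
        HasFDerivAt.comp_hasDerivAt (l := fun q => f (Sum.inr q)) y
          (hf.differentiableAt_rect (q := (x, y)) ⟨hx, hy⟩).hasFDerivAt h1
      refine ((hasDerivAt_id y).mul (h2.pow 2)).congr_deriv ?_
      simp only [id, Pi.pow_apply]
      push_cast
      ring
    obtain ⟨C, hC0, hC⟩ := hf.exists_fderiv_bound ht
    have hdc : ContinuousOn (fun y => rectDirDeriv (0, 1) f (x, y))
        (Ioo (-(Real.pi / 2)) (Real.pi / 2)) :=
      (continuousOn_rectDirDeriv hf.contDiffOn_rect (0, 1)).comp (by fun_prop) fun y hy => ⟨hx, hy⟩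
    have hdi : MemLp (fun y => rectDirDeriv (0, 1) f (x, y)) 2
        (volume.restrict (Ioo (-(Real.pi / 2)) (Real.pi / 2))) :=
      MemLp.of_bound (hdc.aestronglyMeasurable measurableSet_Ioo) (Real.sqrt (C * (0 ^ 2 + 1 ^ 2)))
        ((ae_restrict_iff' measurableSet_Ioo).2 (ae_of_all _ fun y hy =>
          Real.abs_le_sqrt (hC x hx y hy (0, 1))))
    have hci : ∀ g : ℝ → ℝ, ContinuousOn g (Icc (-(Real.pi / 2)) (Real.pi / 2)) →
        MemLp g 2 (volume.restrict (Ioo (-(Real.pi / 2)) (Real.pi / 2))) := fun g hg => by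
      obtain ⟨D, hD⟩ := isCompact_Icc.exists_bound_of_continuousOn hg
      exact MemLp.of_bound ((hg.mono Ioo_subset_Icc_self).aestronglyMeasurable measurableSet_Ioo) D
        ((ae_restrict_iff' measurableSet_Ioo).2 (ae_of_all _ fun y hy =>
          hD y (Ioo_subset_Icc_self hy)))
    have hint : IntegrableOn (fun y => f (Sum.inr (x, y)) ^ 2 +
        2 * ((y * f (Sum.inr (x, y))) * rectDirDeriv (0, 1) f (x, y)))
        (Ioo (-(Real.pi / 2)) (Real.pi / 2)) :=
      (hci _ hcont).integrable_sq.add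
        (((hci _ (continuousOn_id.mul hcont)).integrable_mul hdi).const_mul 2)
    rw [← integral_Ioc_eq_integral_Ioo, ← intervalIntegral.integral_of_le hle,
      intervalIntegral.integral_eq_sub_of_hasDerivAt_of_le hle
        (continuousOn_id.mul (hcont.pow 2)) hder
        ((intervalIntegrable_iff_integrableOn_Ioo_of_le hle).2 hint)]
    simp only [Pi.pow_apply, Pi.mul_apply, id]
    ring
  have hmain : ∫ q, (f (Sum.inr q) ^ 2 +
      2 * ((q.2 * f (Sum.inr q)) * rectDirDeriv (0, 1) f q)) ∂(rectMeasure t) =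
      Real.pi / 2 * ((∫ x in xRange t, f (Sum.inr (x, Real.pi / 2)) ^ 2) +
        ∫ x in xRange t, f (Sum.inr (x, -(Real.pi / 2))) ^ 2) := by
    rw [rectMeasure_eq_prod] at k3 ⊢
    rw [integral_prod _ k3, ← integral_add j1 j2, ← integral_const_mul]
    exact setIntegral_congr_fun measurableSet_Ioo hsec
  have e1 : (∫ x in xRange t, f (Sum.inr (x, Real.pi / 2)) ^ 2) +
      ∫ x in xRange t, f (Sum.inr (x, -(Real.pi / 2))) ^ 2 = 2 / Real.pi *
      ∫ q, (f (Sum.inr q) ^ 2 +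
      2 * ((q.2 * f (Sum.inr q)) * rectDirDeriv (0, 1) f q)) ∂(rectMeasure t) := by
    rw [hmain]; field_simp
  rw [e1, ← integral_const_mul, ← integral_const_mul, ← integral_const_mul, ← integral_const_mul,
    ← integral_add (hdm.integrable_sq.const_mul _) (hfm.integrable_sq.const_mul _)]
  refine integral_mono_ae ((k3.const_mul _).const_mul _)
    ((hdm.integrable_sq.const_mul _).add (hfm.integrable_sq.const_mul _))
    ((ae_restrict_iff' (measurableSet_rect t)).2 (ae_of_all _ fun q hq => ?_))
  have hy : |q.2| ≤ Real.pi / 2 := abs_le.2 ⟨hq.2.1.le, hq.2.2.le⟩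
  simp only
  generalize f (Sum.inr q) = a
  generalize rectDirDeriv (0, 1) f q = b
  have h1 : (2 / Real.pi * q.2) ^ 2 ≤ 1 := by
    rw [sq_le_one_iff_abs_le_one, abs_mul, abs_of_pos (by positivity)]
    calc 2 / Real.pi * |q.2| ≤ 2 / Real.pi * (Real.pi / 2) := by gcongr
      _ = 1 := by field_simp
  have h2 : c * (2 / Real.pi * (a ^ 2 + 2 * (q.2 * a * b))) =
      2 * c / Real.pi * a ^ 2 + 2 * c * (2 / Real.pi * q.2) * a * b := by ring
  rw [h2]
  generalize 2 / Real.pi * q.2 = d at h1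
  have h3 : (c * a) ^ 2 * d ^ 2 ≤ (c * a) ^ 2 * 1 := mul_le_mul_of_nonneg_left h1 (sq_nonneg _)
  -- With `d = 2y/π` and `|d| ≤ 1`, the cross term satisfies `2cdab ≤ b²/2 + 2c²d²a²`. The weight
  -- `1/2` on `b²` is what later lets the Robin term be absorbed.
  nlinarith [sq_nonneg (2 * c * d * a - b)]

end PartiallyRectangularDomain

/-! ### The energy estimate for difference quotients of smooth functions. -/

namespace PartiallyRectangularDomain

variable {M : Type*} [TopologicalSpace M] [T2Space M] [SecondCountableTopology M]
  [ChartedSpace (EuclideanSpace ℝ (Fin 2)) M]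
  [IsManifold (𝓡 2) ∞ M] [MeasurableSpace M] [BorelSpace M]
variable {X : PartiallyRectangularDomain M} {t s : ℝ} {κ J r m : ℝ → ℝ} {u f g k : M ⊕ ℝ × ℝ → ℝ}
  {bc : BoundaryCondition} {E : ℝ}

lemma laplaceForm_linear (ht : 1 ≤ t) (hf : X.IsSmooth t f) (hg : X.IsSmooth t g)
    (hk : X.IsSmooth t k) (a b : ℝ) : X.laplaceForm t bc (a • f + b • g) k =
      a * X.laplaceForm t bc f k + b * X.laplaceForm t bc g k := by
  rw [laplaceForm, laplaceForm, laplaceForm, dirichletForm_linear ht hf hg hk,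
    integral_boundary_linear ht hf hg hk]
  ring

lemma contDiffOn_transport (hJ : IsStretch t s J r) (hm : ContDiff ℝ ∞ m)
    (hu : ContDiffOn ℝ ∞ (fun q => u (Sum.inr q))
      (xRange s ×ˢ Ioo (-(Real.pi / 2)) (Real.pi / 2))) :
    ContDiffOn ℝ ∞ (fun q => transport m J u (Sum.inr q))
      (xRange t ×ˢ Ioo (-(Real.pi / 2)) (Real.pi / 2)) :=
  (hm.comp contDiff_fst).contDiffOn.mul
    (hu.comp (f := fun q : ℝ × ℝ => (J q.1, q.2))
      ((hJ.smooth.comp contDiff_fst).prodMk contDiff_snd).contDiffOn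
      fun _ hq => ⟨hJ.mem_xRange.2 hq.1, hq.2⟩)

/-- Both coefficients of the flux are `O(h)`, since `ρ - 1` and `ρ'` are, so division by `h` leaves
a bounded operator. With `ρ⁻¹ ≤ 2` the constants are `10 = (1 + 3/2) · 2²` and `8 = 2³`. -/
lemma abs_stretchFlux_le {ρ ρ' h A a b : ℝ} (h0 : 0 < h) (h1 : 1 / 2 ≤ ρ) (h2 : ρ ≤ 3 / 2)
    (h3 : |ρ - 1| ≤ h * A) (h4 : |ρ'| ≤ h * A) :
    |h⁻¹ * ((ρ⁻¹ ^ 2 - 1) * a - ρ' * ρ⁻¹ ^ 3 * b)| ≤ 10 * A * |a| + 8 * A * |b| := by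
  have hρ : 0 < ρ := by linarith
  have hi : ρ⁻¹ ≤ 2 := by rw [inv_le_comm₀ hρ (by norm_num)]; linarith
  have hi0 : 0 < ρ⁻¹ := inv_pos.2 hρ
  have hhA : 0 ≤ h * A := (abs_nonneg _).trans h3
  have e1 : |ρ⁻¹ ^ 2 - 1| ≤ h * A * 10 := by
    have : ρ⁻¹ ^ 2 - 1 = (ρ - 1) * (-((1 + ρ) * ρ⁻¹ ^ 2)) := by field_simp; ring
    rw [this, abs_mul, abs_neg, abs_of_pos (by positivity : 0 < (1 + ρ) * ρ⁻¹ ^ 2)]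
    refine mul_le_mul h3 ?_ (by positivity) hhA
    calc (1 + ρ) * ρ⁻¹ ^ 2 ≤ (1 + 3 / 2) * 2 ^ 2 := by gcongr
      _ = 10 := by norm_num
  have e2 : |ρ' * ρ⁻¹ ^ 3| ≤ h * A * 8 := by
    rw [abs_mul, abs_of_pos (by positivity : 0 < ρ⁻¹ ^ 3)]
    refine mul_le_mul h4 ?_ (by positivity) hhA
    calc ρ⁻¹ ^ 3 ≤ 2 ^ 3 := by gcongr
      _ = 8 := by norm_num
  rw [abs_mul, abs_of_pos (inv_pos.2 h0)]
  calc _ ≤ h⁻¹ * (h * A * 10 * |a| + h * A * 8 * |b|) := by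
        gcongr
        refine (abs_sub _ _).trans ?_
        rw [abs_mul, abs_mul (_ * _)]
        gcongr
    _ = _ := by field_simp

/-- The energy estimate for difference quotients of smooth functions. -/
lemma diffQuot_energy_le (ht : 1 ≤ t) (hκ : IsCutoff t κ) {A h : ℝ} (hA : ∀ x, |deriv κ x| ≤ A)
    (hA' : ∀ x, |deriv (deriv κ) x| ≤ A) (h0 : 0 < h) (hh : h * A ≤ 1 / 2) {K : ℝ → ℝ}
    (hK : IsStretch t t K fun x => (1 + h * deriv κ (K x))⁻¹) (hKJ : ∀ x, K (x + h * κ x) = x)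
    (hf : X.IsSmooth t f) :
    3 / 4 * ∫ q, rectDirDeriv (1, 0) (diffQuot κ h f) q ^ 2 ∂(rectMeasure t) ≤
      h⁻¹ * (X.laplaceForm t bc f (transport (fun x => (1 + h * deriv κ (K x))⁻¹) K
          (diffQuot κ h f)) - X.laplaceForm t bc f (diffQuot κ h f)) +
        (2 * |bc.coeff| / Real.pi + 2 * |bc.coeff| ^ 2 + 1) *
          (∫ q, diffQuot κ h f (Sum.inr q) ^ 2 ∂(rectMeasure t)) +
        116 * A ^ 2 * ∫ q, rectDirDeriv (1, 0) (transport (fun _ => 1) (fun x => x + h * κ x) f) q ^ 2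
          ∂(rectMeasure t) := by
  obtain ⟨hJ, hr⟩ := hκ.isStretch hA h0.le hh
  set g := diffQuot κ h f with hg
  set w := transport (fun _ => 1) (fun x => x + h * κ x) f with hw
  have hws : X.IsSmooth t w := hf.transport hJ (isEndWeight_one t)
  have hgs : X.IsSmooth t g := hws.linear hf _ _
  have hrd : ∀ x, deriv (fun x => 1 + h * deriv κ x) x = h * deriv (deriv κ) x := fun x =>
    (((hκ.deriv.hasDerivAt x).const_mul h).const_add 1).deriv
  -- Writing `a` for the form and `T` for the weighted push-forward, this reads `a(f, Tg) = a(w, g)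
  -- + ∫ ∂ₓw · flux(g)`. Together with `g = h⁻¹(w - f)` it expresses `a(g, g)` through `h⁻¹(a(f, Tg)
  -- - a(f, g))` and a flux term. A discrete integration by parts thus leaves only the
  -- undifferentiated `f` in the first slot.
  have e1 := laplaceForm_transport (bc := bc) ht ht hJ hK hKJ hgs hf
  have e2 : X.laplaceForm t bc g g = h⁻¹ * X.laplaceForm t bc w g +
      (-h⁻¹) * X.laplaceForm t bc f g := laplaceForm_linear ht hws hf hgs _ _
  have gx := hgs.memLp_rectDirDeriv ht (1, 0) 2
  have gy := hgs.memLp_rectDirDeriv ht (0, 1) 2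
  have gm := memLp_inr (hgs.memLp_vol ht 2)
  have wx := hws.memLp_rectDirDeriv ht (1, 0) 2
  have e3 : |h⁻¹ * ∫ q, rectDirDeriv (1, 0) w q * stretchFlux (fun x => 1 + h * deriv κ x) g q
      ∂(rectMeasure t)| ≤ 1 / 4 * (∫ q, rectDirDeriv (1, 0) g q ^ 2 ∂(rectMeasure t)) +
        (∫ q, g (Sum.inr q) ^ 2 ∂(rectMeasure t)) +
        116 * A ^ 2 * ∫ q, rectDirDeriv (1, 0) w q ^ 2 ∂(rectMeasure t) := by
    have i1 := gx.integrable_sq.const_mul (1 / 4)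
    have i2 := gm.integrable_sq
    have i3 := wx.integrable_sq.const_mul (116 * A ^ 2)
    have i12 : Integrable (fun q => 1 / 4 * rectDirDeriv (1, 0) g q ^ 2 + g (Sum.inr q) ^ 2)
      (rectMeasure t) := i1.add i2
    rw [← integral_const_mul, ← integral_const_mul, ← integral_const_mul]
    refine abs_integral_le_integral_abs.trans ?_
    rw [← integral_add i1 i2, ← integral_add i12 i3]
    refine integral_mono_of_nonneg (ae_of_all _ fun q => abs_nonneg _) (i12.add i3)
      (ae_of_all _ fun q => ?_)
    have h5 := abs_stretchFlux_le (a := rectDirDeriv (1, 0) g q) (b := g (Sum.inr q)) (A := A)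
      (ρ := 1 + h * deriv κ q.1) (ρ' := h * deriv (deriv κ) q.1) h0 (hr q.1).1 (hr q.1).2
      (by rw [add_sub_cancel_left, abs_mul, abs_of_pos h0]; gcongr; exact hA _)
      (by rw [abs_mul, abs_of_pos h0]; gcongr; exact hA' _)
    simp only [stretchFlux, hrd]
    rw [mul_left_comm, abs_mul]
    refine (mul_le_mul_of_nonneg_left h5 (abs_nonneg _)).trans ?_
    rw [← sq_abs (rectDirDeriv (1, 0) g q), ← sq_abs (g (Sum.inr q)),
      ← sq_abs (rectDirDeriv (1, 0) w q)]
    generalize |rectDirDeriv (1, 0) g q| = a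
    generalize |g (Sum.inr q)| = b
    generalize |rectDirDeriv (1, 0) w q| = p
    -- Weighted Young inequalities: `10Aap ≤ a²/4 + 100A²p²` and `8Abp ≤ b² + 16A²p²`, hence `116 =
    -- 100 + 16`. The `1/4` is the part taken from `‖∂ₓg‖²`, leaving `3/4`.
    nlinarith [sq_nonneg (a / 2 - 10 * A * p), sq_nonneg (b - 4 * A * p)]
  -- The Robin term may have either sign; it costs half of `‖∂_y g‖²`, whose other half is
  -- discarded, and a multiple of `‖g‖²`.
  have e4 := integral_boundary_sq_le ht hgs (fun p => diffQuot_inl κ h f p)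
    (abs_nonneg bc.coeff)
  have e5 : (∫ q, rectDirDeriv (1, 0) g q ^ 2 ∂(rectMeasure t)) +
      (∫ q, rectDirDeriv (0, 1) g q ^ 2 ∂(rectMeasure t)) -
      |bc.coeff| * (∫ z, g z ^ 2 ∂(X.boundaryMeasure t)) ≤ X.laplaceForm t bc g g := by
    rw [laplaceForm, dirichletForm_eq' ht hgs hgs]
    simp only [← sq]
    have h6 := restForm_self_nonneg X t g
    have h7 := mul_le_mul_of_nonneg_right (le_abs_self bc.coeff)
      (X.integral_boundary_sq_nonneg t g)
    linarith
  have e6 : 0 ≤ ∫ q, rectDirDeriv (0, 1) g q ^ 2 ∂(rectMeasure t) :=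
    integral_nonneg fun q => sq_nonneg _
  rw [e1]
  have e7 := (abs_le.1 e3).1
  linarith

lemma rectDirDeriv_diffQuot {h : ℝ}
    (hJ : IsStretch t t (fun x => x + h * κ x) (fun x => 1 + h * deriv κ x))
    (hu : ContDiffOn ℝ ∞ (fun q => u (Sum.inr q))
      (xRange t ×ˢ Ioo (-(Real.pi / 2)) (Real.pi / 2))) {q : ℝ × ℝ}
    (hq : q ∈ xRange t ×ˢ Ioo (-(Real.pi / 2)) (Real.pi / 2)) :
    rectDirDeriv (1, 0) (diffQuot κ h u) q = h⁻¹ * ((1 + h * deriv κ q.1) *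
      rectDirDeriv (1, 0) u (q.1 + h * κ q.1, q.2) - rectDirDeriv (1, 0) u q) := by
  have hd : ∀ {v : M ⊕ ℝ × ℝ → ℝ}, ContDiffOn ℝ ∞ (fun q => v (Sum.inr q))
      (xRange t ×ˢ Ioo (-(Real.pi / 2)) (Real.pi / 2)) → ∀ {q : ℝ × ℝ},
      q ∈ xRange t ×ˢ Ioo (-(Real.pi / 2)) (Real.pi / 2) →
      DifferentiableAt ℝ (fun q => v (Sum.inr q)) q := fun {_} hv {_} hq =>
    (hv.contDiffAt ((isOpen_rect t).mem_nhds hq)).differentiableAt (by simp)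
  have hw := contDiffOn_transport hJ (m := fun _ => 1) contDiff_const hu
  have h1 := (((hd hw hq).hasFDerivAt.const_smul h⁻¹).add
    ((hd hu hq).hasFDerivAt.const_smul (-h⁻¹))).fderiv
  have h2 := (rectDirDeriv_transport (f := u) (m := fun _ => 1) (r := fun x => 1 + h * deriv κ x)
    (J := fun x => x + h * κ x) (q := q) contDiff_const (hJ.hasDerivAt q.1)
    (hd hu ⟨hJ.mem_xRange.2 hq.1, hq.2⟩)).1
  refine (congrArg (fun L : ℝ × ℝ →L[ℝ] ℝ => L (1, 0)) h1).trans ?_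
  change h⁻¹ * rectDirDeriv (1, 0) (transport (fun _ => 1) (fun x => x + h * κ x) u) q +
    -h⁻¹ * rectDirDeriv (1, 0) u q = _
  rw [h2]
  simp only [deriv_const]
  ring

end PartiallyRectangularDomain

/-! ### Second `x`-derivatives of eigenfunctions. -/

namespace PartiallyRectangularDomain

variable {M : Type*} [TopologicalSpace M] [T2Space M] [SecondCountableTopology M]
  [ChartedSpace (EuclideanSpace ℝ (Fin 2)) M]
  [IsManifold (𝓡 2) ∞ M] [MeasurableSpace M] [BorelSpace M]
variable {X : PartiallyRectangularDomain M} {t s : ℝ} {κ J r m : ℝ → ℝ} {u f g k : M ⊕ ℝ × ℝ → ℝ}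
  {bc : BoundaryCondition} {E : ℝ}

lemma IsEigenfunction.contDiffOn_rect (hu : X.IsEigenfunction t bc u E) :
    ContDiffOn ℝ ∞ (fun q => u (Sum.inr q)) (xRange t ×ˢ Ioo (-(Real.pi / 2)) (Real.pi / 2)) :=
  hu.smooth.contDiffOn_rect

lemma IsEigenfunction.memLp_rectDirDeriv (ht : 1 ≤ t) (hu : X.IsEigenfunction t bc u E) :
    MemLp (rectDirDeriv (1, 0) u) 2 (rectMeasure t) := by
  obtain ⟨f, hf, -⟩ := hu.exists_isApprox ht
  exact (hf.tendsto_rectDirDeriv ht hu.contDiffOn_rect).1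

lemma tendsto_integral_sq {α : Type*} [MeasurableSpace α] {μ : Measure α} {F : ℕ → α → ℝ}
    {G : α → ℝ} (hF : ∀ n, MemLp (F n) 2 μ) (hG : MemLp G 2 μ)
    (h : Tendsto (fun n => eLpNorm (F n - G) 2 μ) atTop (𝓝 0)) :
    Tendsto (fun n => ∫ z, F n z ^ 2 ∂μ) atTop (𝓝 (∫ z, G z ^ 2 ∂μ)) := by
  simpa only [sq] using tendsto_integral_mul hF hF hG hG h h

/-- The `x`-derivatives of the difference quotients of an eigenfunction are bounded in `L²`. -/
lemma IsEigenfunction.exists_diffQuot_bound (ht : 1 ≤ t) (hu : X.IsEigenfunction t bc u E)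
    (hκ : IsCutoff t κ) : ∃ D A : ℝ, 0 < A ∧ (∀ x, |deriv κ x| ≤ A) ∧ ∀ h, 0 < h → h * A ≤ 1 / 2 →
      MemLp (rectDirDeriv (1, 0) (diffQuot κ h u)) 2 (rectMeasure t) ∧
      ∫ q, rectDirDeriv (1, 0) (diffQuot κ h u) q ^ 2 ∂(rectMeasure t) ≤ D := by
  obtain ⟨A₀, h00, hA₀⟩ := hκ.exists_bound
  obtain ⟨A₁, h10, hA₁⟩ := hκ.deriv.exists_bound
  obtain ⟨A₂, h20, hA₂⟩ := hκ.deriv.deriv.exists_bound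
  set A := A₀ + A₁ + A₂ + 1 with hA
  have hb0 : ∀ x, |κ x| ≤ A := fun x => (hA₀ x).trans (by linarith)
  have hb1 : ∀ x, |deriv κ x| ≤ A := fun x => (hA₁ x).trans (by linarith)
  have hb2 : ∀ x, |deriv (deriv κ) x| ≤ A := fun x => (hA₂ x).trans (by linarith)
  have hux := hu.memLp_rectDirDeriv ht
  set U := ∫ q, rectDirDeriv (1, 0) u q ^ 2 ∂(rectMeasure t) with hU
  have hU0 : 0 ≤ U := integral_nonneg fun q => sq_nonneg _
  set c := 2 * |bc.coeff| / Real.pi + 2 * |bc.coeff| ^ 2 + 1 with hc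
  have hpi := Real.pi_pos
  have hc0 : 0 ≤ c := by positivity
  -- `4/3` undoes the coefficient `3/4` of the energy estimate. The quantities `2A²U` and `3U/2`
  -- bound `‖g‖²` and `‖∂ₓw‖²` uniformly in `h`, where `g` is the difference quotient and `w` the
  -- displaced `u`.
  refine ⟨4 / 3 * ((|E| + c) * (2 * A ^ 2 * U) + 116 * A ^ 2 * (3 / 2 * U)), A, by positivity, hb1,
    fun h h0 hh => ?_⟩
  obtain ⟨hJ, hr⟩ := hκ.isStretch hb1 h0.le hh
  obtain ⟨K, hK, hKJ, -⟩ := hJ.exists_inverse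
  obtain ⟨f, hf, hf'⟩ := hu.exists_isApprox ht
  have hw := hf.transport ht ht hJ (isEndWeight_one t)
  have hg : X.IsApprox t bc (fun n => diffQuot κ h (f n)) (diffQuot κ h u) :=
    hw.linear ht hf h⁻¹ (-h⁻¹)
  have hT := hg.transport ht ht hK hK.isEndWeight_deriv
  have hucd := hu.contDiffOn_rect
  have hwcd := contDiffOn_transport hJ (m := fun _ => 1) contDiff_const hucd
  have hgcd : ContDiffOn ℝ ∞ (fun q => diffQuot κ h u (Sum.inr q))
      (xRange t ×ˢ Ioo (-(Real.pi / 2)) (Real.pi / 2)) :=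
    (hwcd.const_smul h⁻¹).add (hucd.const_smul (-h⁻¹))
  obtain ⟨gx, gxl⟩ := hg.tendsto_rectDirDeriv ht hgcd
  obtain ⟨wx, wxl⟩ := hw.tendsto_rectDirDeriv ht hwcd
  refine ⟨gx, ?_⟩
  have l1 := tendsto_integral_sq (fun n => (hg.isSmooth n).memLp_rectDirDeriv ht _ 2) gx gxl
  have l2 := tendsto_integral_sq (fun n => (hw.isSmooth n).memLp_rectDirDeriv ht _ 2) wx wxl
  have l3 := tendsto_integral_sq (fun n => memLp_inr (hg.memLp_seq ht n)) (memLp_inr hg.memLp)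
    hg.tendsto_inr
  have l4 := ((hf' _ _ hT).sub (hf' _ _ hg)).const_mul h⁻¹
  -- The estimate for smooth functions passes to `u` along its approximating sequence. The two form
  -- values converge by the weak equation, the only place where `u` being an eigenfunction enters
  -- this limit.
  have hle := le_of_tendsto_of_tendsto (l1.const_mul (3 / 4))
    ((l4.add (l3.const_mul c)).add (l2.const_mul (116 * A ^ 2)))
    (Eventually.of_forall fun n => diffQuot_energy_le ht hκ hb1 hb2 h0 hh hK hKJ (hf.isSmooth n))
  set I := ∫ q, diffQuot κ h u (Sum.inr q) ^ 2 ∂(rectMeasure t) with hI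
  have hI0 : 0 ≤ I := integral_nonneg fun q => sq_nonneg _
  -- The two pairings differ by `⟨w - u, g⟩ = h ‖g‖²`, and `g` vanishes on `W`; the apparently
  -- singular factor `h⁻¹` therefore leaves just `E ‖g‖²`.
  have hZ : h⁻¹ * (E * (∫ z, u z * transport (fun x => (1 + h * deriv κ (K x))⁻¹) K
      (diffQuot κ h u) z ∂(X.vol t)) - E * ∫ z, u z * diffQuot κ h u z ∂(X.vol t)) = E * I := by
    have i1 : Integrable (fun z => transport (fun _ => 1) (fun x => x + h * κ x) u z *
        diffQuot κ h u z) (X.vol t) := hw.memLp.integrable_mul hg.memLp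
    have i2 : Integrable (fun z => u z * diffQuot κ h u z) (X.vol t) :=
      hu.memLp.integrable_mul hg.memLp
    rw [integral_mul_transport hJ hKJ, ← mul_sub, ← integral_sub i1 i2, mul_left_comm,
      ← integral_const_mul]
    congr 1
    have e1 : ∀ z, h⁻¹ * (transport (fun _ => 1) (fun x => x + h * κ x) u z * diffQuot κ h u z -
        u z * diffQuot κ h u z) = diffQuot κ h u z ^ 2 := fun z => by
      simp only [diffQuot, Pi.add_apply, Pi.smul_apply, smul_eq_mul]
      ring
    simp only [e1]
    have i3 := hg.memLp.integrable_sq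
    rw [vol_eq] at i3 ⊢
    rw [integral_add_measure i3.left_of_add_measure i3.right_of_add_measure,
      measurableEmbedding_inl.integral_map, measurableEmbedding_inr.integral_map]
    simp only [diffQuot_inl]
    simp [hI]
  have hIle : I ≤ 2 * A ^ 2 * U := by
    have h1 := lintegral_diffQuot_le hκ hb1 hb0 h0 hh hucd
    rw [← ofReal_integral_eq_lintegral_ofReal (memLp_inr hg.memLp).integrable_sq
        (ae_of_all _ fun q => sq_nonneg _),
      ← ofReal_integral_eq_lintegral_ofReal hux.integrable_sq (ae_of_all _ fun q => sq_nonneg _),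
      ← ENNReal.ofReal_mul (by positivity)] at h1
    exact (ENNReal.ofReal_le_ofReal_iff (by positivity)).1 h1
  have hP : ∫ q, rectDirDeriv (1, 0) (transport (fun _ => 1) (fun x => x + h * κ x) u) q ^ 2
      ∂(rectMeasure t) ≤ 3 / 2 * U := by
    refine hJ.isDensityMap_rect.integral_le hux.integrable_sq (fun q => sq_nonneg _)
      ((ae_restrict_iff' (measurableSet_rect t)).2 (ae_of_all _ fun q hq => ?_))
    have hdiff : DifferentiableAt ℝ (fun q => u (Sum.inr q)) (q.1 + h * κ q.1, q.2) :=
      (hucd.contDiffAt (x := (q.1 + h * κ q.1, q.2)) ((isOpen_rect t).mem_nhds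
        ⟨hJ.mem_xRange.2 hq.1, hq.2⟩)).differentiableAt (by simp)
    rw [(rectDirDeriv_transport (f := u) (m := fun _ => 1) (r := fun x => 1 + h * deriv κ x)
      (J := fun x => x + h * κ x) (q := q) contDiff_const (hJ.hasDerivAt q.1) hdiff).1, deriv_const, zero_mul, zero_add, one_mul]
    set ρ := 1 + h * deriv κ q.1 with hρ
    have h1 := (hr q.1).1
    have h2 := (hr q.1).2
    have h3 : 0 ≤ ρ * rectDirDeriv (1, 0) u (q.1 + h * κ q.1, q.2) ^ 2 :=
      mul_nonneg (by linarith) (sq_nonneg _)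
    nlinarith [mul_le_mul_of_nonneg_right h2 h3]
  rw [hZ] at hle
  have h1 : E * I ≤ |E| * (2 * A ^ 2 * U) :=
    (mul_le_mul_of_nonneg_right (le_abs_self E) hI0).trans
      (mul_le_mul_of_nonneg_left hIle (abs_nonneg E))
  have h2 := mul_le_mul_of_nonneg_left hIle hc0
  have h3 := mul_le_mul_of_nonneg_left hP (by positivity : 0 ≤ 116 * A ^ 2)
  linarith

lemma contDiffOn_rectDirDeriv
    (hu : ContDiffOn ℝ ∞ (fun q => u (Sum.inr q))
      (xRange t ×ˢ Ioo (-(Real.pi / 2)) (Real.pi / 2))) (v : ℝ × ℝ) :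
    ContDiffOn ℝ ∞ (rectDirDeriv v u) (xRange t ×ˢ Ioo (-(Real.pi / 2)) (Real.pi / 2)) :=
  (hu.fderiv_of_isOpen (isOpen_rect t) (by simp)).clm_apply contDiffOn_const

lemma hasDerivAt_dX {F : ℝ × ℝ → ℝ}
    (hF : ContDiffOn ℝ ∞ F (xRange t ×ˢ Ioo (-(Real.pi / 2)) (Real.pi / 2))) {q : ℝ × ℝ}
    (hq : q ∈ xRange t ×ˢ Ioo (-(Real.pi / 2)) (Real.pi / 2)) :
    HasDerivAt (fun x => F (x, q.2)) (dX F q) q.1 := by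
  have h1 : HasDerivAt (fun x : ℝ => (x, q.2)) ((1, 0) : ℝ × ℝ) q.1 :=
    (hasDerivAt_id q.1).prodMk (hasDerivAt_const q.1 q.2)
  have h2 := ((hF.contDiffAt ((isOpen_rect t).mem_nhds hq)).differentiableAt
    (by simp)).hasFDerivAt.comp_hasDerivAt q.1 h1
  exact h2.differentiableAt.hasDerivAt

/-- Second `x`-derivatives of eigenfunctions are square integrable on strips away from `W`. -/
lemma IsEigenfunction.memLp_dX_rectDirDeriv (ht : 1 ≤ t) (hu : X.IsEigenfunction t bc u E)
    (hκ : IsCutoff t κ) :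
    MemLp (fun q => κ q.1 * dX (rectDirDeriv (1, 0) u) q) 2 (rectMeasure t) := by
  obtain ⟨D, A, hA0, hA, hD⟩ := hu.exists_diffQuot_bound ht hκ
  have hucd := hu.contDiffOn_rect
  have hux := hu.memLp_rectDirDeriv ht
  set h : ℕ → ℝ := fun n => 1 / (2 * A) * (1 / ((n : ℝ) + 1)) with hh
  have hpos : ∀ n, 0 < h n := fun n => by positivity
  have hle : ∀ n, h n * A ≤ 1 / 2 := fun n => by
    have : 1 / ((n : ℝ) + 1) ≤ 1 := by
      rw [div_le_one (by positivity)]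
      linarith [Nat.cast_nonneg (α := ℝ) n]
    calc h n * A = 1 / 2 * (1 / ((n : ℝ) + 1)) := by rw [hh]; field_simp
      _ ≤ 1 / 2 := by linarith
  have hlim0 : Tendsto h atTop (𝓝[≠] 0) := by
    refine tendsto_nhdsWithin_iff.2 ⟨?_, Eventually.of_forall fun n => (hpos n).ne'⟩
    have := (tendsto_one_div_add_atTop_nhds_zero_nat (𝕜 := ℝ)).const_mul (1 / (2 * A))
    rwa [mul_zero] at this
  set L : ℝ × ℝ → ℝ := fun q => deriv κ q.1 * rectDirDeriv (1, 0) u q +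
    κ q.1 * dX (rectDirDeriv (1, 0) u) q with hL
  -- At an interior point the quotients are slopes at `0` of `θ ↦ (1 + θκ') ∂ₓu(x + θκ, y)`, so they
  -- converge to `L = ∂ₓ(κ ∂ₓu)`.
  have hpt : ∀ᵐ q ∂(rectMeasure t),
      Tendsto (fun n => rectDirDeriv (1, 0) (diffQuot κ (h n) u) q) atTop (𝓝 (L q)) := by
    refine (ae_restrict_iff' (measurableSet_rect t)).2 (ae_of_all _ fun q hq => ?_)
    have h1 := hasDerivAt_dX (contDiffOn_rectDirDeriv hucd (1, 0)) hq
    have h2 : HasDerivAt (fun θ : ℝ => q.1 + θ * κ q.1) (κ q.1) 0 := by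
      simpa using ((hasDerivAt_id (0 : ℝ)).mul_const (κ q.1)).const_add q.1
    have h3 : HasDerivAt (fun θ : ℝ => 1 + θ * deriv κ q.1) (deriv κ q.1) 0 := by
      simpa using ((hasDerivAt_id (0 : ℝ)).mul_const (deriv κ q.1)).const_add 1
    have h4 := HasDerivAt.comp (h₂ := fun x => rectDirDeriv (1, 0) u (x, q.2)) (0 : ℝ)
      (by simpa using h1) h2
    have h5 := h3.mul h4
    have h6 := (hasDerivAt_iff_tendsto_slope.1 h5).comp hlim0
    have h7 : deriv κ q.1 * ((fun x => rectDirDeriv (1, 0) u (x, q.2)) ∘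
        fun θ => q.1 + θ * κ q.1) 0 + (1 + 0 * deriv κ q.1) * (dX (rectDirDeriv (1, 0) u) q *
          κ q.1) = L q := by
      simp only [Function.comp, zero_mul, add_zero, one_mul, hL]
      ring
    rw [h7] at h6
    refine h6.congr fun n => ?_
    rw [rectDirDeriv_diffQuot (hκ.isStretch hA (hpos n).le (hle n)).1 hucd hq]
    simp [slope, Function.comp]
  -- Fatou: the uniform `L²` bound on the quotients passes to their pointwise limit.
  have hLm : MemLp L 2 (rectMeasure t) := by
    refine ⟨aestronglyMeasurable_of_tendsto_ae atTop
      (fun n => (hD (h n) (hpos n) (hle n)).1.1) hpt, ?_⟩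
    refine (Lp.eLpNorm_lim_le_liminf_eLpNorm (fun n => (hD (h n) (hpos n) (hle n)).1.1) L
      hpt).trans_lt ?_
    refine lt_of_le_of_lt (liminf_le_of_le (by isBoundedDefault) (a := ENNReal.ofReal (Real.sqrt D))
      fun b hb => ?_) ENNReal.ofReal_lt_top
    obtain ⟨n, hn⟩ := hb.exists
    refine hn.trans ?_
    obtain ⟨m1, m2⟩ := hD (h n) (hpos n) (hle n)
    rw [eLpNorm_two_eq m1]
    exact ENNReal.ofReal_le_ofReal (Real.sqrt_le_sqrt m2)
  have hκ' : MemLp (fun q => deriv κ q.1 * rectDirDeriv (1, 0) u q) 2 (rectMeasure t) :=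
    memLp_bdd_mul hux (hκ.deriv.smooth.continuous.comp continuous_fst).aestronglyMeasurable
      fun q => hA q.1
  refine (memLp_congr_ae (ae_of_all _ fun q => ?_)).1 (hLm.sub hκ')
  simp [hL]

end PartiallyRectangularDomain

/-! ### The stretching maps of a profile -/

lemma IsStretch.comp {a b c : ℝ} {J r J' r' : ℝ → ℝ} (hJ : IsStretch a b J r)
    (hJ' : IsStretch b c J' r') : IsStretch a c (fun x => J' (J x)) (fun x => r' (J x) * r x) := by
  obtain ⟨η, h0, h0', h1, h2⟩ := hJ.ends
  obtain ⟨η', k0, k0', k1, k2⟩ := hJ'.ends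
  have e1 := min_le_left η η'
  have e2 := min_le_right η η'
  refine ⟨hJ'.smooth.comp hJ.smooth, fun x => (hJ'.hasDerivAt (J x)).comp x (hJ.hasDerivAt x),
    fun x => mul_pos (hJ'.pos _) (hJ.pos _), min η η', lt_min h0 k0, e1.trans_lt h0',
    fun x hx => ?_, fun x hx => ?_⟩
  · rw [h1 x (by linarith), k1 _ (by linarith)]
    ring
  · rw [h2 x (by linarith), k2 _ (by linarith)]
    ring

namespace IsProfile

variable {φ : ℝ → ℝ}

lemma isCutoff (hφ : IsProfile φ) : IsCutoff 1 φ := by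
  have hs : tsupport φ ⊆ xRange 1 := by simpa [xRange] using hφ.support
  exact ⟨hφ.smooth, (isCompact_Icc.of_isClosed_subset (isClosed_tsupport φ)
    (hφ.support.trans Ioo_subset_Icc_self)), hs⟩

lemma density_ge_one (hφ : IsProfile φ) {t : ℝ} (ht : 1 ≤ t) (x : ℝ) : 1 ≤ 1 + (t - 1) * φ x := by
  have := mul_nonneg (sub_nonneg.2 ht) (hφ.nonneg x)
  linarith

lemma integral_profile_of_le {η : ℝ}
    (hη : ∀ x, Real.pi / 2 - η ≤ |x| → φ x = 0) {x : ℝ} (hx : x ≤ -(Real.pi / 2 - η))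
    (hη0 : 0 < η) : ∫ s in (-(Real.pi / 2))..x, φ s = 0 := by
  refine (intervalIntegral.integral_congr fun s hs => ?_).trans intervalIntegral.integral_zero
  have : s ≤ -(Real.pi / 2 - η) := (mem_uIcc.1 hs).elim (fun h => h.2.trans hx)
    fun h => h.2.trans (by linarith)
  exact hη s (by linarith [neg_le_abs s])

lemma integral_profile_of_ge (hφ : IsProfile φ) {η : ℝ}
    (hη : ∀ x, Real.pi / 2 - η ≤ |x| → φ x = 0) {x : ℝ} (hx : Real.pi / 2 - η ≤ x)
    (hη0 : 0 < η) (hη1 : η < Real.pi / 2) : ∫ s in (-(Real.pi / 2))..x, φ s = Real.pi := by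
  have hle : -(Real.pi / 2) ≤ x := by linarith
  refine Eq.trans ?_ hφ.integral
  rw [intervalIntegral.integral_of_le hle]
  refine setIntegral_eq_integral_of_forall_compl_eq_zero fun s hs => ?_
  rw [mem_Ioc, not_and_or] at hs
  rcases hs with h | h
  · exact hη s (by linarith [neg_le_abs s])
  · exact hη s (by linarith [le_abs_self s])

lemma stretch_eq (hφ : IsProfile φ) (t x : ℝ) : stretch φ t x =
    -(t * (Real.pi / 2)) + (x + Real.pi / 2) + (t - 1) * ∫ s in (-(Real.pi / 2))..x, φ s := by
  have hi := hφ.smooth.continuous.intervalIntegrable (μ := volume) (-(Real.pi / 2)) x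
  rw [stretch, intervalIntegral.integral_add intervalIntegrable_const (hi.const_mul _),
    intervalIntegral.integral_const_mul, intervalIntegral.integral_const, smul_eq_mul]
  ring

/-- To the left of the support the integral of `φ` vanishes, and to the right it equals `π`. The
normalization is what makes both ends translate by the right amount. -/
lemma isStretch (hφ : IsProfile φ) {t : ℝ} (ht : 1 ≤ t) :
    IsStretch 1 t (stretch φ t) (fun x => 1 + (t - 1) * φ x) := by
  have hc : ContDiff ℝ ∞ fun x => 1 + (t - 1) * φ x :=
    contDiff_const.add (contDiff_const.mul hφ.smooth)
  have hd : ∀ x, HasDerivAt (stretch φ t) (1 + (t - 1) * φ x) x := fun x =>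
    (intervalIntegral.integral_hasDerivAt_right (hc.continuous.intervalIntegrable _ _)
      (hc.continuous.stronglyMeasurableAtFilter _ _) hc.continuous.continuousAt).const_add _
  obtain ⟨η, h0, h1, h2⟩ := hφ.isCutoff.exists_ends
  rw [one_mul] at h2
  refine ⟨?_, hd, fun x => by linarith [hφ.density_ge_one ht x], η, h0, h1, fun x hx => ?_,
    fun x hx => ?_⟩
  · rw [contDiff_infty_iff_deriv]
    exact ⟨fun x => (hd x).differentiableAt, by rwa [funext fun x => (hd x).deriv]⟩
  · rw [hφ.stretch_eq, hφ.integral_profile_of_ge h2 (by linarith) h0 h1]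
    ring
  · rw [hφ.stretch_eq, integral_profile_of_le h2 (by linarith) h0]
    ring

/-- The function `φ_t` of the coordinate `x`, and its first two derivatives. -/
lemma exists_stretched (hφ : IsProfile φ) {t : ℝ} (ht : 1 ≤ t) :
    ∃ K ψ : ℝ → ℝ, IsCutoff t ψ ∧ (∀ x, 0 ≤ ψ x) ∧ (∀ q, stretchedProfile φ t q = ψ q.1) ∧
      (∀ x, K (stretch φ t x) = x) ∧
      (∀ s, 1 ≤ s → IsStretch t s (fun x => stretch φ s (K x)) (fun x => 1 + (s - t) * ψ x)) ∧
      ∀ x, deriv (deriv ψ) x = deriv (deriv φ) (K x) / (1 + (t - 1) * φ (K x)) ^ 4 -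
        3 * (t - 1) * deriv φ (K x) ^ 2 / (1 + (t - 1) * φ (K x)) ^ 5 := by
  have hI := hφ.isStretch ht
  obtain ⟨K, hK, hKI, hIK⟩ := hI.exists_inverse
  have hinv : ∀ x, Function.invFun (stretch φ t) x = K x := fun x => by
    conv_lhs => rw [← hIK x]
    exact Function.leftInverse_invFun hI.strictMono.injective (K x)
  have hne : ∀ x, 1 + (t - 1) * φ x ≠ 0 := fun x => (hI.pos x).ne'
  set ψ : ℝ → ℝ := fun x => φ (K x) / (1 + (t - 1) * φ (K x)) with hψ
  have hφd : ∀ x, HasDerivAt φ (deriv φ x) x := hφ.isCutoff.hasDerivAt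
  have hφdd : ∀ x, HasDerivAt (deriv φ) (deriv (deriv φ) x) x := hφ.isCutoff.deriv.hasDerivAt
  have hd1 : ∀ x, HasDerivAt ψ (deriv φ (K x) / (1 + (t - 1) * φ (K x)) ^ 3) x := fun x => by
    have h1 := (hφd (K x)).div (((hφd (K x)).const_mul (t - 1)).const_add 1) (hne _)
    have h2 := h1.comp x (hK.hasDerivAt x)
    refine h2.congr_deriv ?_
    have := hne (K x)
    field_simp
    ring
  have hd1' : deriv ψ = fun x => deriv φ (K x) / (1 + (t - 1) * φ (K x)) ^ 3 :=
    funext fun x => (hd1 x).deriv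
  have hd2 : ∀ x, HasDerivAt (deriv ψ) (deriv (deriv φ) (K x) / (1 + (t - 1) * φ (K x)) ^ 4 -
        3 * (t - 1) * deriv φ (K x) ^ 2 / (1 + (t - 1) * φ (K x)) ^ 5) x := fun x => by
    rw [hd1']
    have h1 := (hφdd (K x)).div ((((hφd (K x)).const_mul (t - 1)).const_add 1).pow 3)
      (pow_ne_zero 3 (hne _))
    have h2 := h1.comp x (hK.hasDerivAt x)
    refine h2.congr_deriv ?_
    have := hne (K x)
    simp only [Pi.pow_apply]
    field_simp
    push_cast
    ring
  refine ⟨K, ψ, ⟨?_, ?_, ?_⟩, fun x => div_nonneg (hφ.nonneg _) (hI.pos _).le, fun q => ?_, hKI,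
    fun s hs => ?_, fun x => (hd2 x).deriv⟩
  · have h1 := hφ.smooth.comp hK.smooth
    exact h1.div (contDiff_const.add (contDiff_const.mul h1)) fun x => hne _
  · refine HasCompactSupport.intro (hφ.isCutoff.compact.isCompact.image hI.smooth.continuous)
      fun x hx => ?_
    have : φ (K x) = 0 := image_eq_zero_of_notMem_tsupport fun h => hx ⟨K x, h, hIK x⟩
    simp [hψ, this]
  · have hcl : IsClosed (stretch φ t '' tsupport φ) :=
      (hφ.isCutoff.compact.isCompact.image hI.smooth.continuous).isClosed
    refine (closure_minimal (fun x hx => ?_) hcl).trans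
      ((image_mono hφ.isCutoff.subset).trans hI.image_xRange.subset)
    refine ⟨K x, subset_tsupport φ fun h => hx ?_, hIK x⟩
    simp [hψ, h]
  · simp only [stretchedProfile, hinv, hψ]
  · have h1 := hK.comp (hφ.isStretch hs)
    -- The Jacobian of `I_s ∘ I_t⁻¹` is the quotient of the densities for `s` and `t`, which is
    -- affine in `s` with slope `φ_t`.
    have e : (fun x => (1 + (s - 1) * φ (K x)) * (1 + (t - 1) * φ (K x))⁻¹) =
        fun x => 1 + (s - t) * ψ x := funext fun x => by
      have e1 : 1 + (s - 1) * φ (K x) = 1 + (t - 1) * φ (K x) + (s - t) * φ (K x) := by ring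
      simp only [hψ]
      rw [e1, add_mul, mul_inv_cancel₀ (hne (K x))]
      ring
    rwa [e] at h1

end IsProfile

/-! ### Continuity of the transplanted eigenfunctions -/

namespace PartiallyRectangularDomain

variable {M : Type*} [TopologicalSpace M] [T2Space M] [SecondCountableTopology M]
  [ChartedSpace (EuclideanSpace ℝ (Fin 2)) M]
  [IsManifold (𝓡 2) ∞ M] [MeasurableSpace M] [BorelSpace M]
variable {X : PartiallyRectangularDomain M} {φ : ℝ → ℝ} {a b t : ℝ} {u : ℝ → M ⊕ ℝ × ℝ → ℝ}

lemma stretchIsometry_eq (φ : ℝ → ℝ) (t : ℝ) :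
    stretchIsometry M φ t = stretchMap M (stretch φ t) := rfl

lemma stretchDensity_eq (φ : ℝ → ℝ) (t : ℝ) :
    stretchDensity M φ t = endWeight M fun x => 1 + (t - 1) * φ x := rfl

lemma abs_sqrt_div_sub_one_le {x : ℝ} (hx : 0 ≤ x) : |Real.sqrt x - 1| ≤ |x - 1| := by
  have h1 : x - 1 = (Real.sqrt x - 1) * (Real.sqrt x + 1) := by
    nlinarith [Real.sq_sqrt hx]
  rw [h1, abs_mul]
  refine le_mul_of_one_le_right (abs_nonneg _) ?_
  rw [abs_of_nonneg (by positivity)]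
  linarith [Real.sqrt_nonneg x]

/-- Pulled back isometrically to `X_1`, the difference becomes `√(ρ_t/ρ_s) v(s) - v(t)`, where `ρ`
denotes the stretch density. It tends to zero because `v` is continuous and the factor tends to `1`
uniformly. Nothing beyond continuity of the family is used. -/
lemma tendsto_transport_of_dependsSmoothly (hφ : IsProfile φ) (ha : 1 ≤ a)
    (hu : DependsSmoothly X φ a b u) (ht : t ∈ Icc a b) {K : ℝ → ℝ}
    (hK : ∀ x, K (stretch φ t x) = x) :
    Tendsto (fun s => eLpNorm (transport (fun _ => 1) (fun x => stretch φ s (K x)) (u s) - u t) 2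
      (X.vol t)) (𝓝[Icc a b] t) (𝓝 0) := by
  obtain ⟨v, hv, hvu⟩ := hu
  obtain ⟨B, hB0, hB⟩ := hφ.isCutoff.exists_bound
  have hvc : Tendsto v (𝓝[Icc a b] t) (𝓝 (v t)) := hv.continuousOn t ht
  have h1 : Tendsto (fun s => eLpNorm (⇑(v s) - ⇑(v t)) 2 (X.vol 1)) (𝓝[Icc a b] t) (𝓝 0) :=
    (Lp.tendsto_Lp_iff_tendsto_eLpNorm' v (v t)).1 hvc
  have h2 : Tendsto (fun s => ENNReal.ofReal (|t - s| * B) * eLpNorm (v s) 2 (X.vol 1))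
      (𝓝[Icc a b] t) (𝓝 0) := by
    have e1 : Tendsto (fun s => ENNReal.ofReal (|t - s| * B)) (𝓝[Icc a b] t) (𝓝 0) := by
      have : Continuous fun s => |t - s| * B := by fun_prop
      have h := ENNReal.tendsto_ofReal (this.tendsto t)
      simp only [sub_self, abs_zero, zero_mul, ENNReal.ofReal_zero] at h
      exact h.mono_left nhdsWithin_le_nhds
    have e2 : Tendsto (fun s => eLpNorm (v s) 2 (X.vol 1)) (𝓝[Icc a b] t)
        (𝓝 (eLpNorm (v t) 2 (X.vol 1))) := by
      simp only [← Lp.enorm_def]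
      exact hvc.enorm
    have := ENNReal.Tendsto.mul e1 (Or.inr (Lp.eLpNorm_ne_top (v t))) e2
      (Or.inr ENNReal.zero_ne_top)
    simpa using this
  have h3 := h1.add h2
  rw [add_zero] at h3
  refine tendsto_of_tendsto_of_tendsto_of_le_of_le' tendsto_const_nhds h3
    (Eventually.of_forall fun _ => zero_le) ?_
  filter_upwards [self_mem_nhdsWithin] with s hs
  have hs1 : 1 ≤ s := ha.trans hs.1
  have ht1 : 1 ≤ t := ha.trans ht.1
  rw [← (X.isDensityMap_vol (hφ.isStretch ht1).isDensityMap).eLpNorm_eq]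
  have hpos : ∀ {s : ℝ}, 1 ≤ s → ∀ z, 1 ≤ stretchDensity M φ s z := fun {s} hs z => by
    rcases z with p | q
    · exact le_rfl
    · exact hφ.density_ge_one hs q.1
  set m : M ⊕ ℝ × ℝ → ℝ := fun z =>
    Real.sqrt (stretchDensity M φ t z / stretchDensity M φ s z) - 1 with hm
  have hmb : ∀ z, |m z| ≤ |t - s| * B := fun z => by
    have hp := hpos hs1 z
    refine (abs_sqrt_div_sub_one_le (div_nonneg (zero_le_one.trans (hpos ht1 z))
      (zero_le_one.trans hp))).trans ?_
    rw [div_sub_one (by positivity), abs_div, abs_of_pos (by linarith : 0 < stretchDensity M φ s z)]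
    refine (div_le_self (abs_nonneg _) hp).trans ?_
    rcases z with p | q
    · simp [stretchDensity]
      positivity
    · have e : stretchDensity M φ t (Sum.inr q) - stretchDensity M φ s (Sum.inr q) =
          (t - s) * φ q.1 := by
        simp only [stretchDensity, Sum.elim_inr]; ring
      rw [e, abs_mul]
      exact mul_le_mul_of_nonneg_left (hB _) (abs_nonneg _)
  have hmm : Measurable m := by
    have hd : ∀ s, Measurable (stretchDensity M φ s) := fun s =>
      measurable_endWeight (continuous_const.add
        (continuous_const.mul hφ.smooth.continuous)).measurable
    exact ((hd t).div (hd s)).sqrt.sub_const 1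
  have hae : (fun z => Real.sqrt (endWeight M (fun x => 1 + (t - 1) * φ x) z) *
      (transport (fun _ => 1) (fun x => stretch φ s (K x)) (u s) - u t)
        (stretchMap M (stretch φ t) z)) =ᵐ[X.vol 1]
      (⇑(v s) - ⇑(v t)) + fun z => m z * v s z := by
    filter_upwards [hvu s hs, hvu t ht] with z e1 e2
    have e3 : transport (fun _ => 1) (fun x => stretch φ s (K x)) (u s)
        (stretchMap M (stretch φ t) z) = u s (stretchIsometry M φ s z) := by
      rcases z with p | q
      · simp [transport, stretchMap, stretchIsometry]
      · simp [transport, stretchMap, stretchIsometry, hK]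
    have e4 : Real.sqrt (stretchDensity M φ t z / stretchDensity M φ s z) *
        Real.sqrt (stretchDensity M φ s z) = Real.sqrt (stretchDensity M φ t z) := by
      have hp := hpos hs1 z
      rw [← Real.sqrt_mul (div_nonneg (zero_le_one.trans (hpos ht1 z)) (zero_le_one.trans hp)),
        div_mul_cancel₀ _ (by positivity)]
    rw [← stretchIsometry_eq] at e3
    simp only [Pi.add_apply, Pi.sub_apply, e1, e2, e3, hm, ← stretchDensity_eq,
      ← stretchIsometry_eq]
    rw [← e4]
    ring
  rw [eLpNorm_congr_ae hae]
  have hmv : AEStronglyMeasurable (fun z => m z * v s z) (X.vol 1) :=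
    hmm.aestronglyMeasurable.mul (Lp.memLp (v s)).1
  refine (eLpNorm_add_le ((Lp.memLp (v s)).sub (Lp.memLp (v t))).1 hmv (by norm_num)).trans ?_
  gcongr
  refine eLpNorm_le_mul_eLpNorm_of_ae_le_mul (ae_of_all _ fun z => ?_) 2
  rw [norm_mul]
  exact mul_le_mul_of_nonneg_right (hmb z) (norm_nonneg _)

end PartiallyRectangularDomain

/-! ### `L²` limits along general filters. -/

lemma tendsto_integral_mul_of_eventually {α ι : Type*} [MeasurableSpace α] {μ : Measure α}
    {l : Filter ι} {F G : ι → α → ℝ} {F₀ G₀ : α → ℝ}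
    (hF : ∀ᶠ n in l, MemLp (F n) 2 μ) (hG : ∀ᶠ n in l, MemLp (G n) 2 μ) (hF₀ : MemLp F₀ 2 μ)
    (hG₀ : MemLp G₀ 2 μ) (h1 : Tendsto (fun n => eLpNorm (F n - F₀) 2 μ) l (𝓝 0))
    (h2 : Tendsto (fun n => eLpNorm (G n - G₀) 2 μ) l (𝓝 0)) :
    Tendsto (fun n => ∫ z, F n z * G n z ∂μ) l (𝓝 (∫ z, F₀ z * G₀ z ∂μ)) := by
  classical
  set F' : ι → α → ℝ := fun n => if MemLp (F n) 2 μ then F n else F₀ with hF'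
  set G' : ι → α → ℝ := fun n => if MemLp (G n) 2 μ then G n else G₀ with hG'
  have e1 : F' =ᶠ[l] F := by filter_upwards [hF] with n hn using if_pos hn
  have e2 : G' =ᶠ[l] G := by filter_upwards [hG] with n hn using if_pos hn
  have m1 : ∀ n, MemLp (F' n) 2 μ := fun n => by
    by_cases h : MemLp (F n) 2 μ <;> simp [hF', h, hF₀]
  have m2 : ∀ n, MemLp (G' n) 2 μ := fun n => by
    by_cases h : MemLp (G n) 2 μ <;> simp [hG', h, hG₀]
  refine (tendsto_integral_mul m1 m2 hF₀ hG₀ (h1.congr' ?_) (h2.congr' ?_)).congr' ?_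
  · filter_upwards [e1] with n hn using by rw [hn]
  · filter_upwards [e2] with n hn using by rw [hn]
  · filter_upwards [e1, e2] with n hn hn' using by rw [hn, hn']

lemma tendsto_eLpNorm_sub_of_dominated {α ι : Type*} [MeasurableSpace α] {μ : Measure α}
    {l : Filter ι} [l.IsCountablyGenerated] {F : ι → α → ℝ} {G B : α → ℝ}
    (hF : ∀ᶠ n in l, AEStronglyMeasurable (F n) μ) (hG : AEStronglyMeasurable G μ)
    (hB : MemLp B 2 μ) (hFB : ∀ᶠ n in l, ∀ᵐ z ∂μ, |F n z| ≤ B z) (hGB : ∀ᵐ z ∂μ, |G z| ≤ B z)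
    (hlim : ∀ᵐ z ∂μ, Tendsto (fun n => F n z) l (𝓝 (G z))) :
    Tendsto (fun n => eLpNorm (F n - G) 2 μ) l (𝓝 0) := by
  have h1 : Tendsto (fun n => ∫⁻ z, ENNReal.ofReal ((F n - G) z ^ 2) ∂μ) l
      (𝓝 (∫⁻ _, 0 ∂μ)) := by
    have hB2 := ((hB.const_mul 2).integrable_sq).lintegral_lt_top
    refine tendsto_lintegral_filter_of_dominated_convergence' _ ?_ ?_ hB2.ne ?_
    · filter_upwards [hF] with n hn
      exact ((hn.sub hG).pow 2).aemeasurable.ennreal_ofReal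
    · filter_upwards [hFB] with n hn
      filter_upwards [hn, hGB] with z h1 h2
      refine ENNReal.ofReal_le_ofReal (sq_le_sq.2 ?_)
      have := abs_sub (F n z) (G z)
      simp only [Pi.sub_apply]
      exact (this.trans (by linarith)).trans (le_abs_self _)
    · filter_upwards [hlim] with z hz
      have := ENNReal.tendsto_ofReal ((hz.sub_const (G z)).pow 2)
      simpa using this
  rw [lintegral_zero] at h1
  have h2 := (ENNReal.continuous_rpow_const (y := (1 / 2 : ℝ))).tendsto 0 |>.comp h1
  simp only [ENNReal.zero_rpow_of_pos (by norm_num : (0 : ℝ) < 1 / 2)] at h2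
  exact h2.congr fun n => (IsDensityMap.eLpNorm_sq_eq _).symm

/-! ### Variation of the eigenvalue -/

/-- The derivative of the flux along `x`, divided by `τ`, for the stretching `1 + τ ψ`. -/
def fluxDeriv {M : Type*} (ψ : ℝ → ℝ) (u : M ⊕ ℝ × ℝ → ℝ) (τ : ℝ) (q : ℝ × ℝ) : ℝ :=
  -(2 + τ * ψ q.1) * (1 + τ * ψ q.1)⁻¹ ^ 2 *
      (ψ q.1 * dX (PartiallyRectangularDomain.rectDirDeriv (1, 0) u) q) +
    (-(2 * deriv ψ q.1 + 2 * τ * ψ q.1 * deriv ψ q.1) * (1 + τ * ψ q.1)⁻¹ ^ 2 +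
        2 * τ * deriv ψ q.1 * (2 * ψ q.1 + τ * ψ q.1 ^ 2) * (1 + τ * ψ q.1)⁻¹ ^ 3 -
        deriv ψ q.1 * (1 + τ * ψ q.1)⁻¹ ^ 3) *
      PartiallyRectangularDomain.rectDirDeriv (1, 0) u q -
    (deriv (deriv ψ) q.1 * (1 + τ * ψ q.1)⁻¹ ^ 3 -
        3 * τ * deriv ψ q.1 ^ 2 * (1 + τ * ψ q.1)⁻¹ ^ 4) * u (Sum.inr q)

namespace PartiallyRectangularDomain

variable {M : Type*} [TopologicalSpace M] [T2Space M] [SecondCountableTopology M]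
  [ChartedSpace (EuclideanSpace ℝ (Fin 2)) M]
  [IsManifold (𝓡 2) ∞ M] [MeasurableSpace M] [BorelSpace M]
variable {X : PartiallyRectangularDomain M} {t s : ℝ} {ψ J : ℝ → ℝ} {u v : M ⊕ ℝ × ℝ → ℝ}
  {bc : BoundaryCondition} {E E' : ℝ}

/-- The factor `τ` is split off algebraically, so that `fluxDeriv` makes sense at `τ = 0` and is
continuous in `τ` there. This replaces a difference quotient of the flux in `τ`. -/
lemma hasDerivAt_stretchFlux (hψ : IsCutoff t ψ)
    (hu : ContDiffOn ℝ ∞ (fun q => u (Sum.inr q))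
      (xRange t ×ˢ Ioo (-(Real.pi / 2)) (Real.pi / 2))) {τ : ℝ} (hτ : ∀ x, 1 + τ * ψ x ≠ 0)
    {q : ℝ × ℝ} (hq : q ∈ xRange t ×ˢ Ioo (-(Real.pi / 2)) (Real.pi / 2)) :
    HasDerivAt (fun x => stretchFlux (fun x => 1 + τ * ψ x) u (x, q.2)) (τ * fluxDeriv ψ u τ q)
      q.1 := by
  have hr : ∀ x, HasDerivAt (fun x => 1 + τ * ψ x) (τ * deriv ψ x) x := fun x =>
    ((hψ.hasDerivAt x).const_mul τ).const_add 1
  have hr' : deriv (fun x => 1 + τ * ψ x) = fun x => τ * deriv ψ x := funext fun x => (hr x).deriv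
  have h0 := hasDerivAt_rectDirDeriv (u := u)
    ((hu.contDiffAt ((isOpen_rect t).mem_nhds hq)).differentiableAt (by simp))
  have h1 := hasDerivAt_dX (contDiffOn_rectDirDeriv hu (1, 0)) hq
  have hi := (hr q.1).inv (hτ q.1)
  have h2 := (((hi.pow 2).sub_const 1).mul h1).sub
    ((((hψ.deriv.hasDerivAt q.1).const_mul τ).mul (hi.pow 3)).mul h0)
  unfold stretchFlux
  rw [hr']
  refine h2.congr_deriv ?_
  have := hτ q.1
  simp only [fluxDeriv, Pi.pow_apply, Pi.inv_apply, Pi.mul_apply]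
  generalize dX (rectDirDeriv (1, 0) u) q = u2
  generalize rectDirDeriv (1, 0) u q = u1
  generalize u (Sum.inr q) = u0
  generalize deriv (deriv ψ) q.1 = c
  generalize deriv ψ q.1 = b
  generalize ψ q.1 = a at *
  push_cast
  field_simp
  ring

lemma fluxDeriv_zero (ψ : ℝ → ℝ) (u : M ⊕ ℝ × ℝ → ℝ) (q : ℝ × ℝ) :
    fluxDeriv ψ u 0 q = -2 * (ψ q.1 * dX (rectDirDeriv (1, 0) u) q) -
      3 * deriv ψ q.1 * rectDirDeriv (1, 0) u q - deriv (deriv ψ) q.1 * u (Sum.inr q) := by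
  simp only [fluxDeriv, zero_mul, mul_zero, add_zero, inv_one, one_pow, mul_one, sub_zero]
  ring

lemma continuousOn_dX {F : ℝ × ℝ → ℝ}
    (hF : ContDiffOn ℝ ∞ F (xRange t ×ˢ Ioo (-(Real.pi / 2)) (Real.pi / 2))) :
    ContinuousOn (dX F) (xRange t ×ˢ Ioo (-(Real.pi / 2)) (Real.pi / 2)) := by
  have h1 : ContinuousOn (fun q => fderiv ℝ F q (1, 0))
      (xRange t ×ˢ Ioo (-(Real.pi / 2)) (Real.pi / 2)) :=
    (hF.continuousOn_fderiv_of_isOpen (isOpen_rect t) (by simp)).clm_apply continuousOn_const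
  refine h1.congr fun q hq => ?_
  have h2 : HasDerivAt (fun x : ℝ => (x, q.2)) ((1, 0) : ℝ × ℝ) q.1 :=
    (hasDerivAt_id q.1).prodMk (hasDerivAt_const q.1 q.2)
  exact (((hF.contDiffAt ((isOpen_rect t).mem_nhds hq)).differentiableAt
    (by simp)).hasFDerivAt.comp_hasDerivAt q.1 h2).deriv

/-- The second derivative of `u` enters only in the combination `ψ ∂ₓ²u`, the one known to be square
integrable. The remaining coefficients are continuous on the compact set `[-δ, δ] × tsupport ψ` and
multiply terms that vanish off it; `δ` is chosen so that `|τψ| ≤ 1/2`. -/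
lemma exists_fluxDeriv_bound (hψ : IsCutoff t ψ) : ∃ δ D : ℝ, 0 < δ ∧
    (∀ τ, |τ| ≤ δ → ∀ x, 1 / 2 ≤ 1 + τ * ψ x) ∧
    ∀ (u : M ⊕ ℝ × ℝ → ℝ) (τ : ℝ), |τ| ≤ δ → ∀ q, |fluxDeriv ψ u τ q| ≤
      D * (|ψ q.1 * dX (rectDirDeriv (1, 0) u) q| + |rectDirDeriv (1, 0) u q| +
        |u (Sum.inr q)|) := by
  obtain ⟨A, hA0, hA⟩ := hψ.exists_bound
  set δ := 1 / (2 * (A + 1)) with hδ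
  have hδ0 : 0 < δ := by positivity
  have hr : ∀ τ, |τ| ≤ δ → ∀ x, 1 / 2 ≤ 1 + τ * ψ x := fun τ hτ x => by
    have h1 : |τ * ψ x| ≤ 1 / 2 := by
      rw [abs_mul]
      calc |τ| * |ψ x| ≤ δ * (A + 1) := by
            gcongr
            exact (hA x).trans (by linarith)
        _ = 1 / 2 := by rw [hδ]; field_simp
    linarith [(abs_le.1 h1).1]
  set S := Icc (-δ) δ ×ˢ tsupport ψ with hS
  have hSc : IsCompact S := isCompact_Icc.prod hψ.compact.isCompact
  have hψc := hψ.smooth.continuous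
  have hψ1 := hψ.deriv.smooth.continuous
  have hψ2 := hψ.deriv.deriv.smooth.continuous
  have hi : ContinuousOn (fun z : ℝ × ℝ => (1 + z.1 * ψ z.2)⁻¹) S :=
    ContinuousOn.inv₀ (by fun_prop) fun z hz => by
      linarith [hr z.1 (abs_le.2 hz.1) z.2]
  obtain ⟨D₁, h1⟩ := hSc.exists_bound_of_continuousOn
    (f := fun z : ℝ × ℝ => -(2 + z.1 * ψ z.2) * (1 + z.1 * ψ z.2)⁻¹ ^ 2)
    (ContinuousOn.mul (by fun_prop) (hi.pow 2))
  obtain ⟨D₂, h2⟩ := hSc.exists_bound_of_continuousOn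
    (f := fun z : ℝ × ℝ => -(2 * deriv ψ z.2 + 2 * z.1 * ψ z.2 * deriv ψ z.2) *
        (1 + z.1 * ψ z.2)⁻¹ ^ 2 +
      2 * z.1 * deriv ψ z.2 * (2 * ψ z.2 + z.1 * ψ z.2 ^ 2) * (1 + z.1 * ψ z.2)⁻¹ ^ 3 -
        deriv ψ z.2 * (1 + z.1 * ψ z.2)⁻¹ ^ 3)
    (((ContinuousOn.mul (by fun_prop) (hi.pow 2)).add
      (ContinuousOn.mul (by fun_prop) (hi.pow 3))).sub
      (ContinuousOn.mul (by fun_prop) (hi.pow 3)))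
  obtain ⟨D₃, h3⟩ := hSc.exists_bound_of_continuousOn
    (f := fun z : ℝ × ℝ => deriv (deriv ψ) z.2 * (1 + z.1 * ψ z.2)⁻¹ ^ 3 -
        3 * z.1 * deriv ψ z.2 ^ 2 * (1 + z.1 * ψ z.2)⁻¹ ^ 4)
    ((ContinuousOn.mul (by fun_prop) (hi.pow 3)).sub
      (ContinuousOn.mul (by fun_prop) (hi.pow 4)))
  set D := max 0 (max D₁ (max D₂ D₃)) with hD
  have d0 : 0 ≤ D := le_max_left _ _
  have d1 : D₁ ≤ D := (le_max_left _ _).trans (le_max_right _ _)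
  have d2 : D₂ ≤ D := ((le_max_left _ _).trans (le_max_right _ _)).trans (le_max_right _ _)
  have d3 : D₃ ≤ D := ((le_max_right _ _).trans (le_max_right _ _)).trans (le_max_right _ _)
  refine ⟨δ, D, hδ0, hr, fun u τ hτ q => ?_⟩
  by_cases hq : q.1 ∈ tsupport ψ
  · have hz : (τ, q.1) ∈ S := ⟨abs_le.1 hτ, hq⟩
    have e1 := (h1 _ hz).trans d1
    have e2 := (h2 _ hz).trans d2
    have e3 := (h3 _ hz).trans d3
    simp only [Real.norm_eq_abs] at e1 e2 e3
    rw [fluxDeriv, mul_add D, mul_add D]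
    refine (abs_sub _ _).trans (add_le_add ((abs_add_le _ _).trans (add_le_add ?_ ?_)) ?_)
    · rw [abs_mul]; gcongr
    · rw [abs_mul]; gcongr
    · rw [abs_mul]; gcongr
  · have z0 : ψ q.1 = 0 := image_eq_zero_of_notMem_tsupport hq
    have z1 : deriv ψ q.1 = 0 :=
      image_eq_zero_of_notMem_tsupport fun h => hq (tsupport_deriv_subset h)
    have z2 : deriv (deriv ψ) q.1 = 0 := image_eq_zero_of_notMem_tsupport fun h =>
      hq (tsupport_deriv_subset (tsupport_deriv_subset h))
    have : fluxDeriv ψ u τ q = 0 := by simp [fluxDeriv, z0, z1, z2]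
    rw [this, abs_zero]
    positivity

lemma IsEigenfunction.memLp_fluxDeriv_majorant (ht : 1 ≤ t) (hu : X.IsEigenfunction t bc u E)
    (hψ : IsCutoff t ψ) (D : ℝ) :
    MemLp (fun q => D * (|ψ q.1 * dX (rectDirDeriv (1, 0) u) q| + |rectDirDeriv (1, 0) u q| +
        |u (Sum.inr q)|)) 2 (rectMeasure t) :=
  ((((hu.memLp_dX_rectDirDeriv ht hψ).abs).add ((hu.memLp_rectDirDeriv ht).abs)).add
    ((memLp_inr hu.memLp).abs)).const_mul D

lemma continuousOn_fluxDeriv (hψ : IsCutoff t ψ)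
    (hu : ContDiffOn ℝ ∞ (fun q => u (Sum.inr q))
      (xRange t ×ˢ Ioo (-(Real.pi / 2)) (Real.pi / 2))) {τ : ℝ} (hτ : ∀ x, 1 + τ * ψ x ≠ 0) :
    ContinuousOn (fluxDeriv ψ u τ) (xRange t ×ˢ Ioo (-(Real.pi / 2)) (Real.pi / 2)) := by
  have hψc := hψ.smooth.continuous
  have hψ1 := hψ.deriv.smooth.continuous
  have hψ2 := hψ.deriv.deriv.smooth.continuous
  have hi : Continuous fun q : ℝ × ℝ => (1 + τ * ψ q.1)⁻¹ :=
    Continuous.inv₀ (by fun_prop) fun q => hτ q.1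
  have c0 := hu.continuousOn
  have c1 := continuousOn_rectDirDeriv hu (1, 0)
  have c2 := continuousOn_dX (contDiffOn_rectDirDeriv hu (1, 0))
  unfold fluxDeriv
  refine ((ContinuousOn.mul ?_ (ContinuousOn.mul (by fun_prop) c2)).add
    (ContinuousOn.mul ?_ c1)).sub (ContinuousOn.mul ?_ c0)
  · exact ((by fun_prop : Continuous fun q : ℝ × ℝ => -(2 + τ * ψ q.1)).mul (hi.pow 2)).continuousOn
  · exact ((((by fun_prop : Continuous fun q : ℝ × ℝ => -(2 * deriv ψ q.1 +
        2 * τ * ψ q.1 * deriv ψ q.1)).mul (hi.pow 2)).add ((by fun_prop : Continuous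
        fun q : ℝ × ℝ => 2 * τ * deriv ψ q.1 * (2 * ψ q.1 + τ * ψ q.1 ^ 2)).mul (hi.pow 3))).sub
        ((by fun_prop : Continuous fun q : ℝ × ℝ => deriv ψ q.1).mul (hi.pow 3))).continuousOn
  · exact (((by fun_prop : Continuous fun q : ℝ × ℝ => deriv (deriv ψ) q.1).mul (hi.pow 3)).sub
      ((by fun_prop : Continuous fun q : ℝ × ℝ => 3 * τ * deriv ψ q.1 ^ 2).mul
        (hi.pow 4))).continuousOn

/-- Dominated convergence: at each point the expression is continuous in `τ`, and `D (|ψ ∂ₓ²u| +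
|∂ₓu| + |u|)` is a square integrable majorant. -/
lemma IsEigenfunction.tendsto_fluxDeriv (ht : 1 ≤ t) (hu : X.IsEigenfunction t bc u E)
    (hψ : IsCutoff t ψ) {l : Filter ℝ} [l.IsCountablyGenerated] {τ : ℝ → ℝ}
    (hl : Tendsto τ l (𝓝 0)) :
    (∀ᶠ s in l, MemLp (fluxDeriv ψ u (τ s)) 2 (rectMeasure t)) ∧
    MemLp (fluxDeriv ψ u 0) 2 (rectMeasure t) ∧
    Tendsto (fun s => eLpNorm (fluxDeriv ψ u (τ s) - fluxDeriv ψ u 0) 2 (rectMeasure t)) l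
      (𝓝 0) := by
  obtain ⟨δ, D, hδ, hr, hD⟩ := exists_fluxDeriv_bound (M := M) hψ
  have hB := hu.memLp_fluxDeriv_majorant ht hψ D
  have hm : ∀ τ, |τ| ≤ δ → AEStronglyMeasurable (fluxDeriv ψ u τ) (rectMeasure t) := fun τ hτ =>
    (continuousOn_fluxDeriv hψ hu.contDiffOn_rect fun x => by
      linarith [hr τ hτ x]).aestronglyMeasurable (measurableSet_rect t)
  have hev : ∀ᶠ s in l, |τ s| ≤ δ := by
    have := hl.abs
    rw [abs_zero] at this
    exact (this.eventually (gt_mem_nhds hδ)).mono fun s hs => hs.le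
  have h0 : |(0 : ℝ)| ≤ δ := by rw [abs_zero]; exact hδ.le
  have hmem : ∀ τ, |τ| ≤ δ → MemLp (fluxDeriv ψ u τ) 2 (rectMeasure t) := fun τ hτ =>
    hB.mono' (hm τ hτ) (ae_of_all _ fun q => hD u τ hτ q)
  refine ⟨hev.mono fun s hs => hmem _ hs, hmem 0 h0, ?_⟩
  refine tendsto_eLpNorm_sub_of_dominated (hev.mono fun s hs => hm _ hs) (hm 0 h0) hB
    (hev.mono fun s hs => ae_of_all _ fun q => hD u _ hs q) (ae_of_all _ fun q => hD u 0 h0 q)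
    (ae_of_all _ fun q => ?_)
  have hc : ContinuousAt (fun τ => fluxDeriv ψ u τ q) 0 := by
    have hi : ContinuousAt (fun τ : ℝ => (1 + τ * ψ q.1)⁻¹) 0 :=
      ContinuousAt.inv₀ (by fun_prop) (by simp)
    unfold fluxDeriv
    fun_prop
  exact hc.tendsto.comp hl

lemma tendsto_stretchFlux_of_isApprox {r : ℝ → ℝ} {f : ℕ → M ⊕ ℝ × ℝ → ℝ} (ht : 1 ≤ t)
    (hJ : IsStretch t s J r) (hf : X.IsApprox t bc f u)
    (hu : ContDiffOn ℝ ∞ (fun q => u (Sum.inr q))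
      (xRange t ×ˢ Ioo (-(Real.pi / 2)) (Real.pi / 2))) :
    MemLp (stretchFlux r u) 2 (rectMeasure t) ∧
      Tendsto (fun n => eLpNorm (stretchFlux r (f n) - stretchFlux r u) 2 (rectMeasure t)) atTop
        (𝓝 0) := by
  obtain ⟨C, hC0, hC⟩ := hJ.isEndWeight_deriv.exists_bound
  obtain ⟨D, hD0, hD⟩ := hJ.isEndWeight_inv_deriv.exists_bound
  obtain ⟨ux, uxl⟩ := hf.tendsto_rectDirDeriv ht hu
  have hc : Continuous (deriv r) := (contDiff_infty_iff_deriv.1 hJ.smooth_deriv).2.continuous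
  have hi : Continuous fun x => (r x)⁻¹ := hJ.isEndWeight_inv_deriv.smooth.continuous
  have m1 : AEStronglyMeasurable (fun q : ℝ × ℝ => (r q.1)⁻¹ ^ 2 - 1) (rectMeasure t) :=
    (((hi.comp continuous_fst).pow 2).sub continuous_const).aestronglyMeasurable
  have m2 : AEStronglyMeasurable (fun q : ℝ × ℝ => deriv r q.1 * (r q.1)⁻¹ ^ 3) (rectMeasure t) :=
    ((hc.comp continuous_fst).mul ((hi.comp continuous_fst).pow 3)).aestronglyMeasurable
  have b1 : ∀ q : ℝ × ℝ, |(r q.1)⁻¹ ^ 2 - 1| ≤ D ^ 2 + 1 := fun q => by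
    refine (abs_sub _ _).trans ?_
    rw [abs_pow, abs_one]
    gcongr
    exact (hD _).1
  have b2 : ∀ q : ℝ × ℝ, |deriv r q.1 * (r q.1)⁻¹ ^ 3| ≤ C * D ^ 3 := fun q => by
    rw [abs_mul, abs_pow]
    gcongr
    · exact (hC _).2
    · exact (hD _).1
  refine ⟨(memLp_bdd_mul ux m1 b1).sub (memLp_bdd_mul (memLp_inr hf.memLp) m2 b2), ?_⟩
  have hlim := (ENNReal.Tendsto.const_mul uxl
      (Or.inr (ENNReal.ofReal_ne_top (r := D ^ 2 + 1)))).add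
    (ENNReal.Tendsto.const_mul hf.tendsto_inr (Or.inr (ENNReal.ofReal_ne_top (r := C * D ^ 3))))
  rw [mul_zero, mul_zero, add_zero] at hlim
  refine tendsto_of_tendsto_of_tendsto_of_le_of_le tendsto_const_nhds hlim (fun _ => zero_le)
    fun n => ?_
  have k1 := ((hf.isSmooth n).memLp_rectDirDeriv ht (1, 0) 2).sub ux
  have k2 := (memLp_inr (hf.memLp_seq ht n)).sub (memLp_inr hf.memLp)
  have e : stretchFlux r (f n) - stretchFlux r u =
      (fun q => ((r q.1)⁻¹ ^ 2 - 1) * (rectDirDeriv (1, 0) (f n) - rectDirDeriv (1, 0) u) q) -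
      fun q => deriv r q.1 * (r q.1)⁻¹ ^ 3 *
        ((fun q => f n (Sum.inr q)) - fun q => u (Sum.inr q)) q := by
    funext q
    simp only [stretchFlux, Pi.sub_apply]
    ring
  rw [e]
  refine (eLpNorm_sub_le (memLp_bdd_mul k1 m1 b1).1 (memLp_bdd_mul k2 m2 b2).1
    (by norm_num)).trans (add_le_add ?_ ?_)
  · refine eLpNorm_le_mul_eLpNorm_of_ae_le_mul (ae_of_all _ fun q => ?_) 2
    rw [norm_mul]
    exact mul_le_mul_of_nonneg_right (b1 q) (norm_nonneg _)
  · refine eLpNorm_le_mul_eLpNorm_of_ae_le_mul (ae_of_all _ fun q => ?_) 2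
    rw [norm_mul]
    exact mul_le_mul_of_nonneg_right (b2 q) (norm_nonneg _)

/-- The difference of the eigenvalues on `X_t` and `X_s`. -/
lemma IsEigenfunction.sub_mul_integral_eq (ht : 1 ≤ t) (hs : 1 ≤ s) (hψ : IsCutoff t ψ)
    (hJ : IsStretch t s J fun x => 1 + (s - t) * ψ x) (hu : X.IsEigenfunction t bc u E)
    (hv : X.IsEigenfunction s bc v E')
    (hm : MemLp (fluxDeriv ψ u (s - t)) 2 (rectMeasure t)) :
    (E' - E) * ∫ z, transport (fun _ => 1) J v z * u z ∂(X.vol t) =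
      -((s - t) * ∫ q, transport (fun _ => 1) J v (Sum.inr q) * fluxDeriv ψ u (s - t) q
        ∂(rectMeasure t)) := by
  obtain ⟨f, h, hf, hh, hlim⟩ := hu.tendsto_stretchFlux ht hs hJ hv
  have hwcd := contDiffOn_transport hJ (m := fun _ => 1) contDiff_const hv.contDiffOn_rect
  obtain ⟨hx, hxl⟩ := hh.tendsto_rectDirDeriv ht hwcd
  obtain ⟨fx, fxl⟩ := tendsto_stretchFlux_of_isApprox ht hJ hf hu.contDiffOn_rect
  have h1 := tendsto_integral_mul (fun n => (hh.isSmooth n).memLp_rectDirDeriv ht _ 2)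
    (fun n => (hf.isSmooth n).memLp_stretchFlux ht hJ) hx fx hxl fxl
  rw [tendsto_nhds_unique hlim h1]
  have hne : ∀ x, 1 + (s - t) * ψ x ≠ 0 := fun x => (hJ.pos x).ne'
  have hr' : ∀ x, deriv (fun x => 1 + (s - t) * ψ x) x = (s - t) * deriv ψ x := fun x =>
    (((hψ.hasDerivAt x).const_mul (s - t)).const_add 1).deriv
  have hmw := memLp_inr hh.memLp
  have i2 : Integrable (fun q => transport (fun _ => 1) J v (Sum.inr q) *
      ((s - t) * fluxDeriv ψ u (s - t) q)) (rectMeasure t) :=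
    hmw.integrable_mul (hm.const_mul (s - t))
  -- The derivative is moved away from the transported `v`, because as `s → t` only its `L²`
  -- convergence is at hand, not that of its `x`-derivative. The flux has the compact `x`-support of
  -- `ψ`, so no boundary terms arise.
  rw [integral_rectDirDeriv_mul hψ.compact.isCompact hψ.subset hwcd
    (fun q hq => hasDerivAt_stretchFlux hψ hu.contDiffOn_rect hne hq) ?_
    (hx.integrable_mul fx) i2]
  · rw [← integral_const_mul]
    congr 1
    refine integral_congr_ae (ae_of_all _ fun q => ?_)
    simp only
    ring
  · intro q hq hqC
    have z0 : ψ q.1 = 0 := image_eq_zero_of_notMem_tsupport hqC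
    have z1 : deriv ψ q.1 = 0 :=
      image_eq_zero_of_notMem_tsupport fun h => hqC (tsupport_deriv_subset h)
    simp [stretchFlux, hr', z0, z1]

end PartiallyRectangularDomain

/-! ### The derivative of the eigenvalue. -/

namespace PartiallyRectangularDomain

variable {M : Type*} [TopologicalSpace M] [T2Space M] [SecondCountableTopology M]
  [ChartedSpace (EuclideanSpace ℝ (Fin 2)) M]
  [IsManifold (𝓡 2) ∞ M] [MeasurableSpace M] [BorelSpace M]
variable {X : PartiallyRectangularDomain M} {t s : ℝ} {φ ψ J : ℝ → ℝ} {u v : M ⊕ ℝ × ℝ → ℝ}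
  {bc : BoundaryCondition} {E E' : ℝ}

/-- The derivative of an eigenvalue along a family that depends smoothly on `t`. -/
lemma hasDerivWithinAt_eigenvalue (hφ : IsProfile φ) {a b : ℝ} {u : ℝ → M ⊕ ℝ × ℝ → ℝ}
    {E : ℝ → ℝ} (ha : 1 ≤ a) (heig : ∀ t ∈ Icc a b, X.IsEigenfunction t bc (u t) (E t))
    (hnorm : ∀ t ∈ Icc a b, ∫ z, u t z ^ 2 ∂(X.vol t) = 1) (hdep : DependsSmoothly X φ a b u)
    (ht : t ∈ Icc a b) (hψ : IsCutoff t ψ) {K : ℝ → ℝ} (hK : ∀ x, K (stretch φ t x) = x)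
    (hJ : ∀ s, 1 ≤ s → IsStretch t s (fun x => stretch φ s (K x)) (fun x => 1 + (s - t) * ψ x)) :
    HasDerivWithinAt E (-∫ q, u t (Sum.inr q) * fluxDeriv ψ (u t) 0 q ∂(rectMeasure t))
      (Icc a b) t := by
  have ht1 : 1 ≤ t := ha.trans ht.1
  have hut := heig t ht
  set w : ℝ → M ⊕ ℝ × ℝ → ℝ := fun s =>
    transport (fun _ => 1) (fun x => stretch φ s (K x)) (u s) with hw
  rw [hasDerivWithinAt_iff_tendsto_slope]
  set l := 𝓝[Icc a b \ {t}] t with hl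
  have hsub : l ≤ 𝓝[Icc a b] t := nhdsWithin_mono t sdiff_subset
  have hmem : ∀ᶠ s in l, s ∈ Icc a b ∧ s ≠ t := by
    filter_upwards [self_mem_nhdsWithin] with s hs using ⟨hs.1, hs.2⟩
  have hwm : ∀ᶠ s in l, MemLp (w s) 2 (X.vol t) := by
    filter_upwards [hmem] with s hs
    exact memLp_transport (hJ s (ha.trans hs.1.1)) (isEndWeight_one t) (heig s hs.1).memLp
  have hwl : Tendsto (fun s => eLpNorm (w s - u t) 2 (X.vol t)) l (𝓝 0) :=
    (tendsto_transport_of_dependsSmoothly hφ ha hdep ht hK).mono_left hsub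
  have hwl' : Tendsto (fun s => eLpNorm ((fun q => w s (Sum.inr q)) - fun q => u t (Sum.inr q)) 2
      (rectMeasure t)) l (𝓝 0) :=
    tendsto_of_tendsto_of_tendsto_of_le_of_le tendsto_const_nhds hwl (fun _ => zero_le)
      fun s => eLpNorm_inr_le X t (w s - u t) 2
  have hτ : Tendsto (fun s => s - t) l (𝓝 0) := by
    have : Continuous fun s => s - t := by fun_prop
    have h := this.tendsto t
    rw [sub_self] at h
    exact h.mono_left nhdsWithin_le_nhds
  obtain ⟨f1, f2, f3⟩ := hut.tendsto_fluxDeriv ht1 hψ hτ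
  -- `⟨w s, u t⟩` tends to `‖u t‖² = 1`, so it is nonzero for `s` near `t` and may be divided out.
  have hc := tendsto_integral_mul_of_eventually (G := fun _ => u t) hwm
    (Eventually.of_forall fun _ => hut.memLp) hut.memLp hut.memLp hwl
    (by simpa using tendsto_const_nhds)
  have hd := tendsto_integral_mul_of_eventually (hwm.mono fun s hs => memLp_inr hs) f1
    (memLp_inr hut.memLp) f2 hwl' f3
  have hone : ∫ z, u t z * u t z ∂(X.vol t) = 1 := by
    rw [← hnorm t ht]
    simp only [sq]
  rw [hone] at hc
  have hlim := (hd.div hc one_ne_zero).neg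
  rw [div_one] at hlim
  refine hlim.congr' ?_
  filter_upwards [hmem, f1, hc.eventually_ne one_ne_zero] with s hs hsm hne
  have hs1 : 1 ≤ s := ha.trans hs.1.1
  have key := hut.sub_mul_integral_eq ht1 hs1 hψ (hJ s hs1) (heig s hs.1) hsm
  have hst : s - t ≠ 0 := sub_ne_zero.2 hs.2
  change (E s - E t) * ∫ z, w s z * u t z ∂(X.vol t) = _ at key
  change -((∫ q, w s (Sum.inr q) * fluxDeriv ψ (u t) (s - t) q ∂(rectMeasure t)) /
    ∫ z, w s z * u t z ∂(X.vol t)) = _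
  rw [slope_def_field, eq_div_iff hst, ← neg_div, div_mul_eq_mul_div, div_eq_iff hne, key]
  ring

/-! ### The operator `Q` -/

lemma dX_congr {F G : ℝ × ℝ → ℝ}
    (h : ∀ q ∈ xRange t ×ˢ Ioo (-(Real.pi / 2)) (Real.pi / 2), F q = G q) {q : ℝ × ℝ}
    (hq : q ∈ xRange t ×ˢ Ioo (-(Real.pi / 2)) (Real.pi / 2)) : dX F q = dX G q := by
  refine Filter.EventuallyEq.deriv_eq ?_
  filter_upwards [(xRange_isOpen t).mem_nhds hq.1] with x hx using h (x, q.2) ⟨hx, hq.2⟩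

lemma dX_eq_rectDirDeriv
    (hu : ContDiffOn ℝ ∞ (fun q => u (Sum.inr q))
      (xRange t ×ˢ Ioo (-(Real.pi / 2)) (Real.pi / 2))) {q : ℝ × ℝ}
    (hq : q ∈ xRange t ×ˢ Ioo (-(Real.pi / 2)) (Real.pi / 2)) :
    dX (fun q => u (Sum.inr q)) q = rectDirDeriv (1, 0) u q :=
  (hasDerivAt_rectDirDeriv ((hu.contDiffAt ((isOpen_rect t).mem_nhds hq)).differentiableAt
    (by simp))).deriv

lemma dX_mul (hψ : IsCutoff t ψ) {F : ℝ × ℝ → ℝ}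
    (hF : ContDiffOn ℝ ∞ F (xRange t ×ˢ Ioo (-(Real.pi / 2)) (Real.pi / 2))) {q : ℝ × ℝ}
    (hq : q ∈ xRange t ×ˢ Ioo (-(Real.pi / 2)) (Real.pi / 2)) :
    dX (fun q => ψ q.1 * F q) q = deriv ψ q.1 * F q + ψ q.1 * dX F q :=
  ((hψ.hasDerivAt q.1).mul (hasDerivAt_dX hF hq)).deriv

/-- In the open rectangle `[∂ₓ, ψ]` is multiplication by `ψ'`, and a second commutator gives
multiplication by `ψ''`; hence `Qu = -4 ∂ₓ(ψ ∂ₓu) - ψ'' u` there. -/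
lemma operatorQ_inr (hψ : IsCutoff t ψ) (hψφ : ∀ q, stretchedProfile φ t q = ψ q.1)
    (hu : ContDiffOn ℝ ∞ (fun q => u (Sum.inr q))
      (xRange t ×ˢ Ioo (-(Real.pi / 2)) (Real.pi / 2))) {q : ℝ × ℝ}
    (hq : q ∈ xRange t ×ˢ Ioo (-(Real.pi / 2)) (Real.pi / 2)) :
    operatorQ φ t u (Sum.inr q) = -4 * (deriv ψ q.1 * rectDirDeriv (1, 0) u q) -
      4 * (ψ q.1 * dX (rectDirDeriv (1, 0) u) q) - deriv (deriv ψ) q.1 * u (Sum.inr q) := by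
  have hprof : stretchedProfile φ t = fun q => ψ q.1 := funext hψφ
  have hu1 := contDiffOn_rectDirDeriv hu (1, 0)
  set F : ℝ × ℝ → ℝ := fun q => u (Sum.inr q) with hF
  have hdF : ∀ q ∈ xRange t ×ˢ Ioo (-(Real.pi / 2)) (Real.pi / 2),
      dX F q = rectDirDeriv (1, 0) u q := fun q hq => dX_eq_rectDirDeriv hu hq
  have hdFc : ContDiffOn ℝ ∞ (dX F) (xRange t ×ˢ Ioo (-(Real.pi / 2)) (Real.pi / 2)) :=
    hu1.congr hdF
  have hcomm : ∀ {G : ℝ × ℝ → ℝ},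
      ContDiffOn ℝ ∞ G (xRange t ×ˢ Ioo (-(Real.pi / 2)) (Real.pi / 2)) →
      ∀ q ∈ xRange t ×ˢ Ioo (-(Real.pi / 2)) (Real.pi / 2),
        opCommutator dX (mulOp fun q => ψ q.1) G q = deriv ψ q.1 * G q := fun {G} hG q hq => by
    simp only [opCommutator, Pi.sub_apply]
    unfold mulOp
    rw [dX_mul hψ hG hq]
    ring
  simp only [operatorQ, Sum.elim_inr, hprof]
  change -4 * dX (mulOp (fun q => ψ q.1) (dX F)) q -
    (dX (opCommutator dX (mulOp fun q => ψ q.1) F) q -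
      opCommutator dX (mulOp fun q => ψ q.1) (dX F) q) = _
  rw [hcomm hdFc q hq, dX_congr (hcomm hu) hq, dX_mul hψ.deriv hu hq, hdF q hq]
  unfold mulOp
  rw [dX_mul hψ hdFc hq, hdF q hq, dX_congr hdF hq]
  ring

/-- `Qu` is itself in `L²`, because `ψ ∂ₓ²u` is, and it vanishes on `W`. -/
lemma IsEigenfunction.integrable_operatorQ (ht : 1 ≤ t) (hu : X.IsEigenfunction t bc u E)
    (hψ : IsCutoff t ψ) (hψφ : ∀ q, stretchedProfile φ t q = ψ q.1) :
    Integrable (fun z => operatorQ φ t u z * u z) (X.vol t) ∧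
    ∫ z, operatorQ φ t u z * u z ∂(X.vol t) = ∫ q, u (Sum.inr q) *
      (-4 * (deriv ψ q.1 * rectDirDeriv (1, 0) u q + ψ q.1 * dX (rectDirDeriv (1, 0) u) q) -
        deriv (deriv ψ) q.1 * u (Sum.inr q)) ∂(rectMeasure t) := by
  obtain ⟨A₁, -, hA₁⟩ := hψ.deriv.exists_bound
  obtain ⟨A₂, -, hA₂⟩ := hψ.deriv.deriv.exists_bound
  have m0 := memLp_inr hu.memLp
  have m1 : MemLp (fun q => deriv ψ q.1 * rectDirDeriv (1, 0) u q) 2 (rectMeasure t) :=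
    memLp_bdd_mul (hu.memLp_rectDirDeriv ht)
      (hψ.deriv.smooth.continuous.comp continuous_fst).aestronglyMeasurable fun q => hA₁ q.1
  have m2 := hu.memLp_dX_rectDirDeriv ht hψ
  have m3 : MemLp (fun q => deriv (deriv ψ) q.1 * u (Sum.inr q)) 2 (rectMeasure t) :=
    memLp_bdd_mul m0 (hψ.deriv.deriv.smooth.continuous.comp continuous_fst).aestronglyMeasurable
      fun q => hA₂ q.1
  have hi : Integrable (fun q => u (Sum.inr q) *
      (-4 * (deriv ψ q.1 * rectDirDeriv (1, 0) u q + ψ q.1 * dX (rectDirDeriv (1, 0) u) q) -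
        deriv (deriv ψ) q.1 * u (Sum.inr q))) (rectMeasure t) :=
    m0.integrable_mul (((m1.add m2).const_mul (-4)).sub m3)
  have hae : (fun q => u (Sum.inr q) *
      (-4 * (deriv ψ q.1 * rectDirDeriv (1, 0) u q + ψ q.1 * dX (rectDirDeriv (1, 0) u) q) -
        deriv (deriv ψ) q.1 * u (Sum.inr q))) =ᵐ[rectMeasure t]
      fun q => operatorQ φ t u (Sum.inr q) * u (Sum.inr q) := by
    refine (ae_restrict_iff' (measurableSet_rect t)).2 (ae_of_all _ fun q hq => ?_)
    simp only [operatorQ_inr hψ hψφ hu.contDiffOn_rect hq]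
    ring
  have hl : (fun z => operatorQ φ t u z * u z) ∘ (Sum.inl : M → M ⊕ ℝ × ℝ) = fun _ => 0 := by
    funext p
    simp [operatorQ]
  have h1 : Integrable (fun z => operatorQ φ t u z * u z)
      (Measure.map Sum.inl X.restVolume) := by
    rw [measurableEmbedding_inl.integrable_map_iff, hl]
    exact integrable_zero _ _ _
  have h2 : Integrable (fun z => operatorQ φ t u z * u z)
      (Measure.map (Sum.inr : ℝ × ℝ → M ⊕ ℝ × ℝ) (rectMeasure t)) := by
    rw [measurableEmbedding_inr.integrable_map_iff]
    exact hi.congr hae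
  rw [vol_eq]
  refine ⟨h1.add_measure h2, ?_⟩
  rw [integral_add_measure h1 h2, measurableEmbedding_inl.integral_map,
    measurableEmbedding_inr.integral_map, integral_congr_ae hae]
  have : ∫ p, operatorQ φ t u (Sum.inl p) * u (Sum.inl p) ∂X.restVolume = 0 := by
    simp [operatorQ]
  rw [this, zero_add]

/-- The integrands differ by `ψ' u ∂ₓu + ½ ψ'' u² = ½ ∂ₓ(ψ' u²)`, whose integral vanishes because
`ψ'` has compact support in `x`. -/
lemma IsEigenfunction.integral_fluxDeriv_zero (ht : 1 ≤ t) (hu : X.IsEigenfunction t bc u E)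
    (hψ : IsCutoff t ψ) (hψφ : ∀ q, stretchedProfile φ t q = ψ q.1) :
    -∫ q, u (Sum.inr q) * fluxDeriv ψ u 0 q ∂(rectMeasure t) =
      -(1 / 2) * ∫ z, operatorQ φ t u z * u z ∂(X.vol t) := by
  obtain ⟨A₁, -, hA₁⟩ := hψ.deriv.exists_bound
  obtain ⟨A₂, -, hA₂⟩ := hψ.deriv.deriv.exists_bound
  have m0 := memLp_inr hu.memLp
  have m1 : MemLp (fun q => deriv ψ q.1 * rectDirDeriv (1, 0) u q) 2 (rectMeasure t) :=
    memLp_bdd_mul (hu.memLp_rectDirDeriv ht)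
      (hψ.deriv.smooth.continuous.comp continuous_fst).aestronglyMeasurable fun q => hA₁ q.1
  have m2 := hu.memLp_dX_rectDirDeriv ht hψ
  have m3 : MemLp (fun q => deriv (deriv ψ) q.1 * u (Sum.inr q)) 2 (rectMeasure t) :=
    memLp_bdd_mul m0 (hψ.deriv.deriv.smooth.continuous.comp continuous_fst).aestronglyMeasurable
      fun q => hA₂ q.1
  have i1 : Integrable (fun q => u (Sum.inr q) *
      (-4 * (deriv ψ q.1 * rectDirDeriv (1, 0) u q + ψ q.1 * dX (rectDirDeriv (1, 0) u) q) -
        deriv (deriv ψ) q.1 * u (Sum.inr q))) (rectMeasure t) :=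
    m0.integrable_mul (((m1.add m2).const_mul (-4)).sub m3)
  have i2 : Integrable (fun q => u (Sum.inr q) * (2 * (deriv ψ q.1 * rectDirDeriv (1, 0) u q) +
      deriv (deriv ψ) q.1 * u (Sum.inr q))) (rectMeasure t) :=
    m0.integrable_mul ((m1.const_mul 2).add m3)
  have hz : ∫ q, u (Sum.inr q) * (2 * (deriv ψ q.1 * rectDirDeriv (1, 0) u q) +
      deriv (deriv ψ) q.1 * u (Sum.inr q)) ∂(rectMeasure t) = 0 := by
    refine integral_rect_deriv_eq_zero (H := fun q => deriv ψ q.1 * u (Sum.inr q) ^ 2)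
      hψ.deriv.compact.isCompact hψ.deriv.subset (fun q hq => ?_) (fun q hq hqK => ?_) i2
    · have h0 := hasDerivAt_rectDirDeriv (u := u) ((hu.contDiffOn_rect.contDiffAt
        ((isOpen_rect t).mem_nhds hq)).differentiableAt (by simp))
      refine ((hψ.deriv.hasDerivAt q.1).mul (h0.pow 2)).congr_deriv ?_
      simp only [Pi.pow_apply]
      push_cast
      ring
    · simp only [image_eq_zero_of_notMem_tsupport hqK, zero_mul]
  rw [(hu.integrable_operatorQ ht hψ hψφ).2, ← integral_const_mul, ← integral_neg, ← sub_eq_zero]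
  have e : ∀ q, -(u (Sum.inr q) * fluxDeriv ψ u 0 q) = -(1 / 2) * (u (Sum.inr q) *
      (-4 * (deriv ψ q.1 * rectDirDeriv (1, 0) u q + ψ q.1 * dX (rectDirDeriv (1, 0) u) q) -
        deriv (deriv ψ) q.1 * u (Sum.inr q))) + 1 / 2 * (u (Sum.inr q) *
      (2 * (deriv ψ q.1 * rectDirDeriv (1, 0) u q) + deriv (deriv ψ) q.1 * u (Sum.inr q))) :=
    fun q => by rw [fluxDeriv_zero]; ring
  simp only [e]
  rw [integral_add (i1.const_mul _) (i2.const_mul _), integral_const_mul (1 / 2 : ℝ), hz]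
  ring

/-- An upper bound for `-⟨Qu, u⟩ / 2`: its principal part is nonpositive. -/
lemma IsEigenfunction.neg_integral_operatorQ_le (ht : 1 ≤ t) (hu : X.IsEigenfunction t bc u E)
    (hψ : IsCutoff t ψ) (hψ0 : ∀ x, 0 ≤ ψ x) (hψφ : ∀ q, stretchedProfile φ t q = ψ q.1) {B : ℝ}
    (hB : ∀ x, |deriv (deriv ψ) x| ≤ B) :
    -(1 / 2) * ∫ z, operatorQ φ t u z * u z ∂(X.vol t) ≤
      1 / 2 * (B * ∫ z, u z ^ 2 ∂(X.vol t)) := by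
  obtain ⟨A₀, -, hA₀⟩ := hψ.exists_bound
  obtain ⟨A₁, -, hA₁⟩ := hψ.deriv.exists_bound
  have hB0 : 0 ≤ B := (abs_nonneg _).trans (hB 0)
  have m0 := memLp_inr hu.memLp
  have mx := hu.memLp_rectDirDeriv ht
  have mψ : MemLp (fun q => ψ q.1 * rectDirDeriv (1, 0) u q) 2 (rectMeasure t) :=
    memLp_bdd_mul mx (hψ.smooth.continuous.comp continuous_fst).aestronglyMeasurable
      fun q => hA₀ q.1
  have m1 : MemLp (fun q => deriv ψ q.1 * rectDirDeriv (1, 0) u q) 2 (rectMeasure t) :=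
    memLp_bdd_mul mx (hψ.deriv.smooth.continuous.comp continuous_fst).aestronglyMeasurable
      fun q => hA₁ q.1
  have m2 := hu.memLp_dX_rectDirDeriv ht hψ
  have m3 : MemLp (fun q => deriv (deriv ψ) q.1 * u (Sum.inr q)) 2 (rectMeasure t) :=
    memLp_bdd_mul m0 (hψ.deriv.deriv.smooth.continuous.comp continuous_fst).aestronglyMeasurable
      fun q => hB q.1
  have i1 : Integrable (fun q => u (Sum.inr q) * (deriv ψ q.1 * rectDirDeriv (1, 0) u q +
      ψ q.1 * dX (rectDirDeriv (1, 0) u) q)) (rectMeasure t) := m0.integrable_mul (m1.add m2)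
  have i2 : Integrable (fun q => u (Sum.inr q) * (deriv (deriv ψ) q.1 * u (Sum.inr q)))
      (rectMeasure t) := m0.integrable_mul m3
  -- `∫ u ∂ₓ(ψ ∂ₓu) = -∫ ψ (∂ₓu)² ≤ 0`, which is the sign that makes the bound one-sided and
  -- independent of the eigenvalue.
  have hibp := integral_rectDirDeriv_mul (u := u) (G := fun q => ψ q.1 * rectDirDeriv (1, 0) u q)
    hψ.compact.isCompact hψ.subset hu.contDiffOn_rect
    (fun q hq => (hψ.hasDerivAt q.1).mul
      (hasDerivAt_dX (contDiffOn_rectDirDeriv hu.contDiffOn_rect (1, 0)) hq))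
    (fun q hq hqC => by simp only [image_eq_zero_of_notMem_tsupport hqC, zero_mul])
    (mx.integrable_mul mψ) i1
  have hpos : 0 ≤ ∫ q, rectDirDeriv (1, 0) u q * (ψ q.1 * rectDirDeriv (1, 0) u q)
      ∂(rectMeasure t) := integral_nonneg fun q => by
    rw [mul_left_comm]
    exact mul_nonneg (hψ0 _) (mul_self_nonneg _)
  have hle : ∫ q, u (Sum.inr q) * (deriv (deriv ψ) q.1 * u (Sum.inr q)) ∂(rectMeasure t) ≤
      B * ∫ z, u z ^ 2 ∂(X.vol t) := by
    refine le_trans ?_ (mul_le_mul_of_nonneg_left (integral_inr_sq_le hu.memLp) hB0)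
    rw [← integral_const_mul]
    refine integral_mono i2 (m0.integrable_sq.const_mul B) fun q => ?_
    have h1 := mul_le_mul_of_nonneg_right ((le_abs_self _).trans (hB q.1))
      (sq_nonneg (u (Sum.inr q)))
    simp only
    linarith
  rw [(hu.integrable_operatorQ ht hψ hψφ).2]
  have e : ∀ q, u (Sum.inr q) *
      (-4 * (deriv ψ q.1 * rectDirDeriv (1, 0) u q + ψ q.1 * dX (rectDirDeriv (1, 0) u) q) -
        deriv (deriv ψ) q.1 * u (Sum.inr q)) = -4 * (u (Sum.inr q) *
      (deriv ψ q.1 * rectDirDeriv (1, 0) u q + ψ q.1 * dX (rectDirDeriv (1, 0) u) q)) -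
        u (Sum.inr q) * (deriv (deriv ψ) q.1 * u (Sum.inr q)) := fun q => by ring
  simp only [e]
  rw [integral_sub (i1.const_mul _) i2, integral_const_mul]
  linarith

end PartiallyRectangularDomain

end

/-! ### The variation formula and the uniform bound. -/

theorem mainTheorem4 (φ : ℝ → ℝ) (hφ : IsProfile φ) :
    ∃ C : ℝ, ∀ (M : Type*) [TopologicalSpace M] [T2Space M] [SecondCountableTopology M]
      [ChartedSpace (EuclideanSpace ℝ (Fin 2)) M] [IsManifold (𝓡 2) ∞ M]
      [MeasurableSpace M] [BorelSpace M]
      (X : PartiallyRectangularDomain M) (bc : BoundaryCondition)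
      (a b : ℝ) (u : ℝ → M ⊕ ℝ × ℝ → ℝ) (E : ℝ → ℝ),
      1 ≤ a → a < b → b ≤ 2 →
      (∀ t ∈ Icc a b, X.IsEigenfunction t bc (u t) (E t)) →
      (∀ t ∈ Icc a b, ∫ z, u t z ^ 2 ∂(X.vol t) = 1) →
      DependsSmoothly X φ a b u →
      ∀ t ∈ Icc a b,
        Integrable (fun z => operatorQ φ t (u t) z * u t z) (X.vol t) ∧
        HasDerivWithinAt E (-(1 / 2) * ∫ z, operatorQ φ t (u t) z * u t z ∂(X.vol t))
          (Icc a b) t ∧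
        derivWithin E (Icc a b) t ≤ C := by
  obtain ⟨B₁, h10, hB₁⟩ := hφ.isCutoff.deriv.exists_bound
  obtain ⟨B₂, h20, hB₂⟩ := hφ.isCutoff.deriv.deriv.exists_bound
  -- Half of a bound for `|φ_t''|`, with `B₁` and `B₂` bounding `|φ'|` and `|φ''|`. In the formula
  -- for `φ_t''` the denominators are powers of a density at least `1`, and the coefficient `3(t -
  -- 1)` is at most `3` because `t ≤ 2`.
  refine ⟨1 / 2 * (B₂ + 3 * B₁ ^ 2), ?_⟩
  intro M _ _ _ _ _ _ _ X bc a b u E ha hab hb heig hnorm hdep t ht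
  have ht1 : 1 ≤ t := ha.trans ht.1
  have ht2 : t ≤ 2 := ht.2.trans hb
  obtain ⟨K, ψ, hψ, hψ0, hψφ, hK, hJ, hψ2⟩ := hφ.exists_stretched ht1
  have hut := heig t ht
  have hder := X.hasDerivWithinAt_eigenvalue hφ ha heig hnorm hdep ht hψ hK hJ
  rw [hut.integral_fluxDeriv_zero ht1 hψ hψφ] at hder
  refine ⟨(hut.integrable_operatorQ ht1 hψ hψφ).1, hder, ?_⟩
  rw [hder.derivWithin (uniqueDiffOn_Icc hab t ht)]
  have hB : ∀ x, |deriv (deriv ψ) x| ≤ B₂ + 3 * B₁ ^ 2 := fun x => by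
    have hρ := hφ.density_ge_one ht1 (K x)
    rw [hψ2]
    refine (abs_sub _ _).trans (add_le_add ?_ ?_)
    · rw [abs_div, abs_of_pos (by positivity : 0 < (1 + (t - 1) * φ (K x)) ^ 4)]
      exact (div_le_self (abs_nonneg _) (one_le_pow₀ hρ)).trans (hB₂ _)
    · rw [abs_div, abs_of_pos (by positivity : 0 < (1 + (t - 1) * φ (K x)) ^ 5)]
      refine (div_le_self (abs_nonneg _) (one_le_pow₀ hρ)).trans ?_
      rw [abs_mul, abs_mul, abs_of_pos (by norm_num : (0 : ℝ) < 3), abs_pow,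
        abs_of_nonneg (by linarith : 0 ≤ t - 1)]
      have h1 : |deriv φ (K x)| ^ 2 ≤ B₁ ^ 2 := by
        gcongr
        exact hB₁ _
      nlinarith [mul_nonneg (by linarith : 0 ≤ 2 - t) (sq_nonneg |deriv φ (K x)|)]
  have := hut.neg_integral_operatorQ_le ht1 hψ hψ0 hψφ hB
  rwa [hnorm t ht, mul_one] at this
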